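/- Write $B(x_0,r)=\{x\in\mathbb R^n:|x-x_0|<r\}$. For $0<\alpha\le 1$ let $\mathcal C_\alpha$ be the family of functions $\varphi:\mathbb R^n\to\mathbb R$ supported in $\{|x|\le 1\}$ with $\int_{\mathbb R^n}\varphi\,dx=0$ and $|\varphi(x)-\varphi(x')|\le|x-x'|^\alpha$ for all $x,x'\in\mathbb R^n$; put $\varphi_t(x)=t^{-n}\varphi(x/t)$. For $f\in L^1_{loc}(\mathbb R^n)$ (complex-valued) define the intrinsic square function $$\mathcal S_\alpha(f)(x)=\left(\iint_{\{(y,t):\,t>0,\ |x-y|<t\}}\Big(\sup_{\varphi\in\mathcal C_\alpha}\Big|\int_{\mathbb R^n}\varphi_t(y-z)f(z)\,dz\Big|\Big)^2\frac{dy\,dt}{t^{n+1}}\right)^{1/2}\in[0,\infty].$$ Let $\Phi:(0,\infty)\to(0,\infty)$ be increasing (that is, nondecreasing) and satisfy $\Phi(2r)\le D\,\Phi(r)$ for all $r>0$. For $1<p<\infty$ let $L^{p,\Phi}(\mathbb R^n)$ be the space of locally integrable functions $f$ on $\mathbb R^n$ for which there is a finite constant $K\ge 0$ with $\int_{B(x_0,r)}|f|^p\,dx\le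 K^p\,\Phi(r)$ for all $x_0\in\mathbb R^n$ and $r>0$, and let $\|f\|_{L^{p,\Phi}}$ be the smallest such $K$. **Theorem 1.1.** Let $0<\alpha\le 1$, $1<p<\infty$, and let $\Phi$ be as above with $1\le D<2^n$. Then there is a constant $C>0$, independent of $f$, such that for every $f\in L^{p,\Phi}(\mathbb R^n)$ one has $\mathcal S_\alpha(f)\in L^{p,\Phi}(\mathbb R^n)$ and $$\|\mathcal S_\alpha(f)\|_{L^{p,\Phi}}\le C\,\|f\|_{L^{p,\Phi}}.$$ -/

import Mathlib

open MeasureTheory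

noncomputable section

/-- `ℝⁿ` with its Euclidean norm and Lebesgue measure. -/
abbrev Rn (n : ℕ) : Type := EuclideanSpace ℝ (Fin n)

/-- The class `𝒞_α`: real functions on `ℝⁿ` supported in the closed unit ball, with vanishing
integral, and `α`-Hölder with constant `1`. (Such functions are continuous with compact support.) -/
structure IsHolderBump {n : ℕ} (α : ℝ) (φ : Rn n → ℝ) : Prop where
  support_subset : Function.support φ ⊆ Metric.closedBall 0 1
  integral_eq_zero : ∫ x, φ x = 0
  holder : ∀ x x' : Rn n, |φ x - φ x'| ≤ ‖x - x'‖ ^ α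

/-- The dilation `φ_t(x) = t⁻ⁿ φ(x / t)`. -/
def dilate {n : ℕ} (φ : Rn n → ℝ) (t : ℝ) (x : Rn n) : ℝ :=
  (t ^ n)⁻¹ * φ (t⁻¹ • x)

/-- `A_α(f)(y,t) = sup_{φ ∈ 𝒞_α} |∫ φ_t(y - z) f(z) dz|`, a supremum in `[0, ∞]`. -/
def intrinsicA {n : ℕ} (α : ℝ) (f : Rn n → ℂ) (y : Rn n) (t : ℝ) : ENNReal :=
  ⨆ (φ : Rn n → ℝ) (_ : IsHolderBump α φ), ‖∫ z, (dilate φ t (y - z) : ℂ) * f z‖ₑ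

/-- The cone `Γ(x) = {(y,t) : t > 0, |x - y| < t}` of aperture one. -/
def cone {n : ℕ} (x : Rn n) : Set (Rn n × ℝ) :=
  {q | 0 < q.2 ∧ ‖x - q.1‖ < q.2}

/-- The intrinsic square function
`S_α(f)(x) = (∬_{Γ(x)} A_α(f)(y,t)² dy dt / t^{n+1})^{1/2}`, with values in `[0, ∞]`. -/
def intrinsicSquare {n : ℕ} (α : ℝ) (f : Rn n → ℂ) (x : Rn n) : ENNReal :=
  (∫⁻ q in cone x, intrinsicA α f q.1 q.2 ^ 2 / ENNReal.ofReal (q.2 ^ (n + 1))) ^ (1 / 2 : ℝ)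

/-- A growth function: positive and increasing on `(0, ∞)`, with doubling constant `D`. -/
structure IsGrowthFunction (Φ : ℝ → ℝ) (D : ℝ) : Prop where
  pos : ∀ r, 0 < r → 0 < Φ r
  mono : MonotoneOn Φ (Set.Ioi 0)
  doubling : ∀ r, 0 < r → Φ (2 * r) ≤ D * Φ r

/-- The generalized Morrey norm: the smallest `K ∈ [0, ∞]` such that
`∫_{B(x₀,r)} |f|^p ≤ K^p Φ(r)` for every ball. It is used both for complex-valued functions and for
`[0, ∞]`-valued ones (where `‖a‖ₑ = a`). -/
def morreyNorm {n : ℕ} {ε : Type*} [ENorm ε] (p : ℝ) (Φ : ℝ → ℝ) (f : Rn n → ε) : ENNReal :=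
  sInf {K : ENNReal | ∀ (x₀ : Rn n) (r : ℝ), 0 < r →
    ∫⁻ x in Metric.ball x₀ r, ‖f x‖ₑ ^ p ≤ K ^ p * ENNReal.ofReal (Φ r)}

/-- Membership in the generalized Morrey space `L^{p,Φ}(ℝⁿ)`. -/
def MemMorrey {n : ℕ} {ε : Type*} [TopologicalSpace ε] [ContinuousENorm ε]
    (p : ℝ) (Φ : ℝ → ℝ) (f : Rn n → ε) : Prop :=
  LocallyIntegrable f volume ∧ morreyNorm p Φ f < ⊤

end

/-!
# The intrinsic square function on generalized Morrey spaces

Write `A f (y, t)` for the supremum over bumps `intrinsicA α f y t`. It satisfies three elementary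
facts: it depends only on `f` restricted to `ball y t`, it is subadditive in `f`, and it is at most
`2 t⁻ⁿ ∫_{ball y t} |f|`.

**The case `p = 2`.** Cut the upper half-space into dyadic Whitney boxes and choose one bump at one
point of each box. The Hölder condition and the cancellation make these bumps almost orthogonal
(`abs_integral_dilate_mul_dilate_le`), so Schur's test in `L²` (`sum_mul_norm_inner_sq_le`) bounds
the sum of squared coefficients by `‖f‖₂²`, uniformly in the choice; hence the same bound holds for
the suprema over bumps, and `∬ (A f)² dy dt / t ≤ C ‖f‖₂²` (`exists_lintegral_intrinsicA_sq_le`).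

**The case `p > 2`.** By Fubini, `∫ (S f)² w` is the integral of `(A f)²` against the averages of `w`
over `ball y t`. If such an average exceeds `λ`, then the whole ball lies in `{M w > λ}`, so `f` may
be replaced there by its restriction to that set. Applying the `L²` bound for each `λ` and
integrating gives `∫ (S f)² w ≤ C ∫ |f|² M w` (`exists_lintegral_intrinsicSquare_sq_mul_le`), with
`M` the Hardy–Littlewood maximal operator; duality and the boundedness of `M` then give `Lᵖ`.

**The case `1 < p < 2`.** A Calderón–Zygmund argument in which averaging at a variable scale takes
the place of a decomposition into cubes. At height `a`, let `F = {M f ≤ a}`. Outside `F` replace `f`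
by its spread `smear δ f`, the mass at `z` being distributed evenly over a ball of radius
`δ z = dist (z, F) / 4`. The spread function is bounded by a multiple of `a`, and the Hölder
condition controls the error `b` by `tailMajorant`, whose total mass is at most
`C ∫_{Fᶜ} |f|` and which is at most `C a` on the cones over `F`; so
`∬ (A b)²` over those cones is at most `C a ∫_{Fᶜ} |f|`. This bounds `∫_F (S f)²`
(`exists_setLIntegral_intrinsicSquare_sq_le`), and integration over `a` gives the `Lᵖ` bound.

**Morrey spaces.** On a ball of radius `r` split `f` at the concentric ball of radius `2 r`. The `Lᵖ`
bound handles the near part. The far part meets the cones only at scales `t ≥ r / 2`, where Hölder's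
inequality gives `A f (y, t) ≤ C K (Φ(t) / tⁿ)^(1/p)`; since `D < 2ⁿ`, these bounds decay
geometrically along dyadic scales (`exists_intrinsicSquare_far_le`).
-/

open Set Metric Filter Topology
open scoped ENNReal

section

variable {n : ℕ} {α : ℝ}

/-! ### Bumps, their dilates, and the supremum over bumps -/

/-- A bump vanishes on the unit sphere as well, by continuity from outside the ball. -/
theorem IsHolderBump.eq_zero_of_one_le {φ : Rn n → ℝ} (hφ : IsHolderBump α φ) (hα : 0 < α)
    {x : Rn n} (hx : 1 ≤ ‖x‖) : φ x = 0 := by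
  have key : ∀ s : ℝ, 0 < s → |φ x| ≤ (s * ‖x‖) ^ α := by
    intro s hs
    have h0 : φ ((1 + s) • x) = 0 := by
      by_contra h
      have := hφ.support_subset (show _ ∈ Function.support φ from h)
      rw [mem_closedBall_zero_iff, norm_smul, Real.norm_of_nonneg (by positivity)] at this
      nlinarith
    have h1 := hφ.holder x ((1 + s) • x)
    rw [h0, sub_zero] at h1
    have h2 : ‖x - (1 + s) • x‖ = s * ‖x‖ := by
      have : x - (1 + s) • x = -(s • x) := by rw [add_smul, one_smul]; abel
      rw [this, norm_neg, norm_smul, Real.norm_of_nonneg hs.le]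
    rwa [h2] at h1
  -- let the outside point tend to `x`
  have hlim : Tendsto (fun s : ℝ => (s * ‖x‖) ^ α) (𝓝[>] 0) (𝓝 0) := by
    have : Tendsto (fun s : ℝ => (s * ‖x‖) ^ α) (𝓝 0) (𝓝 ((0 * ‖x‖) ^ α)) :=
      ((continuous_id.mul continuous_const).tendsto (0 : ℝ)).rpow_const (Or.inr hα.le)
    rw [zero_mul, Real.zero_rpow hα.ne'] at this
    exact this.mono_left nhdsWithin_le_nhds
  have : |φ x| ≤ 0 := ge_of_tendsto hlim (by
    filter_upwards [self_mem_nhdsWithin] with s hs using key s hs)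
  exact abs_nonpos_iff.1 this

/-- Compare `φ x` with the value at a point at distance `2`, which lies outside the unit ball; such a
point exists because the space is not reduced to a point. -/
theorem IsHolderBump.abs_le_two [Nontrivial (Rn n)] {φ : Rn n → ℝ} (hφ : IsHolderBump α φ)
    (hα : 0 < α) (hα1 : α ≤ 1) (x : Rn n) : |φ x| ≤ 2 := by
  by_cases hx : 1 ≤ ‖x‖
  · simp [hφ.eq_zero_of_one_le hα hx]
  push Not at hx
  obtain ⟨u, hu⟩ := exists_norm_eq (Rn n) (zero_le_two (α := ℝ))
  have h0 : φ (x + u) = 0 := by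
    apply hφ.eq_zero_of_one_le hα
    have := norm_sub_le (x + u) x
    rw [add_sub_cancel_left, hu] at this
    linarith
  have h1 := hφ.holder x (x + u)
  rw [h0, sub_zero, sub_add_cancel_left, norm_neg, hu] at h1
  refine h1.trans ?_
  calc (2 : ℝ) ^ α ≤ 2 ^ (1 : ℝ) := Real.rpow_le_rpow_of_exponent_le (by norm_num) hα1
    _ = 2 := Real.rpow_one 2

theorem IsHolderBump.continuous {φ : Rn n → ℝ} (hφ : IsHolderBump α φ) (hα : 0 < α) :
    Continuous φ := by
  rw [continuous_iff_continuousAt]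
  intro x
  rw [ContinuousAt, tendsto_iff_dist_tendsto_zero]
  have hlim : Tendsto (fun y : Rn n => ‖y - x‖ ^ α) (𝓝 x) (𝓝 0) := by
    have : Tendsto (fun y : Rn n => ‖y - x‖ ^ α) (𝓝 x) (𝓝 (‖x - x‖ ^ α)) :=
      (((continuous_id.sub continuous_const).norm).tendsto x).rpow_const (Or.inr hα.le)
    rwa [sub_self, norm_zero, Real.zero_rpow hα.ne'] at this
  exact squeeze_zero (fun _ => dist_nonneg) (fun y => by
    rw [Real.dist_eq]; exact hφ.holder y x) hlim

theorem isHolderBump_zero : IsHolderBump α (0 : Rn n → ℝ) where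
  support_subset := by simp
  integral_eq_zero := by simp
  holder x x' := by simp; positivity

theorem dilate_eq_zero {φ : Rn n → ℝ} (hφ : IsHolderBump α φ) (hα : 0 < α) {t : ℝ} (ht : 0 < t)
    {x : Rn n} (hx : t ≤ ‖x‖) : dilate φ t x = 0 := by
  rw [dilate, hφ.eq_zero_of_one_le hα, mul_zero]
  rw [norm_smul, Real.norm_of_nonneg (by positivity), inv_mul_eq_div, le_div_iff₀ ht, one_mul]
  exact hx

theorem abs_dilate_le [Nontrivial (Rn n)] {φ : Rn n → ℝ} (hφ : IsHolderBump α φ) (hα : 0 < α)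
    (hα1 : α ≤ 1) {t : ℝ} (ht : 0 < t) (x : Rn n) : |dilate φ t x| ≤ 2 * (t ^ n)⁻¹ := by
  rw [dilate, abs_mul, abs_of_nonneg (by positivity), mul_comm]
  exact mul_le_mul_of_nonneg_right (hφ.abs_le_two hα hα1 _) (by positivity)

theorem abs_dilate_sub_le {φ : Rn n → ℝ} (hφ : IsHolderBump α φ) {t : ℝ} (ht : 0 < t)
    (x x' : Rn n) : |dilate φ t x - dilate φ t x'| ≤ (t ^ n)⁻¹ * (‖x - x'‖ / t) ^ α := by
  rw [dilate, dilate, ← mul_sub, abs_mul, abs_of_nonneg (by positivity)]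
  refine mul_le_mul_of_nonneg_left ((hφ.holder _ _).trans_eq ?_) (by positivity)
  rw [← smul_sub, norm_smul, Real.norm_of_nonneg (by positivity), inv_mul_eq_div]

theorem continuous_dilate {φ : Rn n → ℝ} (hφ : IsHolderBump α φ) (hα : 0 < α) (t : ℝ) :
    Continuous (dilate φ t) :=
  continuous_const.mul ((hφ.continuous hα).comp (continuous_const_smul _))

theorem integral_dilate {φ : Rn n → ℝ} (hφ : IsHolderBump α φ) (t : ℝ) :
    ∫ x, dilate φ t x = 0 := by
  simp only [dilate]
  rw [integral_const_mul, Measure.integral_comp_smul volume φ, hφ.integral_eq_zero, smul_zero,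
    mul_zero]

theorem volume_ball_eq [Nontrivial (Rn n)] (x : Rn n) {r : ℝ} (hr : 0 ≤ r) :
    volume (ball x r) = ENNReal.ofReal (r ^ n) * volume (ball (0 : Rn n) 1) := by
  rw [Measure.addHaar_ball volume x hr, finrank_euclideanSpace_fin]

theorem volume_unitBall_pos : 0 < volume (ball (0 : Rn n) 1) := measure_ball_pos _ _ one_pos

theorem volume_unitBall_ne_top : volume (ball (0 : Rn n) 1) ≠ ⊤ := measure_ball_lt_top.ne

/-- A dilated bump is dominated by a multiple of the indicator of a ball. -/
theorem enorm_dilate_le [Nontrivial (Rn n)] {φ : Rn n → ℝ} (hφ : IsHolderBump α φ) (hα : 0 < α)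
    (hα1 : α ≤ 1) {t : ℝ} (ht : 0 < t) (y z : Rn n) :
    ‖(dilate φ t (y - z) : ℂ)‖ₑ ≤
      (ball y t).indicator (fun _ => ENNReal.ofReal (2 * (t ^ n)⁻¹)) z := by
  by_cases hz : z ∈ ball y t
  · rw [indicator_of_mem hz, ← ofReal_norm, Complex.norm_real]
    exact ENNReal.ofReal_le_ofReal (abs_dilate_le hφ hα hα1 ht _)
  · rw [dilate_eq_zero hφ hα ht]
    · simp
    · rw [mem_ball', dist_eq_norm] at hz; exact not_lt.1 hz

theorem integrable_dilate_mul {φ : Rn n → ℝ} (hφ : IsHolderBump α φ)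
    (hα : 0 < α) {t : ℝ} (ht : 0 < t) (y : Rn n) {f : Rn n → ℂ}
    (hf : LocallyIntegrable f volume) :
    Integrable (fun z => (dilate φ t (y - z) : ℂ) * f z) := by
  have hc : Continuous (fun z => (dilate φ t (y - z) : ℂ)) :=
    Complex.continuous_ofReal.comp ((continuous_dilate hφ hα t).comp (continuous_const.sub
      continuous_id))
  have := hf.integrable_smul_left_of_hasCompactSupport hc (by
    apply HasCompactSupport.of_support_subset_isCompact (isCompact_closedBall y t)
    intro z hz
    by_contra h
    apply hz
    simp only
    rw [dilate_eq_zero hφ hα ht, Complex.ofReal_zero]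
    rw [mem_closedBall', dist_eq_norm] at h; exact (not_le.1 h).le)
  simpa using this

theorem intrinsicA_le [Nontrivial (Rn n)] (hα : 0 < α) (hα1 : α ≤ 1) (f : Rn n → ℂ) (y : Rn n)
    {t : ℝ} (ht : 0 < t) :
    intrinsicA α f y t ≤ ENNReal.ofReal (2 * (t ^ n)⁻¹) * ∫⁻ z in ball y t, ‖f z‖ₑ := by
  refine iSup₂_le fun φ hφ => (enorm_integral_le_lintegral_enorm _).trans ?_
  rw [← lintegral_const_mul' _ _ ENNReal.ofReal_ne_top, ← lintegral_indicator measurableSet_ball]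
  refine lintegral_mono fun z => ?_
  rw [enorm_mul]
  refine (mul_le_mul_left (enorm_dilate_le hφ hα hα1 ht y z) _).trans_eq ?_
  by_cases hz : z ∈ ball y t <;> simp [hz]

theorem intrinsicA_congr (hα : 0 < α) {f g : Rn n → ℂ} {y : Rn n} {t : ℝ} (ht : 0 < t)
    (h : ∀ z ∈ ball y t, f z = g z) : intrinsicA α f y t = intrinsicA α g y t := by
  refine iSup_congr fun φ => iSup_congr fun hφ => ?_
  congr 2
  ext z
  by_cases hz : z ∈ ball y t
  · rw [h z hz]
  · rw [dilate_eq_zero hφ hα ht]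
    · simp
    · rw [mem_ball', dist_eq_norm] at hz; exact not_lt.1 hz

theorem intrinsicA_congr_ae {f g : Rn n → ℂ} (h : f =ᵐ[volume] g) (y : Rn n) (t : ℝ) :
    intrinsicA α f y t = intrinsicA α g y t := by
  refine iSup_congr fun φ => iSup_congr fun hφ => ?_
  congr 1
  apply integral_congr_ae
  filter_upwards [h] with z hz
  rw [hz]

theorem intrinsicA_add_le (hα : 0 < α) {f g : Rn n → ℂ}
    (hf : LocallyIntegrable f volume) (hg : LocallyIntegrable g volume) (y : Rn n) {t : ℝ}
    (ht : 0 < t) : intrinsicA α (f + g) y t ≤ intrinsicA α f y t + intrinsicA α g y t := by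
  refine iSup₂_le fun φ hφ => ?_
  have : ∫ z, (dilate φ t (y - z) : ℂ) * (f + g) z =
      (∫ z, (dilate φ t (y - z) : ℂ) * f z) + ∫ z, (dilate φ t (y - z) : ℂ) * g z := by
    rw [← integral_add (integrable_dilate_mul hφ hα ht y hf)
      (integrable_dilate_mul hφ hα ht y hg)]
    simp [mul_add]
  rw [this]
  refine (enorm_add_le _ _).trans (add_le_add ?_ ?_)
  · exact le_iSup₂ (f := fun φ (_ : IsHolderBump α φ) => ‖∫ z, (dilate φ t (y - z) : ℂ) * f z‖ₑ) φ hφ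
  · exact le_iSup₂ (f := fun φ (_ : IsHolderBump α φ) => ‖∫ z, (dilate φ t (y - z) : ℂ) * g z‖ₑ) φ hφ

theorem continuousAt_integral_dilate [Nontrivial (Rn n)] {φ : Rn n → ℝ} (hφ : IsHolderBump α φ)
    (hα : 0 < α) (hα1 : α ≤ 1) {f : Rn n → ℂ} (hf : LocallyIntegrable f volume) {q : Rn n × ℝ}
    (hq : 0 < q.2) :
    ContinuousAt (fun q : Rn n × ℝ => ∫ z, (dilate φ q.2 (q.1 - z) : ℂ) * f z) q := by
  obtain ⟨y, t⟩ := q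
  simp only at hq
  have hnhds : ∀ᶠ q : Rn n × ℝ in 𝓝 (y, t), q.1 ∈ ball y 1 ∧ q.2 ∈ Ioo (t / 2) (2 * t) :=
    prod_mem_nhds (ball_mem_nhds y one_pos) (Ioo_mem_nhds (half_lt_self hq) (lt_two_mul_self hq))
  refine continuousAt_of_dominated
    (bound := (closedBall y (1 + 2 * t)).indicator (fun z => 2 * ((t / 2) ^ n)⁻¹ * ‖f z‖)) ?_ ?_ ?_ ?_
  · filter_upwards [hnhds] with q hq'
    exact (integrable_dilate_mul hφ hα (by linarith [hq'.2.1]) q.1 hf).1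
  · filter_upwards [hnhds] with q hq'
    refine ae_of_all _ fun z => ?_
    have ht : 0 < q.2 := by linarith [hq'.2.1]
    by_cases hz : z ∈ closedBall y (1 + 2 * t)
    · rw [indicator_of_mem hz, norm_mul, Complex.norm_real]
      refine mul_le_mul_of_nonneg_right ((abs_dilate_le hφ hα hα1 ht _).trans ?_) (norm_nonneg _)
      have := hq'.2.1
      gcongr
    · rw [indicator_of_notMem hz, dilate_eq_zero hφ hα ht]
      · simp
      · rw [mem_closedBall', dist_eq_norm] at hz
        have h1 := hq'.1
        rw [mem_ball', dist_eq_norm] at h1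
        have := norm_add_le (y - q.1) (q.1 - z)
        rw [sub_add_sub_cancel] at this
        linarith [hq'.2.2]
  · rw [integrable_indicator_iff measurableSet_closedBall]
    exact ((hf.integrableOn_isCompact (isCompact_closedBall _ _)).norm).const_mul _
  · refine ae_of_all _ fun z => ?_
    refine ContinuousAt.mul ?_ continuousAt_const
    refine Complex.continuous_ofReal.continuousAt.comp ?_
    unfold dilate
    refine ContinuousAt.mul ?_ ?_
    · exact (continuous_snd.continuousAt.pow n).inv₀ (pow_ne_zero n hq.ne')
    · refine (hφ.continuous hα).continuousAt.comp ?_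
      exact (continuous_snd.continuousAt.inv₀ hq.ne').smul
        (continuous_fst.continuousAt.sub continuousAt_const)

/-- The measure `dt / t` on `(0, ∞)`, as a measure on `ℝ` that does not charge `(-∞, 0]`. -/
noncomputable def scaleMeasure : Measure ℝ :=
  (volume.restrict (Ioi 0)).withDensity fun t => ENNReal.ofReal t⁻¹

/-- The measure `dy dt / t` on the upper half-space, as a measure on `ℝⁿ × ℝ`. With this measure in
place of `dy dt`, the cone integrand loses one power of `t`. -/
noncomputable def upperMeasure (n : ℕ) : Measure (Rn n × ℝ) :=
  (volume : Measure (Rn n)).prod scaleMeasure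

instance : SFinite scaleMeasure := by unfold scaleMeasure; infer_instance

instance : SFinite (upperMeasure n) := by unfold upperMeasure; infer_instance

theorem lintegral_scaleMeasure (g : ℝ → ℝ≥0∞) (hg : Measurable g) :
    ∫⁻ t, g t ∂scaleMeasure = ∫⁻ t in Ioi 0, ENNReal.ofReal t⁻¹ * g t := by
  rw [scaleMeasure, lintegral_withDensity_eq_lintegral_mul _ (by fun_prop) hg]
  rfl

theorem ae_scaleMeasure_pos : ∀ᵐ t ∂scaleMeasure, 0 < t :=
  withDensity_absolutelyContinuous _ _ (ae_restrict_mem measurableSet_Ioi)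

theorem ae_upperMeasure_pos : ∀ᵐ q ∂(upperMeasure n), 0 < q.2 :=
  Measure.quasiMeasurePreserving_snd.ae ae_scaleMeasure_pos

/-- On the upper half-space `intrinsicA α f` is a supremum of continuous functions, hence lower
semicontinuous; this is what makes the uncountable supremum measurable. -/
theorem measurable_indicator_intrinsicA [Nontrivial (Rn n)] (hα : 0 < α) (hα1 : α ≤ 1)
    {f : Rn n → ℂ} (hf : LocallyIntegrable f volume) :
    Measurable ({q : Rn n × ℝ | 0 < q.2}.indicator fun q => intrinsicA α f q.1 q.2) := by
  apply measurable_of_Ioi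
  intro a
  have : {q : Rn n × ℝ | 0 < q.2}.indicator (fun q => intrinsicA α f q.1 q.2) ⁻¹' Ioi a =
      {q | 0 < q.2 ∧ a < intrinsicA α f q.1 q.2} := by
    ext q
    by_cases h : 0 < q.2 <;> simp [h]
  rw [this]
  apply IsOpen.measurableSet
  rw [isOpen_iff_mem_nhds]
  rintro q ⟨hq, ha⟩
  simp only [intrinsicA, lt_iSup_iff] at ha
  obtain ⟨φ, hφ, ha⟩ := ha
  have h1 : ∀ᶠ q' : Rn n × ℝ in 𝓝 q, 0 < q'.2 :=
    continuous_snd.continuousAt.eventually (Ioi_mem_nhds hq)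
  have h2 := (continuousAt_integral_dilate hφ hα hα1 hf hq).enorm.eventually (Ioi_mem_nhds ha)
  filter_upwards [h1, h2] with q' hq' hq''
  exact ⟨hq', lt_of_lt_of_le hq'' (le_iSup₂ (f := fun φ (_ : IsHolderBump α φ) =>
    ‖∫ z, (dilate φ q'.2 (q'.1 - z) : ℂ) * f z‖ₑ) φ hφ)⟩

theorem aemeasurable_intrinsicA [Nontrivial (Rn n)] (hα : 0 < α) (hα1 : α ≤ 1)
    {f : Rn n → ℂ} (hf : LocallyIntegrable f volume) :
    AEMeasurable (fun q => intrinsicA α f q.1 q.2) (upperMeasure n) := by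
  refine ⟨_, measurable_indicator_intrinsicA hα hα1 hf, ?_⟩
  filter_upwards [ae_upperMeasure_pos] with q hq
  simp [hq]

/-! ### Almost orthogonality -/

/-- Schur's test: if the weighted row sums of the Gram matrix of the vectors `k i` are at most `C`,
then the weighted sum of the squared coefficients of `f` is at most `C ‖f‖²`. -/
theorem sum_mul_norm_inner_sq_le {ι H : Type*} [NormedAddCommGroup H] [InnerProductSpace ℂ H]
    (s : Finset ι) (w : ι → ℝ) (hw : ∀ i, 0 ≤ w i) (k : ι → H) {C : ℝ} (hC : 0 ≤ C)
    (h : ∀ i ∈ s, ∑ j ∈ s, w j * ‖inner ℂ (k i) (k j)‖ ≤ C) (f : H) :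
    ∑ i ∈ s, w i * ‖inner ℂ (k i) f‖ ^ 2 ≤ C * ‖f‖ ^ 2 := by
  set c : ι → ℂ := fun i => inner ℂ (k i) f with hc
  set X := ∑ i ∈ s, w i * ‖c i‖ ^ 2 with hX
  have hX0 : 0 ≤ X := Finset.sum_nonneg fun i _ => mul_nonneg (hw i) (by positivity)
  -- duality: `X = ⟪v, f⟫` for the synthesized vector `v`, and `‖v‖² ≤ C X` by the row sums
  set v : H := ∑ i ∈ s, ((w i : ℂ) * c i) • k i with hv
  have h1 : X ≤ ‖v‖ * ‖f‖ := by
    have : inner ℂ v f = (X : ℂ) := by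
      rw [hv, sum_inner, hX]
      push_cast
      refine Finset.sum_congr rfl fun i _ => ?_
      rw [inner_smul_left, map_mul, Complex.conj_ofReal, mul_assoc, ← Complex.conj_mul' (c i)]
    have h2 := norm_inner_le_norm (𝕜 := ℂ) v f
    rwa [this, Complex.norm_real, Real.norm_of_nonneg hX0] at h2
  have h2 : ‖v‖ ^ 2 ≤ C * X := by
    have e : ‖v‖ ^ 2 = ‖inner ℂ v v‖ := by rw [inner_self_eq_norm_sq_to_K]; simp
    have e2 : ‖inner ℂ v v‖ ≤ ∑ i ∈ s, ∑ j ∈ s,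
        (w i * w j * ‖inner ℂ (k i) (k j)‖) * (‖c i‖ * ‖c j‖) := by
      rw [hv, sum_inner]
      refine (norm_sum_le _ _).trans (Finset.sum_le_sum fun i _ => ?_)
      rw [inner_sum]
      refine (norm_sum_le _ _).trans (Finset.sum_le_sum fun j _ => ?_)
      rw [inner_smul_left, inner_smul_right]
      simp only [norm_mul, RCLike.norm_conj, Complex.norm_real, Real.norm_of_nonneg (hw _)]
      apply le_of_eq
      ring
    rw [e]
    refine e2.trans ?_
    have e3 : ∀ i ∈ s, ∀ j ∈ s, (w i * w j * ‖inner ℂ (k i) (k j)‖) * (‖c i‖ * ‖c j‖) ≤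
        (w i * w j * ‖inner ℂ (k i) (k j)‖) * (‖c i‖ ^ 2) / 2 +
        (w j * w i * ‖inner ℂ (k j) (k i)‖) * (‖c j‖ ^ 2) / 2 := by
      intro i _ j _
      rw [norm_inner_symm (k j) (k i), mul_comm (w j)]
      have := mul_nonneg (mul_nonneg (hw i) (hw j)) (norm_nonneg (inner ℂ (k i) (k j)))
      nlinarith [mul_nonneg this (sq_nonneg (‖c i‖ - ‖c j‖))]
    refine (Finset.sum_le_sum fun i hi => Finset.sum_le_sum fun j hj => e3 i hi j hj).trans ?_
    simp only [Finset.sum_add_distrib]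
    rw [Finset.sum_comm (f := fun i j => (w j * w i * ‖inner ℂ (k j) (k i)‖) * (‖c j‖ ^ 2) / 2)]
    rw [← Finset.sum_add_distrib, hX, Finset.mul_sum]
    refine Finset.sum_le_sum fun i hi => ?_
    rw [← Finset.sum_add_distrib]
    calc _ = (∑ j ∈ s, w j * ‖inner ℂ (k i) (k j)‖) * (w i * ‖c i‖ ^ 2) := by
          rw [Finset.sum_mul]
          exact Finset.sum_congr rfl fun j _ => by ring
      _ ≤ _ := mul_le_mul_of_nonneg_right (h i hi) (mul_nonneg (hw i) (by positivity))
  rcases hX0.eq_or_lt with h0 | h0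
  · rw [← h0]; positivity
  · have h3 : X * X ≤ (C * ‖f‖ ^ 2) * X := by
      nlinarith [mul_le_mul h1 h1 hX0 (by positivity), mul_le_mul_of_nonneg_right h2 (sq_nonneg ‖f‖)]
    exact le_of_mul_le_mul_right h3 h0

/-- A bound that is uniform over all choices of one point in each index set passes to the sum of the
suprema. -/
theorem sum_iSup_le_of_forall_choice {ι : Type*} [DecidableEq ι] {T : ι → Type*}
    [∀ i, Nonempty (T i)] (g : ∀ i, T i → ℝ≥0∞) (s : Finset ι) {B : ℝ≥0∞}
    (h : ∀ x : ∀ i, T i, ∑ i ∈ s, g i (x i) ≤ B) : ∑ i ∈ s, ⨆ x, g i x ≤ B := by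
  suffices H : ∀ a : ℝ≥0∞, (∀ x : ∀ i, T i, a + ∑ i ∈ s, g i (x i) ≤ B) →
      a + ∑ i ∈ s, ⨆ x, g i x ≤ B by
    simpa using H 0 (by simpa using h)
  clear h
  induction s using Finset.induction_on with
  | empty => intro a h; simpa using h (fun i => Classical.arbitrary _)
  | insert i s hi ih =>
    intro a h
    rw [Finset.sum_insert hi, ← add_assoc, ENNReal.add_iSup, ENNReal.iSup_add]
    refine iSup_le fun y => ih (a + g i y) fun x => ?_
    have := h (Function.update x i y)
    rw [Finset.sum_insert hi, Function.update_self, ← add_assoc] at this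
    refine le_trans (le_of_eq ?_) this
    congr 1
    refine Finset.sum_congr rfl fun j hj => ?_
    rw [Function.update_of_ne (by rintro rfl; exact hi hj)]

/-- Two dilated bumps are almost orthogonal: since the bump at scale `s` has integral zero, the
value at its centre may be subtracted from the other one, and the Hölder condition gains
`(s / t) ^ α`. -/
theorem abs_integral_dilate_mul_dilate_le [Nontrivial (Rn n)] (hα : 0 < α) (hα1 : α ≤ 1)
    {φ ψ : Rn n → ℝ} (hφ : IsHolderBump α φ) (hψ : IsHolderBump α ψ) {s t : ℝ} (hs : 0 < s)
    (ht : 0 < t) (x y : Rn n) :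
    |∫ z, dilate φ t (x - z) * dilate ψ s (y - z)| ≤
      2 * volume.real (ball (0 : Rn n) 1) * (t ^ n)⁻¹ * (s / t) ^ α := by
  have hφc : Continuous fun z => dilate φ t (x - z) :=
    (continuous_dilate hφ hα t).comp (continuous_const.sub continuous_id)
  have hψc : Continuous fun z => dilate ψ s (y - z) :=
    (continuous_dilate hψ hα s).comp (continuous_const.sub continuous_id)
  have hsupp : HasCompactSupport fun z => dilate ψ s (y - z) := by
    apply HasCompactSupport.of_support_subset_isCompact (isCompact_closedBall y s)
    intro z hz
    by_contra h
    apply hz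
    simp only
    rw [dilate_eq_zero hψ hα hs]
    rw [mem_closedBall', dist_eq_norm] at h; exact (not_le.1 h).le
  have hψi : Integrable fun z => dilate ψ s (y - z) := hψc.integrable_of_hasCompactSupport hsupp
  have hmi : Integrable fun z => dilate φ t (x - z) * dilate ψ s (y - z) :=
    (hφc.mul hψc).integrable_of_hasCompactSupport hsupp.mul_left
  have e : ∫ z, dilate φ t (x - z) * dilate ψ s (y - z) =
      ∫ z, (dilate φ t (x - z) - dilate φ t (x - y)) * dilate ψ s (y - z) := by
    simp only [sub_mul]
    rw [integral_sub hmi (hψi.const_mul _), integral_const_mul,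
      integral_sub_left_eq_self (fun z => dilate ψ s z) volume y, integral_dilate hψ, mul_zero,
      sub_zero]
  rw [e, ← Real.norm_eq_abs]
  have hb : ∀ z, ‖(dilate φ t (x - z) - dilate φ t (x - y)) * dilate ψ s (y - z)‖ ≤
      (ball y s).indicator (fun _ => (t ^ n)⁻¹ * (s / t) ^ α * (2 * (s ^ n)⁻¹)) z := by
    intro z
    by_cases hz : z ∈ ball y s
    · rw [indicator_of_mem hz, norm_mul, Real.norm_eq_abs, Real.norm_eq_abs]
      refine mul_le_mul ((abs_dilate_sub_le hφ ht _ _).trans ?_) (abs_dilate_le hψ hα hα1 hs _)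
        (abs_nonneg _) (by positivity)
      rw [sub_sub_sub_cancel_left]
      rw [mem_ball', dist_eq_norm] at hz
      gcongr
    · rw [indicator_of_notMem hz, dilate_eq_zero hψ hα hs]
      · simp
      · rw [mem_ball', dist_eq_norm] at hz; exact not_lt.1 hz
  refine (norm_integral_le_of_norm_le ?_ (ae_of_all _ hb)).trans_eq ?_
  · exact (integrable_indicator_iff measurableSet_ball).2
      (integrableOn_const measure_ball_lt_top.ne)
  · rw [integral_indicator measurableSet_ball, setIntegral_const, smul_eq_mul, Measure.real,
      volume_ball_eq _ hs.le, ENNReal.toReal_mul, ENNReal.toReal_ofReal (by positivity),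
      ← Measure.real]
    field_simp

/-! ### Whitney boxes -/

/-- The dyadic Whitney box of index `(k, m)`: the cube with corner `2ᵏ m` and side `2ᵏ`, times the
range of scales `[2ᵏ, 2ᵏ⁺¹)`. -/
def whitneyBox (c : ℤ × (Fin n → ℤ)) : Set (Rn n × ℝ) :=
  {y | ∀ i, y i ∈ Ico (c.2 i * (2 : ℝ) ^ c.1) ((c.2 i + 1) * (2 : ℝ) ^ c.1)} ×ˢ
    Ico ((2 : ℝ) ^ c.1) (2 * 2 ^ c.1)

theorem mem_whitneyBox {c : ℤ × (Fin n → ℤ)} {q : Rn n × ℝ} : q ∈ whitneyBox c ↔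
    (∀ i, c.2 i * (2 : ℝ) ^ c.1 ≤ q.1 i ∧ q.1 i < (c.2 i + 1) * (2 : ℝ) ^ c.1) ∧
      (2 : ℝ) ^ c.1 ≤ q.2 ∧ q.2 < 2 * 2 ^ c.1 := Iff.rfl

theorem exists_mem_whitneyBox {q : Rn n × ℝ} (hq : 0 < q.2) : ∃ c, q ∈ whitneyBox c := by
  refine ⟨(Int.log 2 q.2, fun i => ⌊q.1 i / (2 : ℝ) ^ Int.log 2 q.2⌋), ?_⟩
  have h2 : (0 : ℝ) < 2 ^ Int.log 2 q.2 := by positivity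
  rw [mem_whitneyBox]
  refine ⟨fun i => ⟨?_, ?_⟩, ?_, ?_⟩
  · exact (le_div_iff₀ h2).1 (Int.floor_le _)
  · exact (div_lt_iff₀ h2).1 (Int.lt_floor_add_one _)
  · exact_mod_cast Int.zpow_log_le_self (b := 2) one_lt_two hq
  · have := Int.lt_zpow_succ_log_self (b := 2) one_lt_two q.2
    rw [zpow_add_one₀ (by norm_num), mul_comm] at this
    exact_mod_cast this

theorem whitneyBox_nonempty (c : ℤ × (Fin n → ℤ)) : (whitneyBox c).Nonempty := by
  have h2 : (0 : ℝ) < 2 ^ c.1 := by positivity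
  refine ⟨(WithLp.toLp 2 fun i => c.2 i * (2 : ℝ) ^ c.1, 2 ^ c.1), ?_⟩
  rw [mem_whitneyBox]
  refine ⟨fun i => ⟨le_rfl, ?_⟩, le_rfl, by linarith⟩
  exact mul_lt_mul_of_pos_right (lt_add_one _) h2

theorem measurableSet_whitneyBox (c : ℤ × (Fin n → ℤ)) : MeasurableSet (whitneyBox c) := by
  refine MeasurableSet.prod ?_ measurableSet_Ico
  rw [ofPred_forall]
  exact MeasurableSet.iInter fun i =>
    measurableSet_Ico.preimage (EuclideanSpace.proj (𝕜 := ℝ) i).continuous.measurable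

theorem scaleMeasure_Ico_le {a : ℝ} (ha : 0 < a) : scaleMeasure (Ico a (2 * a)) ≤ 1 := by
  rw [scaleMeasure, withDensity_apply _ measurableSet_Ico, Measure.restrict_restrict measurableSet_Ico,
    inter_eq_left.2 fun t (ht : t ∈ Ico a (2 * a)) => mem_Ioi.2 (ha.trans_le ht.1)]
  refine (setLIntegral_mono (g := fun _ => ENNReal.ofReal a⁻¹) (by fun_prop) fun t ht =>
    ENNReal.ofReal_le_ofReal (inv_anti₀ ha ht.1)).trans ?_
  rw [setLIntegral_const, Real.volume_Ico, ← ENNReal.ofReal_mul (by positivity)]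
  refine ENNReal.ofReal_le_one.2 (le_of_eq ?_)
  field_simp
  ring

theorem upperMeasure_whitneyBox_le (c : ℤ × (Fin n → ℤ)) :
    upperMeasure n (whitneyBox c) ≤ ENNReal.ofReal (((2 : ℝ) ^ c.1) ^ n) := by
  have h2 : (0 : ℝ) < 2 ^ c.1 := by positivity
  rw [upperMeasure, whitneyBox, Measure.prod_prod]
  refine (mul_le_mul_right (scaleMeasure_Ico_le h2) _).trans_eq ?_
  rw [mul_one]
  have e : {y : Rn n | ∀ i, y i ∈ Ico (c.2 i * (2 : ℝ) ^ c.1) ((c.2 i + 1) * (2 : ℝ) ^ c.1)} =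
      WithLp.ofLp ⁻¹' (univ.pi fun i => Ico (c.2 i * (2 : ℝ) ^ c.1) ((c.2 i + 1) * (2 : ℝ) ^ c.1)) := by
    ext y; simp
  rw [e, (PiLp.volume_preserving_ofLp (Fin n)).measure_preimage
    (MeasurableSet.univ_pi fun i => measurableSet_Ico).nullMeasurableSet, Real.volume_pi_Ico]
  simp only [add_mul, one_mul, add_sub_cancel_left, Finset.prod_const, Finset.card_univ,
    Fintype.card_fin]
  rw [ENNReal.ofReal_pow h2.le]

/-- The number of lattice points in a cube of side `2 R`. -/
theorem card_piFinset_Icc_le (a : Fin n → ℝ) {R : ℝ} (hR : 0 ≤ R) :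
    ((Fintype.piFinset fun i => Finset.Icc ⌈a i - R⌉ ⌊a i + R⌋).card : ℝ) ≤ (2 * R + 1) ^ n := by
  rw [Fintype.card_piFinset]
  push_cast
  refine (Finset.prod_le_prod (g := fun _ => 2 * R + 1) (fun i _ => Nat.cast_nonneg _)
    fun i _ => ?_).trans_eq (by simp)
  rw [Int.card_Icc]
  have h1 := Int.floor_le (a i + R)
  have h2 := Int.le_ceil (a i - R)
  have h3 : (((⌊a i + R⌋ + 1 - ⌈a i - R⌉).toNat : ℤ) : ℝ) ≤ 2 * R + 1 := by
    rcases le_total 0 (⌊a i + R⌋ + 1 - ⌈a i - R⌉) with h | h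
    · rw [Int.toNat_of_nonneg h]; push_cast; linarith
    · rw [Int.toNat_of_nonpos h]; simp; linarith
  exact_mod_cast h3

/-- Almost orthogonality of bumps at points of two Whitney boxes, in terms of the indices. -/
theorem abs_integral_dilate_whitney_le [Nontrivial (Rn n)] (hα : 0 < α) (hα1 : α ≤ 1)
    {φ ψ : Rn n → ℝ} (hφ : IsHolderBump α φ) (hψ : IsHolderBump α ψ) {c d : ℤ × (Fin n → ℤ)}
    {p q : Rn n × ℝ} (hp : p ∈ whitneyBox c) (hq : q ∈ whitneyBox d) :
    |∫ z, dilate φ p.2 (p.1 - z) * dilate ψ q.2 (q.1 - z)| ≤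
      4 * volume.real (ball (0 : Rn n) 1) * (((2 : ℝ) ^ max c.1 d.1) ^ n)⁻¹ *
        ((2 : ℝ) ^ (-α)) ^ (c.1 - d.1).natAbs := by
  -- by symmetry the box `d` may be taken to have the smaller scale
  wlog h : d.1 ≤ c.1 generalizing c d p q φ ψ
  · have := this hψ hφ hq hp (le_of_not_ge h)
    rw [max_comm, ← Int.natAbs_neg, neg_sub] at this
    simpa only [mul_comm] using this
  have hc : (0 : ℝ) < 2 ^ c.1 := by positivity
  have hd : (0 : ℝ) < 2 ^ d.1 := by positivity
  rw [mem_whitneyBox] at hp hq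
  refine (abs_integral_dilate_mul_dilate_le hα hα1 hφ hψ (hd.trans_le hq.2.1)
    (hc.trans_le hp.2.1) _ _).trans ?_
  rw [max_eq_left h]
  have e : (q.2 / p.2) ^ α ≤ 2 * ((2 : ℝ) ^ (-α)) ^ (c.1 - d.1).natAbs := by
    have h1 : q.2 / p.2 ≤ 2 * (2 : ℝ) ^ (-((c.1 - d.1).natAbs : ℝ)) := by
      have : ((c.1 - d.1).natAbs : ℝ) = ((c.1 - d.1 : ℤ) : ℝ) := by
        rw [← Int.cast_natCast, Int.natAbs_of_nonneg (by omega)]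
      rw [this, ← Int.cast_neg, Real.rpow_intCast, neg_sub, zpow_sub₀ two_ne_zero, ← mul_div_assoc]
      exact div_le_div₀ (by positivity) hq.2.2.le hc hp.2.1
    calc (q.2 / p.2) ^ α ≤ (2 * (2 : ℝ) ^ (-((c.1 - d.1).natAbs : ℝ))) ^ α :=
          Real.rpow_le_rpow (div_nonneg (hd.trans_le hq.2.1).le (hc.trans_le hp.2.1).le) h1 hα.le
      _ = 2 ^ α * ((2 : ℝ) ^ (-α)) ^ (c.1 - d.1).natAbs := by
          rw [Real.mul_rpow (by norm_num) (by positivity), ← Real.rpow_mul (by norm_num),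
            ← Real.rpow_natCast, ← Real.rpow_mul (by norm_num)]
          congr 2; ring
      _ ≤ _ := by
          refine mul_le_mul_of_nonneg_right ?_ (by positivity)
          calc (2 : ℝ) ^ α ≤ 2 ^ (1 : ℝ) := Real.rpow_le_rpow_of_exponent_le (by norm_num) hα1
            _ = 2 := Real.rpow_one 2
  have e2 : (p.2 ^ n)⁻¹ ≤ (((2 : ℝ) ^ c.1) ^ n)⁻¹ :=
    inv_anti₀ (by positivity) (pow_le_pow_left₀ hc.le hp.2.1 n)
  have hv : 0 ≤ volume.real (ball (0 : Rn n) 1) := measureReal_nonneg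
  calc _ ≤ 2 * volume.real (ball (0 : Rn n) 1) * (((2 : ℝ) ^ c.1) ^ n)⁻¹ *
        (2 * ((2 : ℝ) ^ (-α)) ^ (c.1 - d.1).natAbs) :=
        mul_le_mul (mul_le_mul_of_nonneg_left e2 (by positivity)) e
          (Real.rpow_nonneg (div_nonneg (hd.trans_le hq.2.1).le (hc.trans_le hp.2.1).le) _)
          (by positivity)
    _ = _ := by ring

/-- Bumps attached to boxes that are far apart have disjoint supports. With `m` the larger
scale index, the two scales are below `2 · 2ᵐ`, and a point of a box is within one side of its corner
in each coordinate, which gives the factor `5`. -/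
theorem integral_dilate_whitney_eq_zero (hα : 0 < α)
    {φ ψ : Rn n → ℝ} (hφ : IsHolderBump α φ) (hψ : IsHolderBump α ψ) {c d : ℤ × (Fin n → ℤ)}
    {p q : Rn n × ℝ} (hp : p ∈ whitneyBox c) (hq : q ∈ whitneyBox d)
    (hd : d.2 ∉ Fintype.piFinset fun i => Finset.Icc
      ⌈p.1 i / 2 ^ d.1 - 5 * 2 ^ (max c.1 d.1) / 2 ^ d.1⌉
      ⌊p.1 i / 2 ^ d.1 + 5 * 2 ^ (max c.1 d.1) / (2 : ℝ) ^ d.1⌋) :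
    ∫ z, dilate φ p.2 (p.1 - z) * dilate ψ q.2 (q.1 - z) = 0 := by
  rw [mem_whitneyBox] at hp hq
  have hc0 : (0 : ℝ) < 2 ^ c.1 := by positivity
  have hd0 : (0 : ℝ) < 2 ^ d.1 := by positivity
  have hcM : (2 : ℝ) ^ c.1 ≤ 2 ^ max c.1 d.1 := zpow_le_zpow_right₀ (by norm_num) (le_max_left _ _)
  have hdM : (2 : ℝ) ^ d.1 ≤ 2 ^ max c.1 d.1 := zpow_le_zpow_right₀ (by norm_num) (le_max_right _ _)
  have hfar : p.2 + q.2 ≤ ‖p.1 - q.1‖ := by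
    by_contra! hlt
    apply hd
    rw [Fintype.mem_piFinset]
    intro i
    rw [Finset.mem_Icc, Int.ceil_le, Int.le_floor, ← sub_div, ← add_div, div_le_iff₀ hd0,
      le_div_iff₀ hd0]
    have h1 : |p.1 i - q.1 i| ≤ ‖p.1 - q.1‖ := PiLp.norm_apply_le (p.1 - q.1) i
    have h2 := abs_le.1 h1
    have h3 := hq.1 i
    constructor <;> nlinarith [hp.2.2, hq.2.2]
  rw [← integral_zero (Rn n) ℝ]
  congr 1
  ext z
  by_cases hz : p.2 ≤ ‖p.1 - z‖
  · rw [dilate_eq_zero hφ hα (hc0.trans_le hp.2.1) hz, zero_mul]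
  · rw [dilate_eq_zero hψ hα (hd0.trans_le hq.2.1), mul_zero]
    have := norm_sub_le (p.1 - z) (q.1 - z)
    rw [sub_sub_sub_cancel_right] at this
    linarith [not_le.1 hz]

theorem summable_pow_natAbs {r : ℝ} (h0 : 0 ≤ r) (h1 : r < 1) :
    Summable fun k : ℤ => r ^ k.natAbs :=
  Summable.of_nat_of_neg (by simpa using summable_geometric_of_lt_one h0 h1)
    (by simpa using summable_geometric_of_lt_one h0 h1)

/-- A sum over pairs in which, for each first component `k`, at most `(N k).card` terms are nonzero
and these are bounded by `G k`. -/
theorem sum_le_sum_card_mul {κ ι : Type*} [DecidableEq κ] [DecidableEq ι] (s : Finset (κ × ι))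
    (N : κ → Finset ι) {F : κ × ι → ℝ} {G : κ → ℝ} (hG : ∀ k, 0 ≤ G k)
    (hF : ∀ d ∈ s, F d ≤ if d.2 ∈ N d.1 then G d.1 else 0) :
    ∑ d ∈ s, F d ≤ ∑ k ∈ s.image Prod.fst, ((N k).card : ℝ) * G k := by
  refine (Finset.sum_le_sum hF).trans ?_
  rw [← Finset.sum_fiberwise_of_maps_to (t := s.image Prod.fst)
    (fun d hd => Finset.mem_image_of_mem _ hd)]
  refine Finset.sum_le_sum fun k _ => ?_
  have e1 : (∑ d ∈ s with d.1 = k, if d.2 ∈ N d.1 then G d.1 else 0) =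
      ∑ d ∈ s with d.1 = k, if d.2 ∈ N k then G k else 0 := by
    refine Finset.sum_congr rfl fun d hd => ?_
    rw [(Finset.mem_filter.1 hd).2]
  rw [e1, ← Finset.sum_filter, Finset.sum_const, nsmul_eq_mul]
  refine mul_le_mul_of_nonneg_right (Nat.cast_le.2 ?_) (hG k)
  refine Finset.card_le_card_of_injOn Prod.snd ?_ ?_
  · intro d hd
    exact (Finset.mem_filter.1 hd).2
  · intro d hd d' hd' h
    have h1 := (Finset.mem_filter.1 (Finset.mem_filter.1 hd).1).2
    have h2 := (Finset.mem_filter.1 (Finset.mem_filter.1 hd').1).2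
    exact Prod.ext (h1.trans h2.symm) h

/-- The row sums required by Schur's test. Let `m` be the larger of the scale indices of a fixed box
and of the boxes at scale `2ᵏ`: at most `(11 · 2ᵐ / 2ᵏ)ⁿ` of the latter interact with the fixed box,
which balances the factors `(2ᵏ)ⁿ` and `(2ᵐ)⁻ⁿ`, and the decay in the difference of the indices
remains. -/
theorem sum_abs_integral_dilate_whitney_le [Nontrivial (Rn n)] (hα : 0 < α) (hα1 : α ≤ 1)
    {φ : Rn n → ℝ} (hφ : IsHolderBump α φ) {c : ℤ × (Fin n → ℤ)}
    {p : Rn n × ℝ} (hp : p ∈ whitneyBox c) (s : Finset (ℤ × (Fin n → ℤ)))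
    (ψ : ℤ × (Fin n → ℤ) → Rn n → ℝ) (hψ : ∀ d, IsHolderBump α (ψ d))
    (q : ℤ × (Fin n → ℤ) → Rn n × ℝ) (hq : ∀ d, q d ∈ whitneyBox d) :
    ∑ d ∈ s, ((2 : ℝ) ^ d.1) ^ n *
        |∫ z, dilate φ p.2 (p.1 - z) * dilate (ψ d) (q d).2 ((q d).1 - z)| ≤
      11 ^ n * (4 * volume.real (ball (0 : Rn n) 1)) *
        ∑' k : ℤ, ((2 : ℝ) ^ (-α)) ^ k.natAbs := by
  classical
  set r : ℝ := (2 : ℝ) ^ (-α) with hr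
  have hr0 : 0 ≤ r := by positivity
  have hr1 : r < 1 := Real.rpow_lt_one_of_one_lt_of_neg (by norm_num) (by linarith)
  have hv : 0 ≤ volume.real (ball (0 : Rn n) 1) := measureReal_nonneg
  set b := 4 * volume.real (ball (0 : Rn n) 1) with hb
  set N : ℤ → Finset (Fin n → ℤ) := fun k => Fintype.piFinset fun i => Finset.Icc
      ⌈p.1 i / 2 ^ k - 5 * 2 ^ (max c.1 k) / 2 ^ k⌉
      ⌊p.1 i / 2 ^ k + 5 * 2 ^ (max c.1 k) / (2 : ℝ) ^ k⌋ with hN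
  set G : ℤ → ℝ := fun k => ((2 : ℝ) ^ k) ^ n *
    (b * (((2 : ℝ) ^ max c.1 k) ^ n)⁻¹ * r ^ (c.1 - k).natAbs) with hG
  have hG0 : ∀ k, 0 ≤ G k := fun k => by positivity
  have hF : ∀ d ∈ s, ((2 : ℝ) ^ d.1) ^ n *
      |∫ z, dilate φ p.2 (p.1 - z) * dilate (ψ d) (q d).2 ((q d).1 - z)| ≤
      if d.2 ∈ N d.1 then G d.1 else 0 := by
    intro d _
    split_ifs with h
    · exact mul_le_mul_of_nonneg_left
        (abs_integral_dilate_whitney_le hα hα1 hφ (hψ d) hp (hq d)) (by positivity)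
    · rw [integral_dilate_whitney_eq_zero hα hφ (hψ d) hp (hq d) h, abs_zero, mul_zero]
  have hN' : ∀ k, ((N k).card : ℝ) ≤ (2 * (5 * 2 ^ (max c.1 k) / (2 : ℝ) ^ k) + 1) ^ n := fun k =>
    card_piFinset_Icc_le (fun i => p.1 i / 2 ^ k) (by positivity)
  have hsum := sum_le_sum_card_mul s N hG0 hF
  refine hsum.trans ?_
  clear hsum hF
  clear_value N
  have hk : ∀ k ∈ s.image Prod.fst, ((N k).card : ℝ) * G k ≤
      11 ^ n * b * r ^ (c.1 - k).natAbs := by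
    intro k _
    have hcard := hN' k
    have hk0 : (0 : ℝ) < 2 ^ k := by positivity
    have hkM : (2 : ℝ) ^ k ≤ 2 ^ max c.1 k := zpow_le_zpow_right₀ (by norm_num) (le_max_right _ _)
    have hM0 : (0 : ℝ) < 2 ^ max c.1 k := by positivity
    calc _ ≤ (2 * (5 * 2 ^ (max c.1 k) / (2 : ℝ) ^ k) + 1) ^ n * G k :=
          mul_le_mul_of_nonneg_right hcard (hG0 k)
      _ = ((10 * 2 ^ max c.1 k + 2 ^ k) / 2 ^ max c.1 k) ^ n * b * r ^ (c.1 - k).natAbs := by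
          simp only [hG]
          rw [div_pow, show (10 * (2 : ℝ) ^ max c.1 k + 2 ^ k) =
            (2 * (5 * 2 ^ (max c.1 k) / (2 : ℝ) ^ k) + 1) * 2 ^ k by field_simp; ring, mul_pow]
          ring
      _ ≤ _ := by
          gcongr
          rw [div_le_iff₀ hM0]
          linarith
  refine (Finset.sum_le_sum hk).trans ?_
  rw [← Finset.mul_sum]
  have hs : Summable fun k : ℤ => r ^ (c.1 - k).natAbs :=
    (summable_pow_natAbs hr0 hr1).comp_injective (i := fun k : ℤ => c.1 - k)
      sub_right_injective
  have ht : ∑' k : ℤ, r ^ (c.1 - k).natAbs = ∑' k : ℤ, r ^ k.natAbs :=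
    (Equiv.subLeft c.1).tsum_eq fun k : ℤ => r ^ k.natAbs
  rw [← ht]
  exact mul_le_mul_of_nonneg_left (hs.sum_le_tsum _ fun _ _ => by positivity) (by positivity)

/-! ### The square-integral bound on the upper half-space -/

theorem memLp_dilate {φ : Rn n → ℝ} (hφ : IsHolderBump α φ) (hα : 0 < α) {t : ℝ} (ht : 0 < t)
    (y : Rn n) : MemLp (fun z => (dilate φ t (y - z) : ℂ)) 2 := by
  have hc : Continuous (fun z => (dilate φ t (y - z) : ℂ)) :=
    Complex.continuous_ofReal.comp ((continuous_dilate hφ hα t).comp (continuous_const.sub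
      continuous_id))
  refine hc.memLp_of_hasCompactSupport ?_
  apply HasCompactSupport.of_support_subset_isCompact (isCompact_closedBall y t)
  intro z hz
  by_contra h
  apply hz
  simp only
  rw [dilate_eq_zero hφ hα ht, Complex.ofReal_zero]
  rw [mem_closedBall', dist_eq_norm] at h; exact (not_le.1 h).le

theorem inner_toLp_dilate {φ : Rn n → ℝ} (hφ : IsHolderBump α φ) (hα : 0 < α) {t : ℝ} (ht : 0 < t)
    (y : Rn n) {f : Rn n → ℂ} (hf : MemLp f 2) :
    inner ℂ ((memLp_dilate hφ hα ht y).toLp _) (hf.toLp f) =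
      ∫ z, (dilate φ t (y - z) : ℂ) * f z := by
  rw [L2.inner_def]
  apply integral_congr_ae
  filter_upwards [(memLp_dilate hφ hα ht y).coeFn_toLp, hf.coeFn_toLp] with z h1 h2
  rw [h1, h2, RCLike.inner_apply, RCLike.conj_eq_re_sub_im]
  simp [mul_comm]

theorem ofReal_norm_toLp_sq {f : Rn n → ℂ} (hf : MemLp f 2) :
    ENNReal.ofReal (‖hf.toLp f‖ ^ 2) = ∫⁻ z, ‖f z‖ₑ ^ 2 := by
  rw [ENNReal.ofReal_pow (norm_nonneg _), ofReal_norm, Lp.enorm_toLp]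
  have := eLpNorm_nnreal_pow_eq_lintegral (f := f) (μ := volume) (p := 2) two_ne_zero
  simpa using this

/-- The supremum over bumps is square integrable on the upper half-space, with norm controlled by
`‖f‖₂`. On each Whitney box it is bounded by the supremum of the coefficients over all bumps and all
points of the box. -/
theorem exists_lintegral_intrinsicA_sq_le [Nontrivial (Rn n)] (hα : 0 < α) (hα1 : α ≤ 1) :
    ∃ C : ℝ≥0∞, C ≠ ⊤ ∧ ∀ f : Rn n → ℂ, AEStronglyMeasurable f volume →
      ∫⁻ q, intrinsicA α f q.1 q.2 ^ 2 ∂(upperMeasure n) ≤ C * ∫⁻ z, ‖f z‖ₑ ^ 2 := by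
  classical
  set C₀ : ℝ := 11 ^ n * (4 * volume.real (ball (0 : Rn n) 1)) *
        ∑' k : ℤ, ((2 : ℝ) ^ (-α)) ^ k.natAbs with hC₀
  have hC₀0 : 0 ≤ C₀ := by
    have hv : 0 ≤ volume.real (ball (0 : Rn n) 1) := measureReal_nonneg
    have : 0 ≤ ∑' k : ℤ, ((2 : ℝ) ^ (-α)) ^ k.natAbs := tsum_nonneg fun k => by positivity
    positivity
  -- adding `1` makes the constant nonzero, so that the bound is trivial when `‖f‖₂ = ∞`
  refine ⟨ENNReal.ofReal C₀ + 1, by finiteness, fun f hfm => ?_⟩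
  rcases eq_or_ne (∫⁻ z, ‖f z‖ₑ ^ 2) ⊤ with htop | htop
  · rw [htop, ENNReal.mul_top (by simp)]; exact le_top
  refine le_trans ?_ (mul_le_mul_left (le_self_add (b := 1)) _)
  have hf : MemLp f 2 := by
    refine ⟨hfm, ?_⟩
    have := eLpNorm_nnreal_pow_eq_lintegral (f := f) (μ := volume) (p := 2) two_ne_zero
    have h2 : eLpNorm f 2 volume ^ (2 : ℕ) = ∫⁻ z, ‖f z‖ₑ ^ 2 := by simpa using this
    rw [← h2] at htop
    exact lt_top_iff_ne_top.2 fun h => htop (by rw [h]; simp)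
  let T : ℤ × (Fin n → ℤ) → Type := fun c =>
    {x : (Rn n → ℝ) × (Rn n × ℝ) // IsHolderBump α x.1 ∧ x.2 ∈ whitneyBox c}
  have hT : ∀ c, Nonempty (T c) := fun c =>
    let ⟨q, hq⟩ := whitneyBox_nonempty c
    ⟨⟨(0, q), isHolderBump_zero, hq⟩⟩
  have hTpos : ∀ c (x : T c), 0 < x.1.2.2 := fun c x =>
    lt_of_lt_of_le (by positivity) (mem_whitneyBox.1 x.2.2).2.1
  let I : ∀ c, T c → ℂ := fun c x => ∫ z, (dilate x.1.1 x.1.2.2 (x.1.2.1 - z) : ℂ) * f z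
  let w : ℤ × (Fin n → ℤ) → ℝ := fun c => ((2 : ℝ) ^ c.1) ^ n
  have hw : ∀ c, 0 ≤ w c := fun c => by positivity
  have hbox : ∀ c, ∫⁻ q in whitneyBox c, intrinsicA α f q.1 q.2 ^ 2 ∂(upperMeasure n) ≤
      ⨆ x, ENNReal.ofReal (w c) * ‖I c x‖ₑ ^ 2 := by
    intro c
    calc _ ≤ ∫⁻ q in whitneyBox c, (⨆ x, ‖I c x‖ₑ ^ 2) ∂(upperMeasure n) := by
          refine setLIntegral_mono' (measurableSet_whitneyBox c) fun q hq => ?_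
          rw [← ENNReal.iSup_pow_of_ne_zero two_ne_zero]
          refine pow_le_pow_left' (iSup₂_le fun φ hφ => ?_) 2
          exact le_iSup (fun x => ‖I c x‖ₑ) ⟨(φ, q), hφ, hq⟩
      _ = (⨆ x, ‖I c x‖ₑ ^ 2) * upperMeasure n (whitneyBox c) := by
          rw [setLIntegral_const]
      _ ≤ (⨆ x, ‖I c x‖ₑ ^ 2) * ENNReal.ofReal (w c) :=
          mul_le_mul_right (upperMeasure_whitneyBox_le c) _
      _ = _ := by rw [mul_comm, ENNReal.mul_iSup]
  have hcover : ∀ᵐ q ∂(upperMeasure n), q ∈ ⋃ c, whitneyBox c := by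
    filter_upwards [ae_upperMeasure_pos] with q hq
    exact mem_iUnion.2 (exists_mem_whitneyBox hq)
  calc _ = ∫⁻ q in ⋃ c, whitneyBox c, intrinsicA α f q.1 q.2 ^ 2 ∂(upperMeasure n) := by
        rw [Measure.restrict_eq_self_of_ae_mem hcover]
    _ ≤ ∑' c, ∫⁻ q in whitneyBox c, intrinsicA α f q.1 q.2 ^ 2 ∂(upperMeasure n) :=
        lintegral_iUnion_le _ _
    _ ≤ ∑' c, ⨆ x, ENNReal.ofReal (w c) * ‖I c x‖ₑ ^ 2 := ENNReal.tsum_le_tsum hbox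
    _ ≤ _ := by
        rw [ENNReal.tsum_eq_iSup_sum]
        refine iSup_le fun s => sum_iSup_le_of_forall_choice _ s fun x => ?_
        let K : ℤ × (Fin n → ℤ) → Lp ℂ 2 (volume : Measure (Rn n)) := fun c =>
          (memLp_dilate (x c).2.1 hα (hTpos c (x c)) (x c).1.2.1).toLp _
        have hinner : ∀ c d, ‖inner ℂ (K c) (K d)‖ =
            |∫ z, dilate (x c).1.1 (x c).1.2.2 ((x c).1.2.1 - z) *
              dilate (x d).1.1 (x d).1.2.2 ((x d).1.2.1 - z)| := by
          intro c d
          rw [inner_toLp_dilate (x c).2.1 hα (hTpos c (x c)) (x c).1.2.1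
            (memLp_dilate (x d).2.1 hα (hTpos d (x d)) (x d).1.2.1), ← Real.norm_eq_abs,
            ← Complex.norm_real, ← integral_complex_ofReal]
          simp
        have hsch := sum_mul_norm_inner_sq_le s w hw K hC₀0 (fun c _ => by
          simp only [hinner]
          exact sum_abs_integral_dilate_whitney_le hα hα1 (x c).2.1 (x c).2.2 s
            (fun d => (x d).1.1) (fun d => (x d).2.1) (fun d => (x d).1.2) (fun d => (x d).2.2))
          (hf.toLp f)
        have hI : ∀ c, inner ℂ (K c) (hf.toLp f) = I c (x c) := fun c =>
          inner_toLp_dilate (x c).2.1 hα (hTpos c (x c)) (x c).1.2.1 hf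
        simp only [hI] at hsch
        rw [← ofReal_norm_toLp_sq hf, ← ENNReal.ofReal_mul hC₀0]
        refine le_trans (le_of_eq ?_) (ENNReal.ofReal_le_ofReal hsch)
        rw [ENNReal.ofReal_sum_of_nonneg fun c _ => mul_nonneg (hw c) (by positivity)]
        refine Finset.sum_congr rfl fun c _ => ?_
        rw [ENNReal.ofReal_mul (hw c), ENNReal.ofReal_pow (norm_nonneg _), ofReal_norm]

/-! ### The Hardy–Littlewood maximal function -/

/-- The uncentred Hardy–Littlewood maximal function of a `[0, ∞]`-valued function. -/
noncomputable def hlMax (w : Rn n → ℝ≥0∞) (x : Rn n) : ℝ≥0∞ :=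
  ⨆ (c : Rn n) (r : ℝ) (_ : x ∈ ball c r), (∫⁻ z in ball c r, w z) / volume (ball c r)

theorem lt_hlMax_iff {w : Rn n → ℝ≥0∞} {x : Rn n} {a : ℝ≥0∞} : a < hlMax w x ↔
    ∃ c r, x ∈ ball c r ∧ a < (∫⁻ z in ball c r, w z) / volume (ball c r) := by
  simp only [hlMax, lt_iSup_iff, exists_prop]

theorem lintegral_div_volume_le_hlMax (w : Rn n → ℝ≥0∞) {x c : Rn n} {r : ℝ} (hx : x ∈ ball c r) :
    (∫⁻ z in ball c r, w z) / volume (ball c r) ≤ hlMax w x :=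
  le_iSup₂_of_le c r (le_iSup_of_le hx le_rfl)

theorem lintegral_ball_le_of_hlMax_le {w : Rn n → ℝ≥0∞} {x c : Rn n} {r : ℝ} (hx : x ∈ ball c r)
    {a : ℝ≥0∞} (ha : hlMax w x ≤ a) : ∫⁻ z in ball c r, w z ≤ a * volume (ball c r) := by
  have h := (lintegral_div_volume_le_hlMax w hx).trans ha
  have hr : 0 < r := pos_of_mem_ball hx
  exact (ENNReal.div_le_iff (measure_ball_pos _ _ hr).ne' measure_ball_lt_top.ne).1 h

theorem isOpen_lt_hlMax (w : Rn n → ℝ≥0∞) (a : ℝ≥0∞) : IsOpen {x | a < hlMax w x} := by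
  rw [isOpen_iff_mem_nhds]
  intro x hx
  obtain ⟨c, r, hxc, h⟩ := lt_hlMax_iff.1 hx
  filter_upwards [isOpen_ball.mem_nhds hxc] with y hy
  exact lt_hlMax_iff.2 ⟨c, r, hy, h⟩

theorem measurable_hlMax (w : Rn n → ℝ≥0∞) : Measurable (hlMax w) :=
  measurable_of_Ioi fun a => (isOpen_lt_hlMax w a).measurableSet

/-- The weak type `(1, 1)` inequality, from the Vitali covering lemma. -/
theorem mul_volume_lt_hlMax_le [Nontrivial (Rn n)] (w : Rn n → ℝ≥0∞) {a : ℝ} (ha : 0 < a) :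
    ENNReal.ofReal a * volume {x | ENNReal.ofReal a < hlMax w x} ≤
      ENNReal.ofReal (5 ^ n) * ∫⁻ z, w z := by
  rcases eq_or_ne (∫⁻ z, w z) ⊤ with htop | htop
  · rw [htop, ENNReal.mul_top (by simp)]; exact le_top
  have hn : n ≠ 0 := by
    rintro rfl
    exact not_subsingleton (Rn 0) inferInstance
  let t : Set (Rn n × ℝ) := {b | 0 < b.2 ∧
    ENNReal.ofReal a < (∫⁻ z in ball b.1 b.2, w z) / volume (ball b.1 b.2)}
  have ht : ∀ b ∈ t, ENNReal.ofReal a * volume (ball b.1 b.2) ≤ ∫⁻ z in ball b.1 b.2, w z := by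
    intro b hb
    exact (ENNReal.le_div_iff_mul_le (Or.inl (measure_ball_pos _ _ hb.1).ne')
      (Or.inl measure_ball_lt_top.ne)).1 hb.2.le
  -- the radii are bounded, because the balls have volume at most `(∫ w) / a`
  obtain ⟨R, hR⟩ : ∃ R : ℝ, ∀ b ∈ t, b.2 ≤ R := by
    have hv := (volume_unitBall_pos (n := n)).ne'
    set V := (∫⁻ z, w z) / (ENNReal.ofReal a * volume (ball (0 : Rn n) 1)) with hV
    have hVtop : V ≠ ⊤ := ENNReal.div_ne_top htop (mul_ne_zero (by simpa using ha) hv)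
    refine ⟨max 1 V.toReal, fun b hb => ?_⟩
    rcases le_total b.2 1 with h1 | h1
    · exact h1.trans (le_max_left _ _)
    · refine le_trans ?_ (le_max_right _ _)
      have h2 : ENNReal.ofReal (b.2 ^ n) ≤ V := by
        rw [hV, ENNReal.le_div_iff_mul_le (Or.inl (mul_ne_zero (by simpa using ha) hv))
          (Or.inl (ENNReal.mul_ne_top ENNReal.ofReal_ne_top volume_unitBall_ne_top))]
        calc _ = ENNReal.ofReal a * volume (ball b.1 b.2) := by
              rw [volume_ball_eq _ hb.1.le]; ring
          _ ≤ _ := ht b hb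
          _ ≤ _ := setLIntegral_le_lintegral _ _
      have h3 := (ENNReal.ofReal_le_iff_le_toReal hVtop).1 h2
      exact (le_self_pow₀ h1 hn).trans h3
  obtain ⟨u, hut, hdisj, hcov⟩ := Vitali.exists_disjoint_subfamily_covering_enlargement_ball t
    (fun b => b.1) (fun b => b.2) R hR 5 (by norm_num)
  have hucount : u.Countable := hdisj.countable_of_isOpen (fun b _ => isOpen_ball)
    fun b hb => ⟨b.1, mem_ball_self (hut hb).1⟩
  have hsub : {x | ENNReal.ofReal a < hlMax w x} ⊆ ⋃ b ∈ u, ball b.1 (5 * b.2) := by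
    intro x hx
    obtain ⟨c, r, hxc, h⟩ := lt_hlMax_iff.1 hx
    obtain ⟨b, hbu, hb⟩ := hcov (c, r) ⟨pos_of_mem_ball hxc, h⟩
    exact mem_iUnion₂.2 ⟨b, hbu, hb hxc⟩
  calc _ ≤ ENNReal.ofReal a * ∑' b : u, volume (ball b.1.1 (5 * b.1.2)) := by
        gcongr
        exact (measure_mono hsub).trans (measure_biUnion_le _ hucount _)
    _ = ∑' b : u, ENNReal.ofReal (5 ^ n) * (ENNReal.ofReal a * volume (ball b.1.1 b.1.2)) := by
        rw [← ENNReal.tsum_mul_left]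
        refine tsum_congr fun b => ?_
        have hb := (hut b.2).1
        rw [volume_ball_eq _ (by positivity), volume_ball_eq _ hb.le, mul_pow,
          ENNReal.ofReal_mul (by positivity)]
        ring
    _ ≤ ∑' b : u, ENNReal.ofReal (5 ^ n) * ∫⁻ z in ball b.1.1 b.1.2, w z :=
        ENNReal.tsum_le_tsum fun b => mul_le_mul_right (ht b.1 (hut b.2)) _
    _ = ENNReal.ofReal (5 ^ n) * ∫⁻ z in ⋃ b ∈ u, ball b.1 b.2, w z := by
        rw [ENNReal.tsum_mul_left, lintegral_biUnion hucount (fun _ _ => measurableSet_ball) hdisj]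
    _ ≤ _ := mul_le_mul_right (setLIntegral_le_lintegral _ _) _

/-- The weak type inequality localized to the large values of `w`: the part of `w` below `a / 2`
contributes at most `a / 2` to any average. -/
theorem mul_volume_lt_hlMax_le_setLIntegral [Nontrivial (Rn n)] {w : Rn n → ℝ≥0∞}
    (hw : Measurable w) {a : ℝ} (ha : 0 < a) :
    ENNReal.ofReal a * volume {x | ENNReal.ofReal a < hlMax w x} ≤
      ENNReal.ofReal (2 * 5 ^ n) * ∫⁻ z in {z | ENNReal.ofReal a < 2 * w z}, w z := by
  set E := {z | ENNReal.ofReal a < 2 * w z} with hE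
  have hEm : MeasurableSet E := measurableSet_lt measurable_const (hw.const_mul _)
  have hsub : {x | ENNReal.ofReal a < hlMax w x} ⊆
      {x | ENNReal.ofReal (a / 2) < hlMax (E.indicator w) x} := by
    intro x hx
    obtain ⟨c, r, hxc, h⟩ := lt_hlMax_iff.1 hx
    refine lt_hlMax_iff.2 ⟨c, r, hxc, ?_⟩
    have hv0 : volume (ball c r) ≠ 0 := (measure_ball_pos _ _ (pos_of_mem_ball hxc)).ne'
    have hv1 : volume (ball c r) ≠ ⊤ := measure_ball_lt_top.ne
    by_contra! hcon
    apply not_le.2 h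
    rw [ENNReal.div_le_iff hv0 hv1] at hcon ⊢
    calc ∫⁻ z in ball c r, w z ≤ ∫⁻ z in ball c r, (E.indicator w z + ENNReal.ofReal (a / 2)) := by
          refine lintegral_mono fun z => ?_
          by_cases hz : z ∈ E
          · rw [indicator_of_mem hz]; exact le_self_add
          · rw [indicator_of_notMem hz, zero_add]
            have : 2 * w z ≤ ENNReal.ofReal a := not_lt.1 hz
            rw [ENNReal.ofReal_div_of_pos two_pos, ENNReal.le_div_iff_mul_le (by simp) (by simp),
              mul_comm]
            simpa using this
      _ = (∫⁻ z in ball c r, E.indicator w z) + ENNReal.ofReal (a / 2) * volume (ball c r) := by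
          rw [lintegral_add_right _ measurable_const, setLIntegral_const]
      _ ≤ ENNReal.ofReal (a / 2) * volume (ball c r) + ENNReal.ofReal (a / 2) * volume (ball c r) :=
          add_le_add_left hcon _
      _ = ENNReal.ofReal a * volume (ball c r) := by
          rw [← add_mul, ← ENNReal.ofReal_add (by positivity) (by positivity), add_halves]
  calc _ ≤ ENNReal.ofReal a * volume {x | ENNReal.ofReal (a / 2) < hlMax (E.indicator w) x} :=
        mul_le_mul_right (measure_mono hsub) _
    _ = 2 * (ENNReal.ofReal (a / 2) *
          volume {x | ENNReal.ofReal (a / 2) < hlMax (E.indicator w) x}) := by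
        rw [← mul_assoc]
        congr 1
        rw [← ENNReal.ofReal_ofNat 2, ← ENNReal.ofReal_mul (by norm_num), mul_div_cancel₀ _ two_ne_zero]
    _ ≤ 2 * (ENNReal.ofReal (5 ^ n) * ∫⁻ z, E.indicator w z) :=
        mul_le_mul_right (mul_volume_lt_hlMax_le _ (half_pos ha)) _
    _ = _ := by
        rw [lintegral_indicator hEm, ENNReal.ofReal_mul (by norm_num), ENNReal.ofReal_ofNat, mul_assoc]

/-- The identity `∫₀ˣ tᵖ⁻¹ dt = xᵖ / p`, valid also for `x = ∞`. -/
theorem lintegral_Ioi_indicator_rpow {p : ℝ} (hp : 0 < p) (x : ℝ≥0∞) :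
    ∫⁻ t in Ioi (0 : ℝ), {t | ENNReal.ofReal t < x}.indicator
      (fun t => ENNReal.ofReal (t ^ (p - 1))) t = x ^ p / ENNReal.ofReal p := by
  have hfin : ∀ b : ℝ, 0 ≤ b → ∫⁻ t in Ioi (0 : ℝ), {t | ENNReal.ofReal t < ENNReal.ofReal b}.indicator
      (fun t => ENNReal.ofReal (t ^ (p - 1))) t = ENNReal.ofReal b ^ p / ENNReal.ofReal p := by
    intro b hb
    have hm : MeasurableSet {t : ℝ | ENNReal.ofReal t < ENNReal.ofReal b} :=
      measurableSet_lt ENNReal.measurable_ofReal measurable_const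
    rw [lintegral_indicator hm, Measure.restrict_restrict hm]
    have e : {t : ℝ | ENNReal.ofReal t < ENNReal.ofReal b} ∩ Ioi 0 = Ioo 0 b := by
      ext t
      simp only [mem_inter_iff, mem_ofPred_eq, mem_Ioi, mem_Ioo, ENNReal.ofReal_lt_ofReal_iff']
      constructor
      · rintro ⟨⟨h1, h2⟩, h3⟩; exact ⟨h3, h1⟩
      · rintro ⟨h1, h2⟩; exact ⟨⟨h2, h1.trans h2⟩, h1⟩
    rw [e, setLIntegral_congr Ioo_ae_eq_Ioc, ← ofReal_integral_eq_lintegral_ofReal,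
      ← intervalIntegral.integral_of_le hb, integral_rpow (Or.inl (by linarith)),
      sub_add_cancel, Real.zero_rpow hp.ne', sub_zero, ENNReal.ofReal_div_of_pos hp,
      ENNReal.ofReal_rpow_of_nonneg hb hp.le]
    · exact (intervalIntegrable_iff_integrableOn_Ioc_of_le hb).1
        (intervalIntegral.intervalIntegrable_rpow' (by linarith))
    · filter_upwards [ae_restrict_mem measurableSet_Ioc] with t ht
      exact Real.rpow_nonneg ht.1.le _
  rcases eq_or_ne x ⊤ with rfl | hx
  · rw [ENNReal.top_rpow_of_pos hp, ENNReal.top_div_of_ne_top ENNReal.ofReal_ne_top]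
    refine ENNReal.eq_top_of_forall_nnreal_le fun r => ?_
    have h1 := hfin ((r * p : ℝ) ^ p⁻¹) (by positivity)
    rw [ENNReal.ofReal_rpow_of_nonneg (by positivity) hp.le, ← Real.rpow_mul (by positivity),
      inv_mul_cancel₀ hp.ne', Real.rpow_one, ← ENNReal.ofReal_div_of_pos hp,
      mul_div_cancel_right₀ _ hp.ne', ENNReal.ofReal_coe_nnreal] at h1
    rw [← h1]
    refine lintegral_mono fun t => indicator_le_indicator_of_subset (fun t _ => ?_) (fun _ => zero_le) t
    simp
  · have := hfin x.toReal ENNReal.toReal_nonneg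
    rwa [ENNReal.ofReal_toReal hx] at this

/-- The identity `∫ₓ^∞ tᵖ⁻¹ dt = xᵖ / (-p)` for `p < 0`. -/
theorem lintegral_Ioi_indicator_rpow_of_le {p : ℝ} (hp : p < 0) {x : ℝ≥0∞} (hx : x ≠ 0) :
    ∫⁻ t in Ioi (0 : ℝ), {t | x ≤ ENNReal.ofReal t}.indicator
      (fun t => ENNReal.ofReal (t ^ (p - 1))) t = x ^ p / ENNReal.ofReal (-p) := by
  rcases eq_or_ne x ⊤ with rfl | hxt
  · simp [ENNReal.top_rpow_of_neg hp]
  obtain ⟨b, hb0, rfl⟩ : ∃ b : ℝ, 0 < b ∧ x = ENNReal.ofReal b :=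
    ⟨x.toReal, ENNReal.toReal_pos hx hxt, (ENNReal.ofReal_toReal hxt).symm⟩
  have hm : MeasurableSet {t : ℝ | ENNReal.ofReal b ≤ ENNReal.ofReal t} :=
    measurableSet_le measurable_const ENNReal.measurable_ofReal
  rw [lintegral_indicator hm, Measure.restrict_restrict hm]
  have e : {t : ℝ | ENNReal.ofReal b ≤ ENNReal.ofReal t} ∩ Ioi 0 = Ici b := by
    ext t
    simp only [mem_inter_iff, mem_ofPred_eq, mem_Ioi, mem_Ici]
    constructor
    · rintro ⟨h1, h2⟩; exact (ENNReal.ofReal_le_ofReal_iff h2.le).1 h1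
    · intro h1; exact ⟨ENNReal.ofReal_le_ofReal h1, hb0.trans_le h1⟩
  rw [e, setLIntegral_congr Ioi_ae_eq_Ici.symm, ← ofReal_integral_eq_lintegral_ofReal,
    integral_Ioi_rpow_of_lt (by linarith) hb0, sub_add_cancel, neg_div, ← div_neg,
    ENNReal.ofReal_div_of_pos (by linarith), ENNReal.ofReal_rpow_of_pos hb0]
  · exact integrableOn_Ioi_rpow_of_lt (by linarith) hb0
  · filter_upwards [ae_restrict_mem measurableSet_Ioi] with t ht
    exact Real.rpow_nonneg (hb0.trans ht).le _

/-- The layer cake formula for a `[0, ∞]`-valued function, which may take the value `∞`. -/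
theorem lintegral_rpow_eq_mul_lintegral_Ioi {X : Type*} [MeasurableSpace X] (μ : Measure X)
    [SFinite μ] {p : ℝ} (hp : 0 < p) {g : X → ℝ≥0∞} (hg : Measurable g) :
    ∫⁻ x, g x ^ p ∂μ = ENNReal.ofReal p *
      ∫⁻ t in Ioi (0 : ℝ), μ {x | ENNReal.ofReal t < g x} * ENNReal.ofReal (t ^ (p - 1)) := by
  have hp' : ENNReal.ofReal p ≠ 0 := by simpa using hp
  have e : ∀ x, g x ^ p = ENNReal.ofReal p * ∫⁻ t in Ioi (0 : ℝ),
      {t | ENNReal.ofReal t < g x}.indicator (fun t => ENNReal.ofReal (t ^ (p - 1))) t := by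
    intro x
    rw [lintegral_Ioi_indicator_rpow hp, ENNReal.mul_div_cancel hp' ENNReal.ofReal_ne_top]
  simp_rw [e]
  rw [lintegral_const_mul' _ _ ENNReal.ofReal_ne_top]
  congr 1
  have hms : MeasurableSet {z : X × ℝ | ENNReal.ofReal z.2 < g z.1} :=
    measurableSet_lt (ENNReal.measurable_ofReal.comp measurable_snd) (hg.comp measurable_fst)
  have hm : Measurable (fun z : X × ℝ => {z : X × ℝ | ENNReal.ofReal z.2 < g z.1}.indicator
      (fun z => ENNReal.ofReal (z.2 ^ (p - 1))) z) :=
    Measurable.indicator (by fun_prop) hms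
  rw [lintegral_lintegral_swap (f := fun x t => {t | ENNReal.ofReal t < g x}.indicator
    (fun t => ENNReal.ofReal (t ^ (p - 1))) t)]
  · refine lintegral_congr fun t => ?_
    have : ∀ x, {t | ENNReal.ofReal t < g x}.indicator (fun t => ENNReal.ofReal (t ^ (p - 1))) t =
        {x | ENNReal.ofReal t < g x}.indicator (fun _ => ENNReal.ofReal (t ^ (p - 1))) x := fun x => rfl
    simp_rw [this]
    rw [lintegral_indicator (measurableSet_lt measurable_const hg), setLIntegral_const, mul_comm]
  · exact hm.aemeasurable

/-- The maximal operator is bounded on `Lᵖ` for `p > 1`. -/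
theorem exists_lintegral_hlMax_rpow_le [Nontrivial (Rn n)] {p : ℝ} (hp : 1 < p) :
    ∃ C : ℝ≥0∞, C ≠ ⊤ ∧ ∀ w : Rn n → ℝ≥0∞, Measurable w →
      ∫⁻ x, hlMax w x ^ p ≤ C * ∫⁻ x, w x ^ p := by
  have hp1 : 0 < p - 1 := by linarith
  refine ⟨ENNReal.ofReal p * (ENNReal.ofReal (2 * 5 ^ n) * (2 ^ (p - 1) / ENNReal.ofReal (p - 1))),
    ?_, fun w hw => ?_⟩
  · refine ENNReal.mul_ne_top ENNReal.ofReal_ne_top (ENNReal.mul_ne_top ENNReal.ofReal_ne_top ?_)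
    exact ENNReal.div_ne_top (ENNReal.rpow_ne_top_of_nonneg hp1.le (by simp)) (by simpa using hp1)
  rw [lintegral_rpow_eq_mul_lintegral_Ioi volume (by linarith) (measurable_hlMax w), mul_assoc]
  refine mul_le_mul_right ?_ _
  have h1 : ∀ t ∈ Ioi (0 : ℝ), volume {x | ENNReal.ofReal t < hlMax w x} *
      ENNReal.ofReal (t ^ (p - 1)) ≤ ENNReal.ofReal (2 * 5 ^ n) *
        ∫⁻ x, {t | ENNReal.ofReal t < 2 * w x}.indicator
          (fun t => ENNReal.ofReal (t ^ (p - 1 - 1))) t * w x := by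
    intro t ht
    have ht0 : (0 : ℝ) < t := ht
    have e : ENNReal.ofReal (t ^ (p - 1)) = ENNReal.ofReal t * ENNReal.ofReal (t ^ (p - 1 - 1)) := by
      rw [← ENNReal.ofReal_mul ht0.le, Real.rpow_sub_one ht0.ne' (p - 1),
        mul_div_cancel₀ _ ht0.ne']
    rw [e, ← mul_assoc, mul_comm (volume _)]
    refine (mul_le_mul_left (mul_volume_lt_hlMax_le_setLIntegral hw ht0) _).trans_eq ?_
    rw [mul_assoc, mul_comm (∫⁻ z in _, w z), ← lintegral_const_mul' _ _ ENNReal.ofReal_ne_top,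
      ← lintegral_indicator (measurableSet_lt measurable_const (hw.const_mul _))]
    congr 1
    refine lintegral_congr fun x => ?_
    by_cases h : ENNReal.ofReal t < 2 * w x <;> simp [h]
  refine (setLIntegral_mono' measurableSet_Ioi h1).trans ?_
  rw [lintegral_const_mul' _ _ ENNReal.ofReal_ne_top, mul_assoc]
  refine mul_le_mul_right ?_ _
  have hms : MeasurableSet {z : ℝ × Rn n | ENNReal.ofReal z.1 < 2 * w z.2} :=
    measurableSet_lt (ENNReal.measurable_ofReal.comp measurable_fst)
      ((hw.comp measurable_snd).const_mul _)
  have hm : Measurable (fun z : ℝ × Rn n => {z : ℝ × Rn n | ENNReal.ofReal z.1 < 2 * w z.2}.indicator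
      (fun z => ENNReal.ofReal (z.1 ^ (p - 1 - 1))) z * w z.2) :=
    (Measurable.indicator (by fun_prop) hms).mul (hw.comp measurable_snd)
  rw [lintegral_lintegral_swap (f := fun t x => {t | ENNReal.ofReal t < 2 * w x}.indicator
    (fun t => ENNReal.ofReal (t ^ (p - 1 - 1))) t * w x) hm.aemeasurable]
  have h2 : ∀ x, ∫⁻ t in Ioi (0 : ℝ), {t | ENNReal.ofReal t < 2 * w x}.indicator
      (fun t => ENNReal.ofReal (t ^ (p - 1 - 1))) t * w x =
      2 ^ (p - 1) / ENNReal.ofReal (p - 1) * w x ^ p := by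
    intro x
    rw [lintegral_mul_const _ (Measurable.indicator (by fun_prop)
      (measurableSet_lt ENNReal.measurable_ofReal measurable_const)),
      lintegral_Ioi_indicator_rpow hp1, ENNReal.mul_rpow_of_nonneg _ _ hp1.le]
    have : w x ^ p = w x ^ (p - 1) * w x := by
      conv_lhs => rw [show p = (p - 1) + 1 by ring]
      rw [ENNReal.rpow_add_of_nonneg _ _ hp1.le zero_le_one, ENNReal.rpow_one]
    rw [this]
    simp only [div_eq_mul_inv]
    ring
  simp_rw [h2]
  rw [lintegral_const_mul _ (hw.pow_const p)]

theorem ae_enorm_le_hlMax [Nontrivial (Rn n)] {f : Rn n → ℂ} (hf : Integrable f) :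
    ∀ᵐ x, ‖f x‖ₑ ≤ hlMax (fun x => ‖f x‖ₑ) x := by
  have h := (Besicovitch.vitaliFamily (volume : Measure (Rn n))).ae_tendsto_lintegral_div
    hf.1.enorm hf.2.ne
  filter_upwards [h] with x hx
  refine le_of_tendsto (hx.comp (Besicovitch.tendsto_filterAt volume x)) ?_
  filter_upwards [self_mem_nhdsWithin] with r hr
  have hr0 : (0 : ℝ) < r := hr
  have e : (closedBall x r : Set (Rn n)) =ᵐ[volume] ball x r := by
    rw [← ball_union_sphere]
    exact union_ae_eq_left_of_ae_eq_empty
      (ae_eq_empty.2 (Measure.addHaar_sphere volume x r))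
  simp only [Function.comp]
  rw [setLIntegral_congr e, measure_congr e]
  exact lintegral_div_volume_le_hlMax _ (mem_ball_self hr0)

/-! ### Weighted estimate and the range `p > 2` -/

theorem lintegral_upperMeasure (G : Rn n × ℝ → ℝ≥0∞) :
    ∫⁻ q, G q ∂(upperMeasure n) = ∫⁻ q in {q : Rn n × ℝ | 0 < q.2}, ENNReal.ofReal q.2⁻¹ * G q := by
  have e : upperMeasure n = (volume.restrict {q : Rn n × ℝ | 0 < q.2}).withDensity
      fun q => ENNReal.ofReal q.2⁻¹ := by
    have h : {q : Rn n × ℝ | 0 < q.2} = univ ×ˢ Ioi 0 := by ext q; simp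
    rw [upperMeasure, scaleMeasure, prod_withDensity_right (by fun_prop), h, Measure.volume_eq_prod,
      ← Measure.prod_restrict, Measure.restrict_univ]
  rw [e, lintegral_withDensity_eq_lintegral_mul_non_measurable _ (by fun_prop)
    (ae_of_all _ fun _ => ENNReal.ofReal_lt_top)]
  rfl

theorem isOpen_cone (x : Rn n) : IsOpen (cone x) :=
  (isOpen_lt continuous_const continuous_snd).inter
    (isOpen_lt (continuous_const.sub continuous_fst).norm continuous_snd)

/-- The square of the intrinsic square function as an integral against `dy dt / t`. -/
theorem intrinsicSquare_sq (f : Rn n → ℂ) (x : Rn n) :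
    intrinsicSquare α f x ^ 2 = ∫⁻ q, (cone x).indicator
      (fun q => intrinsicA α f q.1 q.2 ^ 2 / ENNReal.ofReal (q.2 ^ n)) q ∂(upperMeasure n) := by
  have h1 : intrinsicSquare α f x ^ 2 =
      ∫⁻ q in cone x, intrinsicA α f q.1 q.2 ^ 2 / ENNReal.ofReal (q.2 ^ (n + 1)) := by
    rw [intrinsicSquare, ← ENNReal.rpow_natCast, ← ENNReal.rpow_mul]
    norm_num
  rw [h1, lintegral_upperMeasure]
  have hsub : cone x ∩ {q : Rn n × ℝ | 0 < q.2} = cone x := inter_eq_left.2 fun q hq => hq.1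
  rw [← hsub, ← Measure.restrict_restrict (isOpen_cone x).measurableSet, hsub,
    ← lintegral_indicator (isOpen_cone x).measurableSet]
  refine lintegral_congr fun q => ?_
  by_cases hq : q ∈ cone x
  · have hq0 : 0 < q.2 := hq.1
    rw [indicator_of_mem hq, indicator_of_mem hq, pow_succ' q.2 n, ENNReal.ofReal_mul hq0.le,
      ENNReal.ofReal_inv_of_pos hq0, div_eq_mul_inv, div_eq_mul_inv,
      ENNReal.mul_inv (by simp) (by simp)]
    ring
  · simp [hq]

theorem measurable_coneIntegrand [Nontrivial (Rn n)] (hα : 0 < α) (hα1 : α ≤ 1) {f : Rn n → ℂ}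
    (hf : LocallyIntegrable f volume) :
    Measurable fun z : Rn n × (Rn n × ℝ) => (cone z.1).indicator
      (fun q => intrinsicA α f q.1 q.2 ^ 2 / ENNReal.ofReal (q.2 ^ n)) z.2 := by
  set B := {q : Rn n × ℝ | 0 < q.2}.indicator fun q => intrinsicA α f q.1 q.2 with hB
  have hBm : Measurable B := measurable_indicator_intrinsicA hα hα1 hf
  have hs : MeasurableSet {z : Rn n × (Rn n × ℝ) | z.2 ∈ cone z.1} := by
    refine IsOpen.measurableSet ((isOpen_lt continuous_const (continuous_snd.comp continuous_snd)).inter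
      (isOpen_lt (continuous_fst.sub (continuous_fst.comp continuous_snd)).norm
        (continuous_snd.comp continuous_snd)))
  have e : (fun z : Rn n × (Rn n × ℝ) => (cone z.1).indicator
      (fun q => intrinsicA α f q.1 q.2 ^ 2 / ENNReal.ofReal (q.2 ^ n)) z.2) =
      {z : Rn n × (Rn n × ℝ) | z.2 ∈ cone z.1}.indicator
        (fun z => B z.2 ^ 2 / ENNReal.ofReal (z.2.2 ^ n)) := by
    ext z
    by_cases hz : z.2 ∈ cone z.1
    · have : z.2 ∈ {q : Rn n × ℝ | 0 < q.2} := hz.1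
      simp [hz, hB, this]
    · simp [hz]
  rw [e]
  refine Measurable.indicator ?_ hs
  exact ((hBm.comp measurable_snd).pow_const 2).div (by fun_prop)

theorem measurable_intrinsicSquare [Nontrivial (Rn n)] (hα : 0 < α) (hα1 : α ≤ 1) {f : Rn n → ℂ}
    (hf : LocallyIntegrable f volume) : Measurable (intrinsicSquare α f) := by
  have h := (measurable_coneIntegrand hα hα1 hf).lintegral_prod_right' (ν := upperMeasure n)
  have e : intrinsicSquare α f = fun x => (∫⁻ q, (cone x).indicator
      (fun q => intrinsicA α f q.1 q.2 ^ 2 / ENNReal.ofReal (q.2 ^ n)) q ∂(upperMeasure n)) ^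
        (1 / 2 : ℝ) := by
    ext x
    rw [← intrinsicSquare_sq, ← ENNReal.rpow_natCast, ← ENNReal.rpow_mul]
    norm_num
  rw [e]
  exact h.pow_const _

theorem measurable_lintegral_ball {w : Rn n → ℝ≥0∞} (hw : Measurable w) :
    Measurable fun q : Rn n × ℝ => ∫⁻ z in ball q.1 q.2, w z := by
  have hs : MeasurableSet {p : (Rn n × ℝ) × Rn n | p.2 ∈ ball p.1.1 p.1.2} :=
    (isOpen_lt (continuous_snd.dist (continuous_fst.comp continuous_fst))
      (continuous_snd.comp continuous_fst)).measurableSet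
  have h : Measurable ({p : (Rn n × ℝ) × Rn n | p.2 ∈ ball p.1.1 p.1.2}.indicator
      fun p => w p.2) := (hw.comp measurable_snd).indicator hs
  have e : (fun q : Rn n × ℝ => ∫⁻ z in ball q.1 q.2, w z) = fun q => ∫⁻ z,
      {p : (Rn n × ℝ) × Rn n | p.2 ∈ ball p.1.1 p.1.2}.indicator (fun p => w p.2) (q, z) := by
    ext q
    rw [← lintegral_indicator measurableSet_ball]
    rfl
  rw [e]
  exact h.lintegral_prod_right'

/-- Fubini over cones: `∫ (S f)² w` is the integral of `(A f)²` against the averages of `w`. -/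
theorem lintegral_intrinsicSquare_sq_mul [Nontrivial (Rn n)] (hα : 0 < α) (hα1 : α ≤ 1)
    {f : Rn n → ℂ} (hf : LocallyIntegrable f volume) {w : Rn n → ℝ≥0∞} (hw : Measurable w) :
    ∫⁻ x, intrinsicSquare α f x ^ 2 * w x = volume (ball (0 : Rn n) 1) *
      ∫⁻ q, intrinsicA α f q.1 q.2 ^ 2 * ((∫⁻ z in ball q.1 q.2, w z) / volume (ball q.1 q.2))
        ∂(upperMeasure n) := by
  have hm := measurable_coneIntegrand hα hα1 hf
  simp_rw [intrinsicSquare_sq]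
  have e : ∀ x, (∫⁻ q, (cone x).indicator
      (fun q => intrinsicA α f q.1 q.2 ^ 2 / ENNReal.ofReal (q.2 ^ n)) q ∂(upperMeasure n)) * w x =
      ∫⁻ q, (cone x).indicator
      (fun q => intrinsicA α f q.1 q.2 ^ 2 / ENNReal.ofReal (q.2 ^ n)) q * w x ∂(upperMeasure n) := by
    intro x
    exact (lintegral_mul_const _ (hm.comp measurable_prodMk_left)).symm
  simp_rw [e]
  rw [lintegral_lintegral_swap (hm.mul (hw.comp measurable_fst)).aemeasurable,
    ← lintegral_const_mul' _ _ volume_unitBall_ne_top]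
  refine lintegral_congr_ae ?_
  filter_upwards [ae_upperMeasure_pos] with q hq
  have e2 : ∀ x, (cone x).indicator
      (fun q => intrinsicA α f q.1 q.2 ^ 2 / ENNReal.ofReal (q.2 ^ n)) q * w x =
      (intrinsicA α f q.1 q.2 ^ 2 / ENNReal.ofReal (q.2 ^ n)) * (ball q.1 q.2).indicator w x := by
    intro x
    by_cases hx : x ∈ ball q.1 q.2
    · have : q ∈ cone x := ⟨hq, by rwa [← dist_eq_norm]⟩
      simp only [indicator_of_mem this, indicator_of_mem hx]
    · have : q ∉ cone x := fun h => hx (by rw [mem_ball, dist_eq_norm]; exact h.2)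
      simp only [indicator_of_notMem this, indicator_of_notMem hx, zero_mul, mul_zero]
  simp_rw [e2]
  rw [lintegral_const_mul _ (hw.indicator measurableSet_ball), lintegral_indicator measurableSet_ball,
    volume_ball_eq _ hq.le]
  have hv := (volume_unitBall_pos (n := n)).ne'
  have hv' := volume_unitBall_ne_top (n := n)
  rw [div_eq_mul_inv, div_eq_mul_inv, ENNReal.mul_inv (Or.inr hv') (Or.inr hv)]
  calc _ = intrinsicA α f q.1 q.2 ^ 2 * (ENNReal.ofReal (q.2 ^ n))⁻¹ *
        (∫⁻ z in ball q.1 q.2, w z) * 1 := by rw [mul_one]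
    _ = _ := by
      rw [← ENNReal.mul_inv_cancel hv hv']
      ring

/-- The weighted inequality `∫ (S f)² w ≤ C ∫ |f|² M w`. -/
theorem exists_lintegral_intrinsicSquare_sq_mul_le [Nontrivial (Rn n)] (hα : 0 < α) (hα1 : α ≤ 1) :
    ∃ C : ℝ≥0∞, C ≠ ⊤ ∧ ∀ f : Rn n → ℂ, LocallyIntegrable f volume →
      ∀ w : Rn n → ℝ≥0∞, Measurable w →
      ∫⁻ x, intrinsicSquare α f x ^ 2 * w x ≤ C * ∫⁻ x, ‖f x‖ₑ ^ 2 * hlMax w x := by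
  obtain ⟨C, hC, hL2⟩ := exists_lintegral_intrinsicA_sq_le (n := n) hα hα1
  refine ⟨volume (ball (0 : Rn n) 1) * C, ENNReal.mul_ne_top volume_unitBall_ne_top hC,
    fun f hf w hw => ?_⟩
  rw [lintegral_intrinsicSquare_sq_mul hα hα1 hf hw, mul_assoc]
  refine mul_le_mul_right ?_ _
  have hfm : AEMeasurable (fun x => ‖f x‖ₑ ^ 2) := hf.aestronglyMeasurable.enorm.pow_const 2
  set W : Rn n × ℝ → ℝ≥0∞ := fun q => (∫⁻ z in ball q.1 q.2, w z) / volume (ball q.1 q.2) with hW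
  have hWm : Measurable W := by
    refine (measurable_lintegral_ball hw).div ?_
    have := measurable_lintegral_ball (n := n) (w := fun _ => 1) measurable_const
    simpa using this
  have hcake : ∀ x : ℝ≥0∞, x = ∫⁻ t in Ioi (0 : ℝ),
      {t | ENNReal.ofReal t < x}.indicator (fun _ => 1) t := by
    intro x
    simpa using (lintegral_Ioi_indicator_rpow one_pos x).symm
  have hind : ∀ x : ℝ≥0∞, Measurable ({t | ENNReal.ofReal t < x}.indicator
      (fun _ : ℝ => (1 : ℝ≥0∞))) := fun x =>
    measurable_const.indicator (measurableSet_lt ENNReal.measurable_ofReal measurable_const)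
  have hAm := aemeasurable_intrinsicA hα hα1 hf
  calc ∫⁻ q, intrinsicA α f q.1 q.2 ^ 2 * W q ∂(upperMeasure n)
      = ∫⁻ q, (∫⁻ t in Ioi (0 : ℝ), intrinsicA α f q.1 q.2 ^ 2 *
          {t | ENNReal.ofReal t < W q}.indicator (fun _ => 1) t) ∂(upperMeasure n) := by
        refine lintegral_congr fun q => ?_
        rw [lintegral_const_mul _ (hind _), ← hcake]
    _ = ∫⁻ t in Ioi (0 : ℝ), ∫⁻ q, intrinsicA α f q.1 q.2 ^ 2 *
          {t | ENNReal.ofReal t < W q}.indicator (fun _ => 1) t ∂(upperMeasure n) := by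
        rw [lintegral_lintegral_swap]
        refine ((hAm.pow_const 2).comp_fst).mul (Measurable.aemeasurable ?_)
        have hms : MeasurableSet {z : (Rn n × ℝ) × ℝ | ENNReal.ofReal z.2 < W z.1} :=
          measurableSet_lt (ENNReal.measurable_ofReal.comp measurable_snd) (hWm.comp measurable_fst)
        exact (measurable_const (a := (1 : ℝ≥0∞))).indicator hms
    _ ≤ ∫⁻ t in Ioi (0 : ℝ), C * ∫⁻ x, ‖f x‖ₑ ^ 2 *
          {t | ENNReal.ofReal t < hlMax w x}.indicator (fun _ => 1) t := by
        refine lintegral_mono fun t => ?_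
        -- an average of `w` above the level `t` forces the ball into `E`, where `f` and
        -- `E.indicator f` agree
        set E := {x | ENNReal.ofReal t < hlMax w x} with hE
        have hEm : MeasurableSet E := (isOpen_lt_hlMax w _).measurableSet
        calc _ ≤ ∫⁻ q, intrinsicA α (E.indicator f) q.1 q.2 ^ 2 ∂(upperMeasure n) := by
              refine lintegral_mono_ae ?_
              filter_upwards [ae_upperMeasure_pos] with q hq
              by_cases hqt : ENNReal.ofReal t < W q
              · rw [indicator_of_mem (by exact hqt), mul_one,
                  intrinsicA_congr (g := E.indicator f) hα hq]
                intro z hz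
                rw [indicator_of_mem]
                exact hqt.trans_le (lintegral_div_volume_le_hlMax w hz)
              · rw [indicator_of_notMem (by exact hqt), mul_zero]
                exact zero_le
          _ ≤ C * ∫⁻ x, ‖E.indicator f x‖ₑ ^ 2 := hL2 _ (hf.aestronglyMeasurable.indicator hEm)
          _ = _ := by
              congr 1
              refine lintegral_congr fun x => ?_
              by_cases hx : x ∈ E
              · rw [indicator_of_mem hx, indicator_of_mem (by exact hx), mul_one]
              · rw [indicator_of_notMem hx, indicator_of_notMem (by exact hx)]; simp
    _ = C * ∫⁻ x, ‖f x‖ₑ ^ 2 * hlMax w x := by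
        rw [lintegral_const_mul' _ _ hC]
        congr 1
        rw [lintegral_lintegral_swap]
        · refine lintegral_congr fun x => ?_
          rw [lintegral_const_mul _ (hind _), ← hcake]
        · refine (hfm.comp_snd).mul (Measurable.aemeasurable ?_)
          have hms : MeasurableSet {z : ℝ × Rn n | ENNReal.ofReal z.1 < hlMax w z.2} :=
            measurableSet_lt (ENNReal.measurable_ofReal.comp measurable_fst)
              ((measurable_hlMax w).comp measurable_snd)
          exact (measurable_const (a := (1 : ℝ≥0∞))).indicator hms

/-- To bound `∫ gᵖ` it is enough to bound the integrals of the truncations of `g` in height and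
space, which are finite. -/
theorem lintegral_rpow_le_of_forall_truncation {p : ℝ} (hp : 0 < p) {g : Rn n → ℝ≥0∞}
    (hg : Measurable g) {K : ℝ≥0∞} (h : ∀ N : ℕ, ∫⁻ x, (ball (0 : Rn n) N).indicator
      (fun x => min (g x) N ^ p) x ≤ K) : ∫⁻ x, g x ^ p ≤ K := by
  refine le_of_tendsto' (lintegral_tendsto_of_tendsto_of_monotone
    (f := fun (N : ℕ) x => (ball (0 : Rn n) N).indicator (fun x => min (g x) N ^ p) x)
    (fun N => ?_) (ae_of_all _ fun x N N' hN => ?_) (ae_of_all _ fun x => ?_)) h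
  · exact (((hg.min measurable_const).pow_const p).indicator measurableSet_ball).aemeasurable
  · have hN' : (N : ℝ) ≤ N' := Nat.cast_le.2 hN
    refine (indicator_le_indicator_of_subset (ball_subset_ball hN') (fun _ => zero_le) x).trans ?_
    refine indicator_le_indicator ?_
    exact ENNReal.rpow_le_rpow (min_le_min_left _ (Nat.cast_le.2 hN)) hp.le
  · have h1 : Tendsto (fun N : ℕ => min (g x) (N : ℝ≥0∞) ^ p) atTop (𝓝 (g x ^ p)) := by
      have := (tendsto_const_nhds (x := g x)).min ENNReal.tendsto_nat_nhds_top
      rw [min_eq_left le_top] at this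
      exact (ENNReal.continuous_rpow_const.tendsto _).comp this
    refine h1.congr' ?_
    obtain ⟨N₀, hN₀⟩ := exists_nat_gt ‖x‖
    filter_upwards [eventually_ge_atTop N₀] with N hN
    rw [indicator_of_mem]
    rw [mem_ball_zero_iff]
    exact hN₀.trans_le (Nat.cast_le.2 hN)

/-- For `p > 2`, test the weighted inequality on `w = (S f)ᵖ⁻²`. The truncation makes `∫ w^q`
finite, so that it can be divided out. -/
theorem exists_lintegral_intrinsicSquare_rpow_le_of_two_lt [Nontrivial (Rn n)] (hα : 0 < α)
    (hα1 : α ≤ 1) {p : ℝ} (hp : 2 < p) :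
    ∃ C : ℝ≥0∞, C ≠ ⊤ ∧ ∀ f : Rn n → ℂ, LocallyIntegrable f volume →
      ∫⁻ x, intrinsicSquare α f x ^ p ≤ C * ∫⁻ x, ‖f x‖ₑ ^ p := by
  have hp2 : 0 < p - 2 := by linarith
  have hp0 : 0 < p := by linarith
  set q := p / (p - 2) with hq
  have hpq : (p / 2).HolderConjugate q := by
    rw [Real.holderConjugate_iff]
    refine ⟨by linarith, ?_⟩
    rw [hq]; field_simp; ring
  have hq1 : 1 < q := hpq.symm.lt
  obtain ⟨C, hC, hS⟩ := exists_lintegral_intrinsicSquare_sq_mul_le (n := n) hα hα1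
  obtain ⟨C', hC', hM⟩ := exists_lintegral_hlMax_rpow_le (n := n) hq1
  refine ⟨(C * C' ^ (1 / q)) ^ (p / 2), ENNReal.rpow_ne_top_of_nonneg (by positivity)
    (ENNReal.mul_ne_top hC (ENNReal.rpow_ne_top_of_nonneg (by positivity) hC')), fun f hf => ?_⟩
  have hSm := measurable_intrinsicSquare hα hα1 hf
  set S := intrinsicSquare α f with hSdef
  set P := ∫⁻ x, ‖f x‖ₑ ^ p with hP
  refine lintegral_rpow_le_of_forall_truncation hp0 hSm fun N => ?_
  set w : Rn n → ℝ≥0∞ := (ball (0 : Rn n) N).indicator fun x => min (S x) N ^ (p - 2) with hw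
  have hwm : Measurable w := ((hSm.min measurable_const).pow_const _).indicator measurableSet_ball
  have hwq : ∀ x, w x ^ q = (ball (0 : Rn n) N).indicator (fun x => min (S x) N ^ p) x := by
    intro x
    by_cases hx : x ∈ ball (0 : Rn n) N
    · rw [hw, indicator_of_mem hx, indicator_of_mem hx, ← ENNReal.rpow_mul, hq,
        mul_div_cancel₀ _ hp2.ne']
    · rw [hw, indicator_of_notMem hx, indicator_of_notMem hx, ENNReal.zero_rpow_of_pos (by positivity)]
  simp_rw [← hwq]
  set X := ∫⁻ x, w x ^ q with hX
  have hXtop : X ≠ ⊤ := by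
    have : X ≤ ∫⁻ x in ball (0 : Rn n) N, (N : ℝ≥0∞) ^ p := by
      rw [← lintegral_indicator measurableSet_ball]
      refine lintegral_mono fun x => ?_
      simp only
      rw [hwq]
      exact indicator_le_indicator (ENNReal.rpow_le_rpow (min_le_right _ _) hp0.le)
    refine ne_top_of_le_ne_top ?_ this
    rw [setLIntegral_const]
    exact ENNReal.mul_ne_top (ENNReal.rpow_ne_top_of_nonneg hp0.le (by simp)) measure_ball_lt_top.ne
  have h1 : X ≤ ∫⁻ x, S x ^ 2 * w x := by
    refine lintegral_mono fun x => ?_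
    simp only
    rw [hwq]
    by_cases hx : x ∈ ball (0 : Rn n) N
    · rw [hw, indicator_of_mem hx, indicator_of_mem hx]
      calc min (S x) N ^ p = min (S x) N ^ (2 : ℕ) * min (S x) N ^ (p - 2) := by
            rw [← ENNReal.rpow_natCast, ← ENNReal.rpow_add_of_nonneg _ _ (by simp) hp2.le]
            congr 1; push_cast; ring
        _ ≤ _ := mul_le_mul_left (pow_le_pow_left' (min_le_left _ _) 2) _
    · rw [indicator_of_notMem hx]; exact zero_le
  have h2 : ∫⁻ x, ‖f x‖ₑ ^ 2 * hlMax w x ≤ P ^ (1 / (p / 2)) * (C' * X) ^ (1 / q) := by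
    refine (ENNReal.lintegral_mul_le_Lp_mul_Lq volume hpq
      (hf.aestronglyMeasurable.enorm.pow_const 2) (measurable_hlMax w).aemeasurable).trans ?_
    refine mul_le_mul' (le_of_eq ?_) (ENNReal.rpow_le_rpow (hM w hwm) (by positivity))
    congr 1
    refine lintegral_congr fun x => ?_
    rw [← ENNReal.rpow_natCast, ← ENNReal.rpow_mul]
    congr 1; push_cast; ring
  have h3 : X ≤ C * C' ^ (1 / q) * P ^ (1 / (p / 2)) * X ^ (1 / q) := by
    refine (h1.trans (hS f hf w hwm)).trans ((mul_le_mul_right h2 C).trans_eq ?_)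
    rw [ENNReal.mul_rpow_of_nonneg _ _ (by positivity)]
    ring
  rcases eq_or_ne X 0 with hX0 | hX0
  · rw [hX0]; exact zero_le
  have hsum : 1 / (p / 2) + 1 / q = 1 := by simpa using hpq.inv_add_inv_eq_one
  have h4 : X ^ (1 / (p / 2)) ≤ C * C' ^ (1 / q) * P ^ (1 / (p / 2)) := by
    have e : X = X ^ (1 / (p / 2)) * X ^ (1 / q) := by
      rw [← ENNReal.rpow_add _ _ hX0 hXtop, hsum, ENNReal.rpow_one]
    have hne : X ^ (1 / q) ≠ 0 := (ENNReal.rpow_pos (pos_iff_ne_zero.2 hX0) hXtop).ne'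
    have hnt : X ^ (1 / q) ≠ ⊤ := ENNReal.rpow_ne_top_of_nonneg (by positivity) hXtop
    rw [← ENNReal.mul_le_mul_iff_left hne hnt, ← e]
    exact h3
  have h5 := ENNReal.rpow_le_rpow h4 (z := p / 2) (by positivity)
  have hp2' : 1 / (p / 2) * (p / 2) = 1 := by field_simp
  rw [← ENNReal.rpow_mul, hp2', ENNReal.rpow_one, ENNReal.mul_rpow_of_nonneg _ _ (by positivity),
    ← ENNReal.rpow_mul, hp2', ENNReal.rpow_one] at h5
  exact h5

/-! ### Averaging at a variable scale -/

/-- The kernel `(x, z) ↦ |B(z, δ z)|⁻¹ 1_{B(z, δ z)}(x)`. It is zero where `δ z ≤ 0`, the ball being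
empty there. -/
noncomputable def ballKernel (δ : Rn n → ℝ) (x z : Rn n) : ℝ :=
  (ball z (δ z)).indicator (fun _ => (volume.real (ball z (δ z)))⁻¹) x

/-- The function obtained from `f` by distributing the mass at each `z` with `δ z > 0` evenly over
the ball `B(z, δ z)`, and discarding the rest. -/
noncomputable def smear (δ : Rn n → ℝ) (f : Rn n → ℂ) (x : Rn n) : ℂ :=
  ∫ z, (ballKernel δ x z : ℂ) * f z

theorem measurable_ballKernel {δ : Rn n → ℝ} (hδ : Measurable δ) :
    Measurable fun p : Rn n × Rn n => ballKernel δ p.1 p.2 := by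
  have hs : MeasurableSet {p : Rn n × Rn n | p.1 ∈ ball p.2 (δ p.2)} :=
    measurableSet_lt (measurable_fst.dist measurable_snd) (hδ.comp measurable_snd)
  have hv : Measurable fun z : Rn n => volume (ball z (δ z)) := by
    have := (measurable_lintegral_ball (n := n) (w := fun _ => 1) measurable_const).comp
      (measurable_id.prodMk hδ)
    simpa [Function.comp_def] using this
  exact (hv.ennreal_toReal.inv.comp measurable_snd).indicator hs

theorem enorm_ballKernel (δ : Rn n → ℝ) (x z : Rn n) :
    ‖(ballKernel δ x z : ℂ)‖ₑ = (ball z (δ z)).indicator (fun _ => (volume (ball z (δ z)))⁻¹) x := by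
  rw [ballKernel]
  by_cases hx : x ∈ ball z (δ z)
  · have h0 : 0 < volume (ball z (δ z)) := measure_ball_pos _ _ (pos_of_mem_ball hx)
    have h1 : volume (ball z (δ z)) ≠ ⊤ := measure_ball_lt_top.ne
    rw [indicator_of_mem hx, indicator_of_mem hx, ← ofReal_norm, Complex.norm_real,
      Real.norm_of_nonneg (by positivity), Measure.real,
      ENNReal.ofReal_inv_of_pos (ENNReal.toReal_pos h0.ne' h1), ENNReal.ofReal_toReal h1]
  · rw [indicator_of_notMem hx, indicator_of_notMem hx]; simp

theorem lintegral_enorm_ballKernel_le (δ : Rn n → ℝ) (z : Rn n) :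
    ∫⁻ x, ‖(ballKernel δ x z : ℂ)‖ₑ ≤ {z | 0 < δ z}.indicator (fun _ => 1) z := by
  simp_rw [enorm_ballKernel]
  rw [lintegral_indicator measurableSet_ball, setLIntegral_const]
  by_cases hz : 0 < δ z
  · rw [indicator_of_mem (by exact hz)]
    exact ENNReal.inv_mul_le_one _
  · rw [ball_eq_empty.2 (not_lt.1 hz)]; simp

theorem lintegral_lintegral_ballKernel_mul_le {δ : Rn n → ℝ} (hδ : Measurable δ) {f : Rn n → ℂ}
    (hf : Measurable f) :
    ∫⁻ x, ∫⁻ z, ‖(ballKernel δ x z : ℂ) * f z‖ₑ ≤ ∫⁻ z in {z | 0 < δ z}, ‖f z‖ₑ := by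
  have hm : Measurable fun p : Rn n × Rn n => ‖(ballKernel δ p.1 p.2 : ℂ) * f p.2‖ₑ :=
    ((Complex.measurable_ofReal.comp (measurable_ballKernel hδ)).mul (hf.comp measurable_snd)).enorm
  rw [lintegral_lintegral_swap hm.aemeasurable,
    ← lintegral_indicator (measurableSet_lt measurable_const hδ)]
  refine lintegral_mono fun z => ?_
  simp_rw [enorm_mul]
  rw [lintegral_mul_const' _ _ enorm_ne_top]
  refine (mul_le_mul_left (lintegral_enorm_ballKernel_le δ z) _).trans_eq ?_
  by_cases hz : 0 < δ z
  · rw [indicator_of_mem (by exact hz), indicator_of_mem (by exact hz), one_mul]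
  · rw [indicator_of_notMem (by exact hz), indicator_of_notMem (by exact hz), zero_mul]

theorem stronglyMeasurable_smear {δ : Rn n → ℝ} (hδ : Measurable δ) {f : Rn n → ℂ} (hf : Measurable f) :
    StronglyMeasurable (smear δ f) := by
  have hm : Measurable fun p : Rn n × Rn n => (ballKernel δ p.1 p.2 : ℂ) * f p.2 :=
    (Complex.measurable_ofReal.comp (measurable_ballKernel hδ)).mul (hf.comp measurable_snd)
  exact hm.stronglyMeasurable.integral_prod_right'

theorem lintegral_enorm_smear_le {δ : Rn n → ℝ} (hδ : Measurable δ) {f : Rn n → ℂ}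
    (hf : Measurable f) : ∫⁻ x, ‖smear δ f x‖ₑ ≤ ∫⁻ z in {z | 0 < δ z}, ‖f z‖ₑ :=
  (lintegral_mono fun _ => enorm_integral_le_lintegral_enorm _).trans
    (lintegral_lintegral_ballKernel_mul_le hδ hf)

theorem integrable_smear {δ : Rn n → ℝ} (hδ : Measurable δ) {f : Rn n → ℂ} (hf : Measurable f)
    (hfi : Integrable f) : Integrable (smear δ f) :=
  ⟨(stronglyMeasurable_smear hδ hf).aestronglyMeasurable, (lintegral_enorm_smear_le hδ hf).trans_lt
    ((setLIntegral_le_lintegral _ _).trans_lt hfi.2)⟩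

/-- Testing `smear δ f` against `ψ` amounts to testing `f` against the averages of `ψ`. -/
theorem integral_mul_smear {δ : Rn n → ℝ} (hδ : Measurable δ) {f : Rn n → ℂ} (hf : Measurable f)
    (hfi : Integrable f) {ψ : Rn n → ℂ} (hψ : Continuous ψ) {B : ℝ} (hB : ∀ x, ‖ψ x‖ ≤ B) :
    ∫ x, ψ x * smear δ f x = ∫ z, (∫ x, ψ x * ballKernel δ x z) * f z := by
  have hm : Measurable fun p : Rn n × Rn n => (ballKernel δ p.1 p.2 : ℂ) * f p.2 :=
    (Complex.measurable_ofReal.comp (measurable_ballKernel hδ)).mul (hf.comp measurable_snd)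
  have hi : Integrable (fun p : Rn n × Rn n => (ballKernel δ p.1 p.2 : ℂ) * f p.2)
      (volume.prod volume) := by
    refine ⟨hm.aestronglyMeasurable, ?_⟩
    rw [hasFiniteIntegral_iff_enorm, lintegral_prod _ hm.enorm.aemeasurable]
    exact (lintegral_lintegral_ballKernel_mul_le hδ hf).trans_lt
      ((setLIntegral_le_lintegral _ _).trans_lt hfi.2)
  have hi2 : Integrable (fun p : Rn n × Rn n => ψ p.1 * ((ballKernel δ p.1 p.2 : ℂ) * f p.2))
      (volume.prod volume) :=
    hi.bdd_mul (c := B) (hψ.comp continuous_fst).aestronglyMeasurable (ae_of_all _ fun p => hB p.1)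
  simp_rw [smear, ← integral_const_mul]
  rw [integral_integral_swap hi2]
  refine integral_congr_ae (ae_of_all _ fun z => ?_)
  simp only
  rw [← integral_mul_const]
  simp_rw [mul_assoc]

/-- An average of `ψ` over `B(z, δ z)` is as close to `ψ z` as the values of `ψ` on that ball. -/
theorem norm_sub_integral_mul_ballKernel_le {δ : Rn n → ℝ} {z : Rn n} (hz : 0 < δ z)
    {ψ : Rn n → ℂ} (hψ : Continuous ψ) {B : ℝ} (hB : ∀ x ∈ ball z (δ z), ‖ψ z - ψ x‖ ≤ B) :
    ‖ψ z - ∫ x, ψ x * ballKernel δ x z‖ ≤ B := by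
  set V := volume.real (ball z (δ z)) with hV
  have hV0 : 0 < V := ENNReal.toReal_pos (measure_ball_pos _ _ hz).ne' measure_ball_lt_top.ne
  have hi : IntegrableOn ψ (ball z (δ z)) :=
    (hψ.continuousOn.integrableOn_compact (isCompact_closedBall z (δ z))).mono_set ball_subset_closedBall
  have e : ∫ x, ψ x * ballKernel δ x z = (∫ x in ball z (δ z), ψ x) * (V : ℂ)⁻¹ := by
    rw [← integral_mul_const, ← integral_indicator measurableSet_ball]
    congr 1
    ext x
    by_cases hx : x ∈ ball z (δ z)
    · simp [ballKernel, hx, hV]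
    · simp [ballKernel, hx]
  have e2 : ψ z - ∫ x, ψ x * ballKernel δ x z = (∫ x in ball z (δ z), (ψ z - ψ x)) * (V : ℂ)⁻¹ := by
    have hVc : (V : ℂ) ≠ 0 := by exact_mod_cast hV0.ne'
    have hc : IntegrableOn (fun _ : Rn n => ψ z) (ball z (δ z)) :=
      integrableOn_const measure_ball_lt_top.ne
    rw [e, integral_sub hc hi, setIntegral_const, sub_mul,
      Complex.real_smul, ← hV]
    field_simp
  rw [e2, norm_mul, norm_inv, Complex.norm_real, Real.norm_of_nonneg hV0.le, ← div_eq_mul_inv,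
    div_le_iff₀ hV0]
  exact norm_setIntegral_le_of_norm_le_const measure_ball_lt_top hB

theorem integrable_integral_mul_ballKernel_mul {δ : Rn n → ℝ} (hδ : Measurable δ)
    {f : Rn n → ℂ} (hfi : Integrable f) {ψ : Rn n → ℂ} (hψ : Continuous ψ) {B : ℝ}
    (hB : ∀ x, ‖ψ x‖ ≤ B) : Integrable fun z => (∫ x, ψ x * ballKernel δ x z) * f z := by
  have hB0 : 0 ≤ B := (norm_nonneg _).trans (hB 0)
  have hswap : Measurable fun p : Rn n × Rn n => (p.2, p.1) := measurable_swap
  have hk := (measurable_ballKernel hδ).comp hswap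
  simp only [Function.comp_def] at hk
  have hm : Measurable fun p : Rn n × Rn n => ψ p.2 * (ballKernel δ p.2 p.1 : ℂ) :=
    (hψ.measurable.comp measurable_snd).mul (Complex.measurable_ofReal.comp hk)
  have hm' : StronglyMeasurable fun z => ∫ x, ψ x * (ballKernel δ x z : ℂ) :=
    hm.stronglyMeasurable.integral_prod_right' (ν := volume)
  have hbd : ∀ z, ‖∫ x, ψ x * (ballKernel δ x z : ℂ)‖ ≤ B := by
    intro z
    suffices h1 : ‖∫ x, ψ x * (ballKernel δ x z : ℂ)‖ₑ ≤ ENNReal.ofReal B by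
      rw [← ofReal_norm] at h1
      exact (ENNReal.ofReal_le_ofReal_iff hB0).1 h1
    refine (enorm_integral_le_lintegral_enorm _).trans ?_
    calc _ ≤ ∫⁻ x, ENNReal.ofReal B * ‖(ballKernel δ x z : ℂ)‖ₑ := by
          refine lintegral_mono fun x => ?_
          rw [enorm_mul]
          refine mul_le_mul_left ?_ _
          rw [← ofReal_norm]
          exact ENNReal.ofReal_le_ofReal (hB x)
      _ ≤ ENNReal.ofReal B * 1 := by
          rw [lintegral_const_mul' _ _ ENNReal.ofReal_ne_top]
          refine mul_le_mul_right ((lintegral_enorm_ballKernel_le δ z).trans ?_) _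
          exact indicator_le_self' (fun _ _ => zero_le) z
      _ = _ := mul_one _
  exact hfi.bdd_mul hm'.aestronglyMeasurable (ae_of_all _ hbd)

/-- Replacing `f` by `smear δ f` where `δ > 0` costs little: after moving the averaging onto the
bump, the Hölder condition gains `(δ z / t) ^ α`, and only `z` within `t + δ z` of `y` contribute. -/
theorem intrinsicA_indicator_sub_smear_le [Nontrivial (Rn n)] (hα : 0 < α) (hα1 : α ≤ 1)
    {δ : Rn n → ℝ} (hδ : Measurable δ) {f : Rn n → ℂ} (hf : Measurable f)
    (hfi : Integrable f) (y : Rn n) {t : ℝ} (ht : 0 < t) :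
    intrinsicA α ({z | 0 < δ z}.indicator f - smear δ f) y t ≤
      ∫⁻ z, {z | 0 < δ z ∧ dist z y < t + δ z}.indicator
        (fun z => ENNReal.ofReal ((t ^ n)⁻¹ * (δ z / t) ^ α) * ‖f z‖ₑ) z := by
  have hEm : MeasurableSet {z | 0 < δ z} := measurableSet_lt measurable_const hδ
  refine iSup₂_le fun φ hφ => ?_
  set ψ : Rn n → ℂ := fun z => (dilate φ t (y - z) : ℂ) with hψdef
  have hψ : Continuous ψ :=
    Complex.continuous_ofReal.comp ((continuous_dilate hφ hα t).comp (continuous_const.sub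
      continuous_id))
  have hψB : ∀ x, ‖ψ x‖ ≤ 2 * (t ^ n)⁻¹ := fun x => by
    rw [hψdef, Complex.norm_real]; exact abs_dilate_le hφ hα hα1 ht _
  have hfE : LocallyIntegrable ({z | 0 < δ z}.indicator f) volume := (hfi.indicator hEm).locallyIntegrable
  have hsm : LocallyIntegrable (smear δ f) volume := (integrable_smear hδ hf hfi).locallyIntegrable
  have hkf := integrable_integral_mul_ballKernel_mul hδ hfi hψ hψB
  have e : ∫ z, ψ z * ({z | 0 < δ z}.indicator f - smear δ f) z =
      ∫ z, (ψ z * {z | 0 < δ z}.indicator f z - (∫ x, ψ x * ballKernel δ x z) * f z) := by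
    rw [integral_sub (integrable_dilate_mul hφ hα ht y hfE) hkf, ← integral_mul_smear hδ hf hfi hψ hψB,
      ← integral_sub (integrable_dilate_mul hφ hα ht y hfE) (integrable_dilate_mul hφ hα ht y hsm)]
    simp only [Pi.sub_apply, mul_sub, hψdef]
  rw [e]
  refine (enorm_integral_le_lintegral_enorm _).trans (lintegral_mono fun z => ?_)
  by_cases hz : 0 < δ z
  swap
  · have h0 : ∀ x, ballKernel δ x z = 0 := fun x => by
      rw [ballKernel, ball_eq_empty.2 (not_lt.1 hz)]; simp
    have hz' : z ∉ {z | 0 < δ z} := hz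
    simp [h0, hz]
  · rw [indicator_of_mem (by exact hz), ← sub_mul, enorm_mul]
    by_cases hzy : dist z y < t + δ z
    · rw [indicator_of_mem (by exact ⟨hz, hzy⟩)]
      refine mul_le_mul_left ?_ _
      rw [← ofReal_norm]
      refine ENNReal.ofReal_le_ofReal (norm_sub_integral_mul_ballKernel_le hz hψ fun x hx => ?_)
      rw [hψdef]
      simp only
      rw [← Complex.ofReal_sub, Complex.norm_real]
      refine (abs_dilate_sub_le hφ ht _ _).trans ?_
      rw [sub_sub_sub_cancel_left]
      rw [mem_ball, dist_eq_norm] at hx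
      gcongr
    · have h0 : ψ z - ∫ x, ψ x * ballKernel δ x z = 0 := by
        refine norm_le_zero_iff.1 (norm_sub_integral_mul_ballKernel_le hz hψ fun x hx => ?_)
        have h1 : t + δ z ≤ ‖y - z‖ := by rw [← dist_eq_norm, dist_comm]; exact not_lt.1 hzy
        have h2 : t ≤ ‖y - x‖ := by
          rw [mem_ball, dist_eq_norm] at hx
          have := norm_add_le (y - x) (x - z)
          rw [sub_add_sub_cancel] at this
          linarith
        rw [hψdef]
        simp only
        rw [dilate_eq_zero hφ hα ht h2, dilate_eq_zero hφ hα ht (by linarith)]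
        simp
      rw [h0]; simp

/-! ### Control of the averaging error -/

theorem lintegral_scaleMeasure_rpow (hα : 0 < α) {d : ℝ} (hd : 0 < d) :
    ∫⁻ t, (Ici d).indicator (fun t => ENNReal.ofReal ((d / t) ^ α)) t ∂scaleMeasure =
      (ENNReal.ofReal α)⁻¹ := by
  rw [lintegral_scaleMeasure _ (Measurable.indicator (by fun_prop) measurableSet_Ici)]
  have h1 := lintegral_Ioi_indicator_rpow_of_le (p := -α) (by linarith) (x := ENNReal.ofReal d)
    (by simpa using hd)
  have h2 : ∀ t ∈ Ioi (0 : ℝ), ENNReal.ofReal t⁻¹ *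
      (Ici d).indicator (fun t => ENNReal.ofReal ((d / t) ^ α)) t = ENNReal.ofReal (d ^ α) *
        {t | ENNReal.ofReal d ≤ ENNReal.ofReal t}.indicator
          (fun t => ENNReal.ofReal (t ^ (-α - 1))) t := by
    intro t ht
    have ht0 : (0 : ℝ) < t := ht
    by_cases hdt : d ≤ t
    · have h3 : t ∈ {t : ℝ | ENNReal.ofReal d ≤ ENNReal.ofReal t} := ENNReal.ofReal_le_ofReal hdt
      rw [indicator_of_mem (by exact hdt), indicator_of_mem h3,
        ← ENNReal.ofReal_mul (by positivity), ← ENNReal.ofReal_mul (by positivity),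
        Real.div_rpow hd.le ht0.le, Real.rpow_sub_one ht0.ne', Real.rpow_neg ht0.le]
      congr 1
      field_simp
    · have h3 : t ∉ {t : ℝ | ENNReal.ofReal d ≤ ENNReal.ofReal t} := fun h =>
        hdt ((ENNReal.ofReal_le_ofReal_iff ht0.le).1 h)
      rw [indicator_of_notMem (by exact hdt), indicator_of_notMem h3, mul_zero, mul_zero]
  rw [setLIntegral_congr_fun measurableSet_Ioi h2, lintegral_const_mul' _ _ ENNReal.ofReal_ne_top,
    h1, neg_neg, ENNReal.ofReal_rpow_of_pos hd, ← mul_div_assoc, ← ENNReal.ofReal_mul (by positivity),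
    ← Real.rpow_add hd, add_neg_cancel, Real.rpow_zero, ENNReal.ofReal_one, one_div]

theorem lintegral_upperMeasure_tail [Nontrivial (Rn n)] (hα : 0 < α) {d : ℝ} (hd : 0 < d)
    (z : Rn n) :
    ∫⁻ q, {q : Rn n × ℝ | d ≤ q.2 ∧ dist z q.1 < 2 * q.2}.indicator
      (fun q => ENNReal.ofReal ((q.2 ^ n)⁻¹ * (d / q.2) ^ α)) q ∂(upperMeasure n) =
      ENNReal.ofReal (2 ^ n) * volume (ball (0 : Rn n) 1) * (ENNReal.ofReal α)⁻¹ := by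
  have hs : MeasurableSet {q : Rn n × ℝ | d ≤ q.2 ∧ dist z q.1 < 2 * q.2} :=
    (measurableSet_le measurable_const measurable_snd).inter
      (measurableSet_lt (measurable_const.dist measurable_fst) (measurable_snd.const_mul 2))
  have hm : Measurable ({q : Rn n × ℝ | d ≤ q.2 ∧ dist z q.1 < 2 * q.2}.indicator
      (fun q => ENNReal.ofReal ((q.2 ^ n)⁻¹ * (d / q.2) ^ α))) :=
    Measurable.indicator (by fun_prop) hs
  rw [upperMeasure, lintegral_prod_symm _ hm.aemeasurable, ← lintegral_scaleMeasure_rpow hα hd,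
    ← lintegral_const_mul' _ _ (ENNReal.mul_ne_top ENNReal.ofReal_ne_top volume_unitBall_ne_top)]
  refine lintegral_congr_ae ?_
  filter_upwards [ae_scaleMeasure_pos] with t ht
  by_cases hdt : d ≤ t
  · have e : ∀ y : Rn n, {q : Rn n × ℝ | d ≤ q.2 ∧ dist z q.1 < 2 * q.2}.indicator
        (fun q => ENNReal.ofReal ((q.2 ^ n)⁻¹ * (d / q.2) ^ α)) (y, t) =
        (ball z (2 * t)).indicator (fun _ => ENNReal.ofReal ((t ^ n)⁻¹ * (d / t) ^ α)) y := by
      intro y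
      by_cases hy : y ∈ ball z (2 * t)
      · rw [indicator_of_mem hy, indicator_of_mem]
        exact ⟨hdt, by rwa [mem_ball'] at hy⟩
      · rw [indicator_of_notMem hy, indicator_of_notMem]
        exact fun h => hy (by rw [mem_ball']; exact h.2)
    simp_rw [e]
    rw [lintegral_indicator measurableSet_ball, setLIntegral_const, indicator_of_mem (by exact hdt),
      volume_ball_eq _ (by positivity), ← mul_assoc, ← ENNReal.ofReal_mul (by positivity),
      mul_right_comm (ENNReal.ofReal (2 ^ n)), ← ENNReal.ofReal_mul (by positivity)]
    congr 2
    rw [mul_pow]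
    field_simp
  · have e : ∀ y : Rn n, {q : Rn n × ℝ | d ≤ q.2 ∧ dist z q.1 < 2 * q.2}.indicator
        (fun q => ENNReal.ofReal ((q.2 ^ n)⁻¹ * (d / q.2) ^ α)) (y, t) = 0 := fun y =>
      indicator_of_notMem (fun h => hdt h.1) _
    simp_rw [e]
    rw [indicator_of_notMem (by exact hdt), lintegral_zero, mul_zero]

/-- The function `∫ t⁻ⁿ (δ z / t) ^ α |f z| dz` of `(y, t)`, over the `z` with `0 < δ z ≤ t` and
`|z - y| < 2 t`. It dominates the effect of replacing `f` by `smear δ f`. -/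
noncomputable def tailMajorant (α : ℝ) (δ : Rn n → ℝ) (f : Rn n → ℂ) (q : Rn n × ℝ) : ℝ≥0∞ :=
  ∫⁻ z in {z | 0 < δ z}, {q : Rn n × ℝ | δ z ≤ q.2 ∧ dist z q.1 < 2 * q.2}.indicator
    (fun q => ENNReal.ofReal ((q.2 ^ n)⁻¹ * (δ z / q.2) ^ α)) q * ‖f z‖ₑ

/-- Integrating first in `(y, t)`, each `z` contributes `∫_{δ z}^∞ (δ z / t) ^ α dt / t = 1 / α`, up to
a dimensional constant. -/
theorem lintegral_tailMajorant [Nontrivial (Rn n)] (hα : 0 < α) {δ : Rn n → ℝ} (hδ : Measurable δ)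
    {f : Rn n → ℂ} (hf : Measurable f) :
    ∫⁻ q, tailMajorant α δ f q ∂(upperMeasure n) =
      ENNReal.ofReal (2 ^ n) * volume (ball (0 : Rn n) 1) * (ENNReal.ofReal α)⁻¹ *
        ∫⁻ z in {z | 0 < δ z}, ‖f z‖ₑ := by
  have hEm : MeasurableSet {z | 0 < δ z} := measurableSet_lt measurable_const hδ
  have hs : MeasurableSet {p : (Rn n × ℝ) × Rn n | δ p.2 ≤ p.1.2 ∧ dist p.2 p.1.1 < 2 * p.1.2} :=
    (measurableSet_le (hδ.comp measurable_snd) (measurable_snd.comp measurable_fst)).inter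
      (measurableSet_lt (measurable_snd.dist (measurable_fst.comp measurable_fst))
        ((measurable_snd.comp measurable_fst).const_mul 2))
  have hm0 : Measurable (fun p : (Rn n × ℝ) × Rn n =>
      ENNReal.ofReal ((p.1.2 ^ n)⁻¹ * (δ p.2 / p.1.2) ^ α)) := by
    have : Measurable fun p : (Rn n × ℝ) × Rn n => δ p.2 := hδ.comp measurable_snd
    fun_prop
  have hm : Measurable fun p : (Rn n × ℝ) × Rn n =>
      {p : (Rn n × ℝ) × Rn n | δ p.2 ≤ p.1.2 ∧ dist p.2 p.1.1 < 2 * p.1.2}.indicator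
      (fun p => ENNReal.ofReal ((p.1.2 ^ n)⁻¹ * (δ p.2 / p.1.2) ^ α)) p * ‖f p.2‖ₑ :=
    (hm0.indicator hs).mul (hf.comp measurable_snd).enorm
  simp only [tailMajorant]
  rw [lintegral_lintegral_swap (f := fun q z =>
      {q : Rn n × ℝ | δ z ≤ q.2 ∧ dist z q.1 < 2 * q.2}.indicator
    (fun q => ENNReal.ofReal ((q.2 ^ n)⁻¹ * (δ z / q.2) ^ α)) q * ‖f z‖ₑ) hm.aemeasurable,
    ← lintegral_const_mul _ hf.enorm]
  refine setLIntegral_congr_fun hEm fun z hz => ?_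
  rw [lintegral_mul_const' _ _ enorm_ne_top, lintegral_upperMeasure_tail hα hz]

/-- The majorant at `(y, t)` is at most a multiple of the mean of `|f|` over `ball y (2 * t)`, hence
of the maximal function at any point of `ball y t`. -/
theorem tailMajorant_le [Nontrivial (Rn n)] (hα : 0 < α) {δ : Rn n → ℝ} (hδ : Measurable δ)
    {f : Rn n → ℂ} {y : Rn n} {t : ℝ} (ht : 0 < t) {a : ℝ≥0∞} {x : Rn n} (hx : x ∈ ball y t)
    (ha : hlMax (fun z => ‖f z‖ₑ) x ≤ a) :
    tailMajorant α δ f (y, t) ≤ ENNReal.ofReal (2 ^ n) * volume (ball (0 : Rn n) 1) * a := by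
  have hx' : x ∈ ball y (2 * t) := ball_subset_ball (by linarith) hx
  calc tailMajorant α δ f (y, t)
      ≤ ∫⁻ z in {z | 0 < δ z}, ENNReal.ofReal (t ^ n)⁻¹ *
          (ball y (2 * t)).indicator (fun z => ‖f z‖ₑ) z := by
        refine setLIntegral_mono' (measurableSet_lt measurable_const hδ) fun z hz => ?_
        by_cases hzq : (y, t) ∈ {q : Rn n × ℝ | δ z ≤ q.2 ∧ dist z q.1 < 2 * q.2}
        · have h1 : δ z ≤ t := hzq.1
          have h0 : 0 < δ z := hz
          rw [indicator_of_mem hzq, indicator_of_mem (by exact hzq.2)]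
          refine mul_le_mul_left (ENNReal.ofReal_le_ofReal ?_) _
          refine mul_le_of_le_one_right (by positivity)
            (Real.rpow_le_one (by positivity) ((div_le_one ht).2 h1) hα.le)
        · rw [indicator_of_notMem hzq, zero_mul]; exact zero_le
    _ ≤ ∫⁻ z, ENNReal.ofReal (t ^ n)⁻¹ *
          (ball y (2 * t)).indicator (fun z => ‖f z‖ₑ) z := setLIntegral_le_lintegral _ _
    _ = ENNReal.ofReal (t ^ n)⁻¹ * ∫⁻ z in ball y (2 * t), ‖f z‖ₑ := by
        rw [lintegral_const_mul' _ _ ENNReal.ofReal_ne_top, lintegral_indicator measurableSet_ball]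
    _ ≤ ENNReal.ofReal (t ^ n)⁻¹ * (a * volume (ball y (2 * t))) :=
        mul_le_mul_right (lintegral_ball_le_of_hlMax_le hx' ha) _
    _ = _ := by
        rw [volume_ball_eq _ (by positivity), mul_pow]
        have : ENNReal.ofReal (2 ^ n * t ^ n) * ENNReal.ofReal (t ^ n)⁻¹ = ENNReal.ofReal (2 ^ n) := by
          rw [← ENNReal.ofReal_mul (by positivity)]
          congr 1; field_simp
        rw [← this]; ring

/-- If the ball `ball y t` meets `F`, then the points `z` that interact with it through a radius
`dist (z, F) / 4` have radius at most `t` and lie in `ball y (2 * t)`. -/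
theorem dist_lt_of_infDist {F : Set (Rn n)} {x y z : Rn n} {t : ℝ} (hx : x ∈ F) (hxy : x ∈ ball y t)
    (hz : dist z y < t + infDist z F / 4) : infDist z F / 4 ≤ t ∧ dist z y < 2 * t := by
  have h1 : infDist z F ≤ dist z x := infDist_le_dist_of_mem hx
  have h2 := dist_triangle z y x
  have ht := pos_of_mem_ball hxy
  rw [mem_ball'] at hxy
  constructor <;> linarith

theorem intrinsicA_le_tailMajorant [Nontrivial (Rn n)] (hα : 0 < α) (hα1 : α ≤ 1)
    {F : Set (Rn n)} {f : Rn n → ℂ} (hf : Measurable f) (hfi : Integrable f)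
    {x y : Rn n} {t : ℝ} (ht : 0 < t) (hx : x ∈ F) (hxy : x ∈ ball y t) :
    intrinsicA α ({z | 0 < infDist z F / 4}.indicator f - smear (fun z => infDist z F / 4) f) y t ≤
      tailMajorant α (fun z => infDist z F / 4) f (y, t) := by
  have hδ : Measurable fun z : Rn n => infDist z F / 4 := measurable_infDist.div_const 4
  refine (intrinsicA_indicator_sub_smear_le hα hα1 hδ hf hfi y ht).trans ?_
  rw [tailMajorant, ← lintegral_indicator (measurableSet_lt measurable_const hδ)]
  refine lintegral_mono fun z => ?_
  by_cases hz : z ∈ {z | 0 < infDist z F / 4 ∧ dist z y < t + infDist z F / 4}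
  · have hg := dist_lt_of_infDist hx hxy hz.2
    have hz1 : z ∈ {z | 0 < infDist z F / 4} := hz.1
    have hz2 : (y, t) ∈ {q : Rn n × ℝ | infDist z F / 4 ≤ q.2 ∧ dist z q.1 < 2 * q.2} := hg
    rw [indicator_of_mem hz, indicator_of_mem hz1, indicator_of_mem hz2]
  · rw [indicator_of_notMem hz]; exact zero_le

/-- If `M f ≤ a` on `F`, then the spread function is at most a multiple of `a` everywhere. With
`D = dist (x, F)`, the points `z` whose ball contains `x` have radius at least `D / 5` and lie in
`ball x (2 * D)`, which contains a point of `F`; the two radii have ratio `10`. -/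
theorem enorm_smear_le [Nontrivial (Rn n)] {F : Set (Rn n)} (hF : F.Nonempty) {f : Rn n → ℂ}
    {a : ℝ≥0∞} (ha : ∀ x ∈ F, hlMax (fun z => ‖f z‖ₑ) x ≤ a) (x : Rn n) :
    ‖smear (fun z => infDist z F / 4) f x‖ₑ ≤ ENNReal.ofReal (10 ^ n) * a := by
  refine (enorm_integral_le_lintegral_enorm _).trans ?_
  set D := infDist x F with hD
  have hD0 : 0 ≤ D := infDist_nonneg
  have key : ∀ z, x ∈ ball z (infDist z F / 4) → 0 < D ∧ D / 5 ≤ infDist z F / 4 ∧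
      z ∈ ball x (2 * D) := by
    intro z hz
    rw [mem_ball] at hz ⊢
    have h1 : infDist z F ≤ infDist x F + dist z x := infDist_le_infDist_add_dist
    have h2 : infDist x F ≤ infDist z F + dist x z := infDist_le_infDist_add_dist
    have h3 : 0 ≤ dist x z := dist_nonneg
    rw [dist_comm z x] at *
    refine ⟨?_, ?_, ?_⟩ <;> linarith
  rcases hD0.eq_or_lt with h0 | hDpos
  · have e : ∀ z, ‖(ballKernel (fun z => infDist z F / 4) x z : ℂ) * f z‖ₑ = 0 := by
      intro z
      rw [enorm_mul, enorm_ballKernel, indicator_of_notMem, zero_mul]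
      intro h
      exact (key z h).1.ne h0
    simp_rw [e]
    simp
  · obtain ⟨x₀, hx₀, hx₀d⟩ := (infDist_lt_iff hF).1 (show infDist x F < 2 * D by linarith)
    have hx₀b : x₀ ∈ ball x (2 * D) := by rwa [mem_ball']
    have hVpos : volume (ball x (D / 5)) ≠ 0 := (measure_ball_pos _ _ (by positivity)).ne'
    calc ∫⁻ z, ‖(ballKernel (fun z => infDist z F / 4) x z : ℂ) * f z‖ₑ
        ≤ ∫⁻ z, (volume (ball x (D / 5)))⁻¹ * (ball x (2 * D)).indicator (fun z => ‖f z‖ₑ) z := by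
          refine lintegral_mono fun z => ?_
          simp only
          rw [enorm_mul, enorm_ballKernel]
          by_cases hz : x ∈ ball z (infDist z F / 4)
          · obtain ⟨-, h1, h2⟩ := key z hz
            rw [indicator_of_mem hz, indicator_of_mem h2]
            refine mul_le_mul_left (ENNReal.inv_le_inv.2 ?_) _
            rw [volume_ball_eq x (r := D / 5) (by positivity), volume_ball_eq z (by linarith)]
            gcongr
          · rw [indicator_of_notMem hz, zero_mul]; exact zero_le
      _ = (volume (ball x (D / 5)))⁻¹ * ∫⁻ z in ball x (2 * D), ‖f z‖ₑ := by
          rw [lintegral_const_mul' _ _ (ENNReal.inv_ne_top.2 hVpos),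
            lintegral_indicator measurableSet_ball]
      _ ≤ (volume (ball x (D / 5)))⁻¹ * (a * volume (ball x (2 * D))) :=
          mul_le_mul_right (lintegral_ball_le_of_hlMax_le hx₀b (ha x₀ hx₀)) _
      _ = _ := by
          have e : volume (ball x (2 * D)) = ENNReal.ofReal (10 ^ n) * volume (ball x (D / 5)) := by
            rw [volume_ball_eq x (r := 2 * D) (by positivity),
              volume_ball_eq x (r := D / 5) (by positivity), ← mul_assoc,
              ← ENNReal.ofReal_mul (by positivity), ← mul_pow]
            congr 3; ring
          rw [e]
          calc _ = (volume (ball x (D / 5)) * (volume (ball x (D / 5)))⁻¹) *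
                (ENNReal.ofReal (10 ^ n) * a) := by ring
            _ = _ := by rw [ENNReal.mul_inv_cancel hVpos measure_ball_lt_top.ne, one_mul]

/-! ### The range `1 < p < 2` and the full `Lᵖ` bound -/

theorem add_sq_le_two_mul_sq_add (a b : ℝ≥0∞) : (a + b) ^ 2 ≤ 2 * a ^ 2 + 2 * b ^ 2 := by
  have h := ENNReal.rpow_add_le_mul_rpow_add_rpow a b (p := 2) one_le_two
  rw [show (2 : ℝ) - 1 = 1 by norm_num, ENNReal.rpow_one, mul_add] at h
  simpa only [ENNReal.rpow_two] using h

/-- The square function of `f` on the set `{M f ≤ a}`. -/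
theorem exists_setLIntegral_intrinsicSquare_sq_le [Nontrivial (Rn n)] (hα : 0 < α) (hα1 : α ≤ 1) :
    ∃ C : ℝ≥0∞, C ≠ ⊤ ∧ ∀ f : Rn n → ℂ, Measurable f → Integrable f → ∀ a : ℝ≥0∞, a ≠ ⊤ →
      ∫⁻ x in {x | hlMax (fun z => ‖f z‖ₑ) x ≤ a}, intrinsicSquare α f x ^ 2 ≤
        C * (a * (∫⁻ x in {x | a < hlMax (fun z => ‖f z‖ₑ) x}, ‖f x‖ₑ) +
          ∫⁻ x in {x | hlMax (fun z => ‖f z‖ₑ) x ≤ a}, ‖f x‖ₑ ^ 2) := by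
  obtain ⟨C, hC, hL2⟩ := exists_lintegral_intrinsicA_sq_le (n := n) hα hα1
  set v := volume (ball (0 : Rn n) 1) with hv
  have hvt : v ≠ ⊤ := volume_unitBall_ne_top
  set c₁ : ℝ≥0∞ := ENNReal.ofReal (2 ^ n) * v with hc₁
  set c₂ : ℝ≥0∞ := ENNReal.ofReal (10 ^ n) with hc₂
  set c₃ : ℝ≥0∞ := c₁ * (ENNReal.ofReal α)⁻¹ with hc₃
  have hα' : ENNReal.ofReal α ≠ 0 := by simpa using hα
  have hc₁t : c₁ ≠ ⊤ := ENNReal.mul_ne_top ENNReal.ofReal_ne_top hvt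
  have hc₃t : c₃ ≠ ⊤ := ENNReal.mul_ne_top hc₁t (ENNReal.inv_ne_top.2 hα')
  refine ⟨v * (4 * C * (c₂ + 1) + 2 * c₁ * c₃), by finiteness, fun f hf hfi a hat => ?_⟩
  set M := hlMax fun z => ‖f z‖ₑ with hM
  set F := {x | M x ≤ a} with hFdef
  have hFc : Fᶜ = {x | a < M x} := by ext x; simp [hFdef]
  have hFclosed : IsClosed F := by
    rw [← isOpen_compl_iff, hFc]; exact isOpen_lt_hlMax _ _
  rw [← hFc]
  rcases F.eq_empty_or_nonempty with hFe | hFne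
  · rw [hFe]; simp
  set δ : Rn n → ℝ := fun z => infDist z F / 4 with hδdef
  have hδ : Measurable δ := measurable_infDist.div_const 4
  have hpos : {z | 0 < δ z} = Fᶜ := by
    ext z
    rw [mem_compl_iff, hFclosed.notMem_iff_infDist_pos hFne, mem_ofPred_eq, hδdef]
    simp only
    constructor <;> intro h <;> linarith
  -- `f = u + b`, where `u` is `f` on `F` plus the spread of `f` from outside `F`
  set b := {z | 0 < δ z}.indicator f - smear δ f with hb
  set u := F.indicator f + smear δ f with hu
  have hFm : MeasurableSet F := hFclosed.measurableSet
  have hsi : Integrable (smear δ f) := integrable_smear hδ hf hfi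
  have hui : Integrable u := (hfi.indicator hFm).add hsi
  have hbi : Integrable b := (hfi.indicator (measurableSet_lt measurable_const hδ)).sub hsi
  have hfub : f = u + b := by
    rw [hu, hb, hpos]
    rw [add_sub_assoc', add_right_comm, add_sub_cancel_right, indicator_self_add_compl]
  -- one factor of `‖smear δ f‖²` is estimated pointwise, the other in `L¹`
  have hu2 : ∫⁻ x, ‖u x‖ₑ ^ 2 ≤ 2 * (∫⁻ x in F, ‖f x‖ₑ ^ 2) + 2 * (c₂ * a * ∫⁻ x in Fᶜ, ‖f x‖ₑ) := by
    calc ∫⁻ x, ‖u x‖ₑ ^ 2 ≤ ∫⁻ x, (2 * F.indicator (fun x => ‖f x‖ₑ ^ 2) x +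
          2 * (c₂ * a * ‖smear δ f x‖ₑ)) := by
          refine lintegral_mono fun x => ?_
          simp only
          refine (pow_le_pow_left' (enorm_add_le _ _) 2).trans
            ((add_sq_le_two_mul_sq_add _ _).trans (add_le_add (mul_le_mul_right ?_ _)
              (mul_le_mul_right ?_ _)))
          · by_cases hx : x ∈ F
            · rw [indicator_of_mem hx, indicator_of_mem hx]
            · rw [indicator_of_notMem hx, indicator_of_notMem hx]; simp
          · rw [sq]
            exact mul_le_mul_left (enorm_smear_le hFne (fun x hx => hx) x) _
      _ = 2 * (∫⁻ x in F, ‖f x‖ₑ ^ 2) + 2 * (c₂ * a * ∫⁻ x, ‖smear δ f x‖ₑ) := by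
          have hm := (stronglyMeasurable_smear hδ hf).measurable.enorm
          rw [lintegral_add_right _ ((hm.const_mul _).const_mul _),
            lintegral_const_mul _ (hm.const_mul _), lintegral_const_mul _ hm,
            lintegral_const_mul _ ((hf.enorm.pow_const 2).indicator hFm), lintegral_indicator hFm]
      _ ≤ _ := by
          rw [← hpos]
          exact add_le_add le_rfl (mul_le_mul_right (mul_le_mul_right
            (lintegral_enorm_smear_le hδ hf) _) _)
  have hSm := measurable_intrinsicSquare hα hα1 hfi.locallyIntegrable
  have hA := aemeasurable_intrinsicA hα hα1 hui.locallyIntegrable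
  have e1 : ∫⁻ x in F, intrinsicSquare α f x ^ 2 =
      ∫⁻ x, intrinsicSquare α f x ^ 2 * F.indicator (fun _ => 1) x := by
    rw [← lintegral_indicator hFm]
    refine lintegral_congr fun x => ?_
    by_cases hx : x ∈ F <;> simp [hx]
  rw [e1, lintegral_intrinsicSquare_sq_mul hα hα1 hfi.locallyIntegrable
    (measurable_const.indicator hFm), mul_assoc]
  refine mul_le_mul_right ?_ _
  calc _ ≤ ∫⁻ q, (2 * intrinsicA α u q.1 q.2 ^ 2 + 2 * (c₁ * a * tailMajorant α δ f q))
        ∂(upperMeasure n) := by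
        refine lintegral_mono_ae ?_
        filter_upwards [ae_upperMeasure_pos] with q hq
        by_cases hqF : ∃ x ∈ F, x ∈ ball q.1 q.2
        · obtain ⟨x, hxF, hxq⟩ := hqF
          have hW : (∫⁻ z in ball q.1 q.2, F.indicator (fun _ => 1) z) / volume (ball q.1 q.2) ≤ 1 := by
            refine ENNReal.div_le_of_le_mul ?_
            rw [one_mul]
            calc _ ≤ ∫⁻ z in ball q.1 q.2, 1 :=
                  lintegral_mono fun z => indicator_le_self' (fun _ _ => zero_le) z
              _ = _ := setLIntegral_one _
          have hAb : intrinsicA α b q.1 q.2 ≤ tailMajorant α δ f q :=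
            intrinsicA_le_tailMajorant hα hα1 hf hfi hq hxF hxq
          have hH : tailMajorant α δ f q ≤ c₁ * a := tailMajorant_le hα hδ hq hxq hxF
          calc _ ≤ intrinsicA α f q.1 q.2 ^ 2 * 1 := mul_le_mul_right hW _
            _ ≤ (intrinsicA α u q.1 q.2 + intrinsicA α b q.1 q.2) ^ 2 := by
                rw [mul_one]
                refine pow_le_pow_left' ?_ 2
                conv_lhs => rw [hfub]
                exact intrinsicA_add_le hα hui.locallyIntegrable hbi.locallyIntegrable _ hq
            _ ≤ 2 * intrinsicA α u q.1 q.2 ^ 2 + 2 * intrinsicA α b q.1 q.2 ^ 2 :=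
                add_sq_le_two_mul_sq_add _ _
            _ ≤ _ := by
                gcongr
                -- again one factor is estimated pointwise, and the other will be integrated
                rw [sq]
                exact mul_le_mul' (hAb.trans hH) hAb
        · have hz : ∫⁻ z in ball q.1 q.2, F.indicator (fun _ => (1 : ℝ≥0∞)) z = 0 := by
            rw [setLIntegral_congr_fun (g := fun _ => 0) measurableSet_ball, lintegral_zero]
            intro z hz
            exact indicator_of_notMem (fun h => hqF ⟨z, h, hz⟩) _
          rw [hz, ENNReal.zero_div, mul_zero]
          exact zero_le
    _ = 2 * (∫⁻ q, intrinsicA α u q.1 q.2 ^ 2 ∂(upperMeasure n)) +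
        2 * (c₁ * a * ∫⁻ q, tailMajorant α δ f q ∂(upperMeasure n)) := by
        rw [lintegral_add_left' ((hA.pow_const 2).const_mul 2), lintegral_const_mul'' _ (hA.pow_const 2),
          lintegral_const_mul' _ _ (by finiteness), lintegral_const_mul' _ _ (by finiteness)]
    _ ≤ 2 * (C * (2 * (∫⁻ x in F, ‖f x‖ₑ ^ 2) + 2 * (c₂ * a * ∫⁻ x in Fᶜ, ‖f x‖ₑ))) +
        2 * (c₁ * a * (c₃ * ∫⁻ x in Fᶜ, ‖f x‖ₑ)) := by
        rw [lintegral_tailMajorant hα hδ hf, hpos]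
        gcongr
        exact (hL2 u hui.1).trans (mul_le_mul_right hu2 C)
    _ = (4 * C * c₂ + 2 * c₁ * c₃) * (a * ∫⁻ x in Fᶜ, ‖f x‖ₑ) + 4 * C * ∫⁻ x in F, ‖f x‖ₑ ^ 2 := by
        ring
    _ ≤ (4 * C * (c₂ + 1) + 2 * c₁ * c₃) * (a * ∫⁻ x in Fᶜ, ‖f x‖ₑ) +
        (4 * C * (c₂ + 1) + 2 * c₁ * c₃) * ∫⁻ x in F, ‖f x‖ₑ ^ 2 := by
        gcongr
        · exact le_self_add
        · calc 4 * C = 4 * C * 1 := (mul_one _).symm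
            _ ≤ 4 * C * (c₂ + 1) := by gcongr; exact le_add_self
            _ ≤ _ := le_self_add
    _ = _ := (mul_add _ _ _).symm

/-- For `1 < p < 2`, integrate over `a = t` the distributional estimate obtained from Chebyshev's
inequality on `{M f ≤ t}`; both resulting integrals are bounded by `∫ (M f)ᵖ`. -/
theorem exists_lintegral_intrinsicSquare_rpow_le_of_lt_two [Nontrivial (Rn n)] (hα : 0 < α)
    (hα1 : α ≤ 1) {p : ℝ} (hp : 1 < p) (hp2 : p < 2) :
    ∃ C : ℝ≥0∞, C ≠ ⊤ ∧ ∀ f : Rn n → ℂ, Measurable f → Integrable f →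
      ∫⁻ x, intrinsicSquare α f x ^ p ≤ C * ∫⁻ x, ‖f x‖ₑ ^ p := by
  have hp0 : 0 < p := by linarith
  have hp1 : 0 < p - 1 := by linarith
  have h2p : 0 < 2 - p := by linarith
  obtain ⟨C, hC, hgood⟩ := exists_setLIntegral_intrinsicSquare_sq_le (n := n) hα hα1
  obtain ⟨C', hC', hmax⟩ := exists_lintegral_hlMax_rpow_le (n := n) hp
  set P := ENNReal.ofReal p with hP
  set c₁ := (ENNReal.ofReal (p - 1))⁻¹ with hc₁
  set c₂ := (ENNReal.ofReal (2 - p))⁻¹ with hc₂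
  have hc₁t : c₁ ≠ ⊤ := ENNReal.inv_ne_top.2 (by simpa using hp)
  have hc₂t : c₂ ≠ ⊤ := ENNReal.inv_ne_top.2 (by simpa using hp2)
  have hPt : P ≠ ⊤ := ENNReal.ofReal_ne_top
  refine ⟨(1 + P * C * (c₁ + c₂)) * C', by finiteness, fun f hf hfi => ?_⟩
  rw [mul_assoc]
  refine le_trans ?_ (mul_le_mul_right (hmax _ hf.enorm) _)
  set M := hlMax fun z => ‖f z‖ₑ with hM
  have hMm : Measurable M := measurable_hlMax _
  have hSm := measurable_intrinsicSquare hα hα1 hfi.locallyIntegrable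
  set S := intrinsicSquare α f with hS
  have hle := ae_enorm_le_hlMax hfi
  -- the distribution function of `S`, multiplied by `tᵖ⁻¹`
  have hdist : ∀ t ∈ Ioi (0 : ℝ), volume {x | ENNReal.ofReal t < S x} * ENNReal.ofReal (t ^ (p - 1)) ≤
      volume {x | ENNReal.ofReal t < M x} * ENNReal.ofReal (t ^ (p - 1)) +
        C * ((∫⁻ x, {t | ENNReal.ofReal t < M x}.indicator
          (fun t => ENNReal.ofReal (t ^ (p - 1 - 1))) t * ‖f x‖ₑ) +
        ∫⁻ x, {t | M x ≤ ENNReal.ofReal t}.indicator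
          (fun t => ENNReal.ofReal (t ^ (p - 2 - 1))) t * ‖f x‖ₑ ^ 2) := by
    intro t ht
    have ht0 : (0 : ℝ) < t := ht
    set a := ENNReal.ofReal t with ha
    have ha0 : a ≠ 0 := by simpa [ha] using ht0
    have hat : a ≠ ⊤ := ENNReal.ofReal_ne_top
    have hFm : MeasurableSet {x | M x ≤ a} := measurableSet_le hMm measurable_const
    have hOm : MeasurableSet {x | a < M x} := measurableSet_lt measurable_const hMm
    have h1 : volume {x | a < S x} ≤ volume {x | a < M x} +
        (a ^ 2)⁻¹ * ∫⁻ x in {x | M x ≤ a}, S x ^ 2 := by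
      have hsub : {x | a < S x} ⊆ {x | a < M x} ∪ ({x | a ^ 2 ≤ S x ^ 2} ∩ {x | M x ≤ a}) := by
        intro x hx
        rcases lt_or_ge a (M x) with h | h
        · exact Or.inl h
        · exact Or.inr ⟨pow_le_pow_left' (le_of_lt (show a < S x from hx)) 2, h⟩
      refine (measure_mono hsub).trans ((measure_union_le _ _).trans (add_le_add_right ?_ _))
      rw [← Measure.restrict_apply₀' hFm.nullMeasurableSet, ← ENNReal.div_eq_inv_mul]
      exact meas_ge_le_lintegral_div (hSm.pow_const 2).aemeasurable (pow_ne_zero 2 ha0)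
        (ENNReal.pow_ne_top hat)
    have h2 := hgood f hf hfi a hat
    have e2 : ENNReal.ofReal (t ^ (p - 1)) = a ^ 2 * ENNReal.ofReal (t ^ (p - 2 - 1)) := by
      rw [ha, ← ENNReal.ofReal_pow ht0.le, ← ENNReal.ofReal_mul (by positivity), ← Real.rpow_natCast,
        ← Real.rpow_add ht0]
      congr 2; push_cast; ring
    have e3 : ∫⁻ x, {t | ENNReal.ofReal t < M x}.indicator
          (fun t => ENNReal.ofReal (t ^ (p - 1 - 1))) t * ‖f x‖ₑ =
          ENNReal.ofReal (t ^ (p - 1 - 1)) * ∫⁻ x in {x | a < M x}, ‖f x‖ₑ := by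
      rw [← lintegral_const_mul' _ _ ENNReal.ofReal_ne_top, ← lintegral_indicator hOm]
      refine lintegral_congr fun x => ?_
      by_cases h : a < M x
      · rw [indicator_of_mem (by exact h), indicator_of_mem (by exact h)]
      · rw [indicator_of_notMem (by exact h), indicator_of_notMem (by exact h), zero_mul]
    have e4 : ∫⁻ x, {t | M x ≤ ENNReal.ofReal t}.indicator
          (fun t => ENNReal.ofReal (t ^ (p - 2 - 1))) t * ‖f x‖ₑ ^ 2 =
          ENNReal.ofReal (t ^ (p - 2 - 1)) * ∫⁻ x in {x | M x ≤ a}, ‖f x‖ₑ ^ 2 := by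
      rw [← lintegral_const_mul' _ _ ENNReal.ofReal_ne_top, ← lintegral_indicator hFm]
      refine lintegral_congr fun x => ?_
      by_cases h : M x ≤ a
      · rw [indicator_of_mem (by exact h), indicator_of_mem (by exact h)]
      · rw [indicator_of_notMem (by exact h), indicator_of_notMem (by exact h), zero_mul]
    rw [e3, e4]
    refine (mul_le_mul_left h1 _).trans ?_
    rw [add_mul]
    refine add_le_add_right ?_ _
    have hcancel : (a ^ 2)⁻¹ * ENNReal.ofReal (t ^ (p - 1)) = ENNReal.ofReal (t ^ (p - 2 - 1)) := by
      rw [e2, ← mul_assoc, ENNReal.inv_mul_cancel (pow_ne_zero 2 ha0) (ENNReal.pow_ne_top hat), one_mul]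
    have e5 : ENNReal.ofReal (t ^ (p - 1 - 1)) = a * ENNReal.ofReal (t ^ (p - 2 - 1)) := by
      rw [ha, ← ENNReal.ofReal_mul ht0.le, Real.rpow_sub_one ht0.ne' (p - 2),
        mul_div_cancel₀ _ ht0.ne']
      congr 2; ring
    calc _ = (a ^ 2)⁻¹ * ENNReal.ofReal (t ^ (p - 1)) * ∫⁻ x in {x | M x ≤ a}, S x ^ 2 := by ring
      _ ≤ ENNReal.ofReal (t ^ (p - 2 - 1)) * (C * (a * (∫⁻ x in {x | a < M x}, ‖f x‖ₑ) +
          ∫⁻ x in {x | M x ≤ a}, ‖f x‖ₑ ^ 2)) := by rw [hcancel]; exact mul_le_mul_right h2 _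
      _ = _ := by rw [e5]; ring
  have hm1 : Measurable fun z : ℝ × Rn n => {z : ℝ × Rn n | ENNReal.ofReal z.1 < M z.2}.indicator
      (fun z => ENNReal.ofReal (z.1 ^ (p - 1 - 1))) z * ‖f z.2‖ₑ :=
    (Measurable.indicator (by fun_prop) (measurableSet_lt
      (ENNReal.measurable_ofReal.comp measurable_fst) (hMm.comp measurable_snd))).mul
        (hf.comp measurable_snd).enorm
  have hm2 : Measurable fun z : ℝ × Rn n => {z : ℝ × Rn n | M z.2 ≤ ENNReal.ofReal z.1}.indicator
      (fun z => ENNReal.ofReal (z.1 ^ (p - 2 - 1))) z * ‖f z.2‖ₑ ^ 2 :=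
    (Measurable.indicator (by fun_prop) (measurableSet_le (hMm.comp measurable_snd)
      (ENNReal.measurable_ofReal.comp measurable_fst))).mul
        ((hf.comp measurable_snd).enorm.pow_const 2)
  have hI1 : ∫⁻ t in Ioi (0 : ℝ), ∫⁻ x, {t | ENNReal.ofReal t < M x}.indicator
      (fun t => ENNReal.ofReal (t ^ (p - 1 - 1))) t * ‖f x‖ₑ ≤ c₁ * ∫⁻ x, M x ^ p := by
    rw [lintegral_lintegral_swap (f := fun t x => {t | ENNReal.ofReal t < M x}.indicator
      (fun t => ENNReal.ofReal (t ^ (p - 1 - 1))) t * ‖f x‖ₑ) hm1.aemeasurable,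
      ← lintegral_const_mul _ (hMm.pow_const p)]
    refine lintegral_mono_ae ?_
    filter_upwards [hle] with x hx
    rw [lintegral_mul_const' _ _ enorm_ne_top, lintegral_Ioi_indicator_rpow hp1,
      ENNReal.div_eq_inv_mul, mul_assoc]
    refine mul_le_mul_right ((mul_le_mul_right hx _).trans_eq ?_) _
    have e : p = (p - 1) + 1 := by ring
    conv_rhs => rw [e]
    rw [ENNReal.rpow_add_of_nonneg _ _ hp1.le zero_le_one, ENNReal.rpow_one]
  have hI2 : ∫⁻ t in Ioi (0 : ℝ), ∫⁻ x, {t | M x ≤ ENNReal.ofReal t}.indicator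
      (fun t => ENNReal.ofReal (t ^ (p - 2 - 1))) t * ‖f x‖ₑ ^ 2 ≤ c₂ * ∫⁻ x, M x ^ p := by
    rw [lintegral_lintegral_swap (f := fun t x => {t | M x ≤ ENNReal.ofReal t}.indicator
      (fun t => ENNReal.ofReal (t ^ (p - 2 - 1))) t * ‖f x‖ₑ ^ 2) hm2.aemeasurable,
      ← lintegral_const_mul _ (hMm.pow_const p)]
    refine lintegral_mono_ae ?_
    filter_upwards [hle] with x hx
    rw [lintegral_mul_const' _ _ (ENNReal.pow_ne_top enorm_ne_top)]
    rcases eq_or_ne (M x) 0 with h0 | h0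
    · have : ‖f x‖ₑ = 0 := le_antisymm (hx.trans h0.le) zero_le
      rw [this]; simp
    rw [lintegral_Ioi_indicator_rpow_of_le (by linarith) h0, neg_sub, ENNReal.div_eq_inv_mul, mul_assoc]
    refine mul_le_mul_right ?_ _
    rcases eq_or_ne (M x) ⊤ with hT | hT
    · rw [hT, ENNReal.top_rpow_of_neg (by linarith), zero_mul]; exact zero_le
    refine (mul_le_mul_right (pow_le_pow_left' hx 2) _).trans_eq ?_
    rw [← ENNReal.rpow_natCast, ← ENNReal.rpow_add _ _ h0 hT]
    congr 1; push_cast; ring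
  rw [lintegral_rpow_eq_mul_lintegral_Ioi volume hp0 hSm]
  have hmeasM : Measurable fun t : ℝ => volume {x | ENNReal.ofReal t < M x} * ENNReal.ofReal (t ^ (p - 1)) := by
    refine Measurable.mul (Antitone.measurable ?_) (by fun_prop)
    intro s t hst
    exact measure_mono fun x hx => (ENNReal.ofReal_le_ofReal hst).trans_lt hx
  have hm1' : Measurable fun t : ℝ => ∫⁻ x, {t | ENNReal.ofReal t < M x}.indicator
      (fun t => ENNReal.ofReal (t ^ (p - 1 - 1))) t * ‖f x‖ₑ := hm1.lintegral_prod_right'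
  calc _ ≤ P * ∫⁻ t in Ioi (0 : ℝ), (volume {x | ENNReal.ofReal t < M x} * ENNReal.ofReal (t ^ (p - 1)) +
        C * ((∫⁻ x, {t | ENNReal.ofReal t < M x}.indicator
          (fun t => ENNReal.ofReal (t ^ (p - 1 - 1))) t * ‖f x‖ₑ) +
        ∫⁻ x, {t | M x ≤ ENNReal.ofReal t}.indicator
          (fun t => ENNReal.ofReal (t ^ (p - 2 - 1))) t * ‖f x‖ₑ ^ 2)) :=
        mul_le_mul_right (setLIntegral_mono' measurableSet_Ioi hdist) _
    _ = P * (∫⁻ t in Ioi (0 : ℝ), volume {x | ENNReal.ofReal t < M x} * ENNReal.ofReal (t ^ (p - 1))) +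
        P * C * ((∫⁻ t in Ioi (0 : ℝ), ∫⁻ x, {t | ENNReal.ofReal t < M x}.indicator
          (fun t => ENNReal.ofReal (t ^ (p - 1 - 1))) t * ‖f x‖ₑ) +
        ∫⁻ t in Ioi (0 : ℝ), ∫⁻ x, {t | M x ≤ ENNReal.ofReal t}.indicator
          (fun t => ENNReal.ofReal (t ^ (p - 2 - 1))) t * ‖f x‖ₑ ^ 2) := by
        rw [lintegral_add_left hmeasM, lintegral_const_mul' _ _ hC,
          lintegral_add_left hm1', mul_add, mul_assoc]
    _ ≤ (∫⁻ x, M x ^ p) + P * C * (c₁ * (∫⁻ x, M x ^ p) + c₂ * ∫⁻ x, M x ^ p) := by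
        rw [← lintegral_rpow_eq_mul_lintegral_Ioi volume hp0 hMm]
        gcongr
    _ = _ := by ring

/-- The case `p = 2` is the weighted inequality with `w = 1`. -/
theorem exists_lintegral_intrinsicSquare_sq_le [Nontrivial (Rn n)] (hα : 0 < α)
    (hα1 : α ≤ 1) :
    ∃ C : ℝ≥0∞, C ≠ ⊤ ∧ ∀ f : Rn n → ℂ, LocallyIntegrable f volume →
      ∫⁻ x, intrinsicSquare α f x ^ 2 ≤ C * ∫⁻ x, ‖f x‖ₑ ^ 2 := by
  obtain ⟨C, hC, hS⟩ := exists_lintegral_intrinsicSquare_sq_mul_le (n := n) hα hα1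
  refine ⟨C, hC, fun f hf => ?_⟩
  have h := hS f hf (fun _ => 1) measurable_const
  have h1 : ∀ x : Rn n, hlMax (fun _ => 1) x ≤ 1 := fun x =>
    iSup₂_le fun c r => iSup_le fun hx => by
      rw [setLIntegral_one]; exact ENNReal.div_self_le_one
  calc _ = ∫⁻ x, intrinsicSquare α f x ^ 2 * 1 := by simp
    _ ≤ C * ∫⁻ x, ‖f x‖ₑ ^ 2 * hlMax (fun _ => 1) x := h
    _ ≤ _ := by
      gcongr with x
      exact mul_le_of_le_one_right' (h1 x)

theorem intrinsicSquare_congr_ae {f g : Rn n → ℂ} (h : f =ᵐ[volume] g) :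
    intrinsicSquare α f = intrinsicSquare α g := by
  ext x
  simp only [intrinsicSquare, intrinsicA_congr_ae h]

/-- The intrinsic square function is bounded on `Lᵖ` for `1 < p < ∞`. -/
theorem exists_lintegral_intrinsicSquare_rpow_le [Nontrivial (Rn n)] (hα : 0 < α)
    (hα1 : α ≤ 1) {p : ℝ} (hp : 1 < p) :
    ∃ C : ℝ≥0∞, C ≠ ⊤ ∧ ∀ f : Rn n → ℂ, Integrable f →
      ∫⁻ x, intrinsicSquare α f x ^ p ≤ C * ∫⁻ x, ‖f x‖ₑ ^ p := by
  rcases lt_trichotomy p 2 with h | rfl | h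
  · obtain ⟨C, hC, hS⟩ := exists_lintegral_intrinsicSquare_rpow_le_of_lt_two (n := n) hα hα1 hp h
    refine ⟨C, hC, fun f hf => ?_⟩
    have hae := hf.1.ae_eq_mk
    rw [intrinsicSquare_congr_ae hae]
    refine (hS _ hf.1.stronglyMeasurable_mk.measurable (hf.congr hae)).trans_eq ?_
    congr 1
    refine lintegral_congr_ae ?_
    filter_upwards [hae] with x hx
    rw [← hx]
  · obtain ⟨C, hC, hS⟩ := exists_lintegral_intrinsicSquare_sq_le (n := n) hα hα1
    exact ⟨C, hC, fun f hfi => by simpa using hS f hfi.locallyIntegrable⟩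
  · obtain ⟨C, hC, hS⟩ := exists_lintegral_intrinsicSquare_rpow_le_of_two_lt (n := n) hα hα1 h
    exact ⟨C, hC, fun f hfi => hS f hfi.locallyIntegrable⟩

/-! ### Morrey spaces -/

theorem intrinsicSquare_add_le [Nontrivial (Rn n)] (hα : 0 < α) (hα1 : α ≤ 1) {f g : Rn n → ℂ}
    (hf : LocallyIntegrable f volume) (hg : LocallyIntegrable g volume) (x : Rn n) :
    intrinsicSquare α (f + g) x ≤ 2 * max (intrinsicSquare α f x) (intrinsicSquare α g x) := by
  have hm : Measurable fun q : Rn n × ℝ =>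
      (cone x).indicator (fun q => intrinsicA α f q.1 q.2 ^ 2 / ENNReal.ofReal (q.2 ^ n)) q := by
    have h0 := (measurable_coneIntegrand hα hα1 hf).comp
      (measurable_prodMk_left (β := Rn n × ℝ) (x := x))
    simpa only [Function.comp_def] using h0
  have h : intrinsicSquare α (f + g) x ^ 2 ≤
      2 * intrinsicSquare α f x ^ 2 + 2 * intrinsicSquare α g x ^ 2 := by
    simp only [intrinsicSquare_sq]
    rw [← lintegral_const_mul' _ _ (by finiteness), ← lintegral_const_mul' _ _ (by finiteness),
      ← lintegral_add_left (hm.const_mul 2)]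
    refine lintegral_mono fun q => ?_
    by_cases hq : q ∈ cone x
    · rw [indicator_of_mem hq, indicator_of_mem hq, indicator_of_mem hq, ← mul_div_assoc,
        ← mul_div_assoc, ← ENNReal.add_div]
      refine ENNReal.div_le_div_right ?_ _
      exact (pow_le_pow_left' (intrinsicA_add_le hα hf hg _ hq.1) 2).trans
        (add_sq_le_two_mul_sq_add _ _)
    · rw [indicator_of_notMem hq]; exact zero_le
  refine (ENNReal.pow_le_pow_left_iff two_ne_zero).1 (h.trans ?_)
  rw [mul_pow]
  calc _ ≤ 2 * max (intrinsicSquare α f x) (intrinsicSquare α g x) ^ 2 +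
        2 * max (intrinsicSquare α f x) (intrinsicSquare α g x) ^ 2 := by
        gcongr
        · exact le_max_left _ _
        · exact le_max_right _ _
    _ = _ := by ring

theorem IsGrowthFunction.two_pow_mul_le {Φ : ℝ → ℝ} {D : ℝ} (hΦ : IsGrowthFunction Φ D)
    (hD : 0 ≤ D) {r : ℝ} (hr : 0 < r) (k : ℕ) : Φ (2 ^ k * r) ≤ D ^ k * Φ r := by
  induction k with
  | zero => simp
  | succ k ih =>
    calc Φ (2 ^ (k + 1) * r) = Φ (2 * (2 ^ k * r)) := by congr 1; ring
      _ ≤ D * Φ (2 ^ k * r) := hΦ.doubling _ (by positivity)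
      _ ≤ D * (D ^ k * Φ r) := mul_le_mul_of_nonneg_left ih hD
      _ = _ := by ring

/-- One dyadic slice of the cone over `x` has measure at most `|B(0, 1)|` for `t⁻ⁿ dy dt / t`. -/
theorem lintegral_upperMeasure_slice_le [Nontrivial (Rn n)] (x : Rn n) {a : ℝ} (ha : 0 < a) :
    ∫⁻ q, {q : Rn n × ℝ | q.1 ∈ ball x q.2 ∧ q.2 ∈ Ico a (2 * a)}.indicator
      (fun q => (ENNReal.ofReal (q.2 ^ n))⁻¹) q ∂(upperMeasure n) ≤ volume (ball (0 : Rn n) 1) := by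
  have hs : MeasurableSet {q : Rn n × ℝ | q.1 ∈ ball x q.2 ∧ q.2 ∈ Ico a (2 * a)} :=
    (measurableSet_lt (measurable_fst.dist measurable_const) measurable_snd).inter
      (measurableSet_Ico.preimage measurable_snd)
  have hm : Measurable ({q : Rn n × ℝ | q.1 ∈ ball x q.2 ∧ q.2 ∈ Ico a (2 * a)}.indicator
      (fun q => (ENNReal.ofReal (q.2 ^ n))⁻¹)) := Measurable.indicator (by fun_prop) hs
  rw [upperMeasure, lintegral_prod_symm _ hm.aemeasurable]
  calc _ ≤ ∫⁻ t, (Ico a (2 * a)).indicator (fun _ => volume (ball (0 : Rn n) 1)) t ∂scaleMeasure := by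
        refine lintegral_mono fun t => ?_
        by_cases ht : t ∈ Ico a (2 * a)
        · have ht0 : 0 < t := ha.trans_le ht.1
          have e : ∀ y : Rn n, {q : Rn n × ℝ | q.1 ∈ ball x q.2 ∧ q.2 ∈ Ico a (2 * a)}.indicator
              (fun q => (ENNReal.ofReal (q.2 ^ n))⁻¹) (y, t) =
              (ball x t).indicator (fun _ => (ENNReal.ofReal (t ^ n))⁻¹) y := by
            intro y
            by_cases hy : y ∈ ball x t
            · rw [indicator_of_mem hy, indicator_of_mem]
              exact ⟨hy, ht⟩
            · rw [indicator_of_notMem hy, indicator_of_notMem]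
              exact fun h => hy h.1
          simp_rw [e]
          rw [lintegral_indicator measurableSet_ball, setLIntegral_const, indicator_of_mem ht,
            volume_ball_eq _ ht0.le, ← mul_assoc,
            ENNReal.inv_mul_cancel (by simpa using pow_pos ht0 n) ENNReal.ofReal_ne_top, one_mul]
        · have e : ∀ y : Rn n, {q : Rn n × ℝ | q.1 ∈ ball x q.2 ∧ q.2 ∈ Ico a (2 * a)}.indicator
              (fun q => (ENNReal.ofReal (q.2 ^ n))⁻¹) (y, t) = 0 := fun y =>
            indicator_of_notMem (fun h => ht h.2) _
          simp_rw [e]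
          rw [lintegral_zero]
          exact zero_le
    _ = volume (ball (0 : Rn n) 1) * scaleMeasure (Ico a (2 * a)) := by
        rw [lintegral_indicator measurableSet_Ico, setLIntegral_const]
    _ ≤ _ := mul_le_of_le_one_right' (scaleMeasure_Ico_le ha)

/-- Hölder's inequality on the ball `ball y t`. -/
theorem intrinsicA_le_of_morrey [Nontrivial (Rn n)] (hα : 0 < α) (hα1 : α ≤ 1) {p q : ℝ}
    (hpq : p.HolderConjugate q) {f : Rn n → ℂ} (hf : AEStronglyMeasurable f volume) {K c : ℝ≥0∞}
    {y : Rn n} {t : ℝ} (ht : 0 < t) (h : ∫⁻ x in ball y t, ‖f x‖ₑ ^ p ≤ K ^ p * c) :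
    intrinsicA α f y t ≤
      2 * volume (ball (0 : Rn n) 1) ^ (1 / q) * K * (c / ENNReal.ofReal (t ^ n)) ^ (1 / p) := by
  have hp0 : 0 < p := hpq.pos
  have hq0 : 0 < q := hpq.symm.pos
  set T := ENNReal.ofReal (t ^ n) with hT
  have hT0 : T ≠ 0 := by simpa [hT] using pow_pos ht n
  have hTt : T ≠ ⊤ := ENNReal.ofReal_ne_top
  have hH : ∫⁻ x in ball y t, ‖f x‖ₑ ≤ K * c ^ (1 / p) * volume (ball y t) ^ (1 / q) := by
    have h1 := ENNReal.lintegral_mul_le_Lp_mul_Lq (volume.restrict (ball y t)) hpq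
      (f := fun x => ‖f x‖ₑ) (g := fun _ => 1) hf.enorm.restrict aemeasurable_const
    simp only [Pi.mul_apply, mul_one, ENNReal.one_rpow, setLIntegral_one] at h1
    refine h1.trans (mul_le_mul_left ?_ _)
    refine (ENNReal.rpow_le_rpow h (by positivity)).trans_eq ?_
    rw [ENNReal.mul_rpow_of_nonneg _ _ (by positivity), ← ENNReal.rpow_mul,
      mul_one_div_cancel hp0.ne', ENNReal.rpow_one]
  have e1 : ENNReal.ofReal (2 * (t ^ n)⁻¹) = 2 * T⁻¹ := by
    rw [ENNReal.ofReal_mul (by norm_num), ENNReal.ofReal_inv_of_pos (by positivity),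
      ENNReal.ofReal_ofNat]
  have e2 : T⁻¹ * T ^ (1 / q) = (T ^ (1 / p))⁻¹ := by
    rw [← ENNReal.rpow_neg_one, ← ENNReal.rpow_add _ _ hT0 hTt, ← ENNReal.rpow_neg]
    congr 1
    have := hpq.inv_add_inv_eq_one
    rw [one_div, one_div]; linarith
  refine (intrinsicA_le hα hα1 f y ht).trans ?_
  calc _ ≤ 2 * T⁻¹ * (K * c ^ (1 / p) * volume (ball y t) ^ (1 / q)) := by
        rw [e1]; exact mul_le_mul_right hH _
    _ = 2 * volume (ball (0 : Rn n) 1) ^ (1 / q) * K * (c ^ (1 / p) * (T⁻¹ * T ^ (1 / q))) := by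
        rw [volume_ball_eq _ ht.le, ENNReal.mul_rpow_of_nonneg _ _ (by positivity)]
        ring
    _ = _ := by
        rw [e2, ENNReal.div_rpow_of_nonneg _ _ (by positivity), div_eq_mul_inv (c ^ (1 / p))]

/-- The part of `f` outside `ball x₀ (2 * r)` has square function at most `C K (Φ(r) / rⁿ)^(1/p)` on
`ball x₀ r`. The dyadic slices of the cone contribute a geometric series of ratio `(D / 2ⁿ)^(2/p)`. -/
theorem exists_intrinsicSquare_far_le [Nontrivial (Rn n)] (hα : 0 < α) (hα1 : α ≤ 1) {p : ℝ}
    (hp : 1 < p) {Φ : ℝ → ℝ} {D : ℝ} (hΦ : IsGrowthFunction Φ D) (hD1 : 1 ≤ D) (hD : D < 2 ^ n) :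
    ∃ C : ℝ≥0∞, C ≠ ⊤ ∧ ∀ f : Rn n → ℂ, LocallyIntegrable f volume → ∀ K : ℝ≥0∞,
      (∀ (x₀ : Rn n) (r : ℝ), 0 < r →
        ∫⁻ x in ball x₀ r, ‖f x‖ₑ ^ p ≤ K ^ p * ENNReal.ofReal (Φ r)) →
      ∀ (x₀ : Rn n) (r : ℝ), 0 < r → ∀ x ∈ ball x₀ r,
        intrinsicSquare α ((ball x₀ (2 * r))ᶜ.indicator f) x ^ p ≤
          C * K ^ p * ENNReal.ofReal (Φ r / r ^ n) := by
  have hp0 : 0 < p := by linarith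
  have hpq := Real.HolderConjugate.conjExponent hp
  set q := p.conjExponent with hq
  set v := volume (ball (0 : Rn n) 1) with hv
  have hvt : v ≠ ⊤ := volume_unitBall_ne_top
  set c₁ : ℝ≥0∞ := 2 * v ^ (1 / q) with hc₁
  have hc₁t : c₁ ≠ ⊤ := ENNReal.mul_ne_top (by simp) (ENNReal.rpow_ne_top_of_nonneg
    (one_div_nonneg.2 hpq.symm.pos.le) hvt)
  set d := ENNReal.ofReal (D / 2 ^ n) with hd
  have hd1 : d < 1 := by
    rw [hd, ENNReal.ofReal_lt_one, div_lt_one (by positivity)]; exact hD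
  set ρ := d ^ (2 / p) with hρ
  have hρ1 : ρ < 1 := ENNReal.rpow_lt_one hd1 (by positivity)
  have hgeom : (1 - ρ)⁻¹ ≠ ⊤ := ENNReal.inv_ne_top.2 (tsub_pos_of_lt hρ1).ne'
  set c₂ : ℝ≥0∞ := c₁ ^ 2 * v * (1 - ρ)⁻¹ with hc₂
  have hc₂t : c₂ ≠ ⊤ := by finiteness
  refine ⟨c₂ ^ (p / 2) * ENNReal.ofReal (2 ^ n), ENNReal.mul_ne_top
    (ENNReal.rpow_ne_top_of_nonneg (by positivity) hc₂t) ENNReal.ofReal_ne_top,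
    fun f hf K hK x₀ r hr x hx => ?_⟩
  set f₂ := (ball x₀ (2 * r))ᶜ.indicator f with hf₂
  have hf₂m : AEStronglyMeasurable f₂ volume :=
    hf.aestronglyMeasurable.indicator measurableSet_ball.compl
  set R := ENNReal.ofReal (2 ^ n * (Φ r / r ^ n)) with hR
  set B := c₁ ^ 2 * K ^ 2 * R ^ (2 / p) with hB
  have hsq : intrinsicSquare α f₂ x ^ 2 ≤ c₂ * K ^ 2 * R ^ (2 / p) := by
    rw [intrinsicSquare_sq]
    calc _ ≤ ∫⁻ q, ∑' k : ℕ, B * ρ ^ k *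
          {q : Rn n × ℝ | q.1 ∈ ball x q.2 ∧ q.2 ∈ Ico (2 ^ k * (r / 2)) (2 * (2 ^ k * (r / 2)))}.indicator
            (fun q => (ENNReal.ofReal (q.2 ^ n))⁻¹) q ∂(upperMeasure n) := by
          refine lintegral_mono fun q => ?_
          by_cases hqx : q ∈ cone x
          swap
          · rw [indicator_of_notMem hqx]; exact zero_le
          rw [indicator_of_mem hqx]
          obtain ⟨y, t⟩ := q
          have ht : 0 < t := hqx.1
          have hyx : y ∈ ball x t := by rw [mem_ball', dist_eq_norm]; exact hqx.2
          simp only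
          -- at scales below `r / 2`, the ball `ball y t` stays inside `ball x₀ (2 * r)`
          rcases lt_or_ge t (r / 2) with htr | htr
          · have h0 : intrinsicA α f₂ y t = 0 := by
              rw [intrinsicA_congr (g := 0) hα ht]
              · simp [intrinsicA]
              · intro z hz
                rw [hf₂, indicator_of_notMem, Pi.zero_apply]
                rw [notMem_compl_iff, mem_ball]
                rw [mem_ball] at hz hx hyx
                have h1 := dist_triangle z y x₀
                have h2 := dist_triangle y x x₀
                linarith
            rw [h0]; simp
          · obtain ⟨k, hk1, hk2⟩ := exists_nat_pow_near (x := t / (r / 2)) (y := (2 : ℝ))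
              ((one_le_div (by positivity)).2 htr) one_lt_two
            rw [le_div_iff₀ (by positivity)] at hk1
            rw [div_lt_iff₀ (by positivity), pow_succ', mul_assoc] at hk2
            refine le_trans ?_ (ENNReal.le_tsum k)
            rw [indicator_of_mem (by exact ⟨hyx, hk1, hk2⟩), div_eq_mul_inv]
            refine mul_le_mul_left ?_ _
            have hΦt : ENNReal.ofReal (Φ t) / ENNReal.ofReal (t ^ n) ≤ R * d ^ k := by
              rw [← ENNReal.ofReal_div_of_pos (by positivity), hR, hd,
                ← ENNReal.ofReal_pow (by positivity), ← ENNReal.ofReal_mul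
                (mul_nonneg (by positivity) (div_nonneg (hΦ.pos r hr).le (by positivity)))]
              refine ENNReal.ofReal_le_ofReal ?_
              have h1 : Φ t ≤ D ^ k * Φ r := by
                refine (hΦ.mono ht (mem_Ioi.2 (by positivity)) ?_).trans
                  (hΦ.two_pow_mul_le (by linarith) hr k)
                linarith
              have h2 := (hΦ.pos r hr).le
              have h3 : (2 ^ k * (r / 2)) ^ n ≤ t ^ n := pow_le_pow_left₀ (by positivity) hk1 n
              calc Φ t / t ^ n ≤ (D ^ k * Φ r) / (2 ^ k * (r / 2)) ^ n :=
                    div_le_div₀ (by positivity) h1 (by positivity) h3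
                _ = _ := by
                  rw [div_pow D, ← pow_mul, mul_comm n k, pow_mul, mul_pow, div_pow r]
                  field_simp
            have hint : ∫⁻ z in ball y t, ‖f₂ z‖ₑ ^ p ≤ K ^ p * ENNReal.ofReal (Φ t) := by
              refine (lintegral_mono fun z => ?_).trans (hK y t ht)
              refine ENNReal.rpow_le_rpow ?_ hp0.le
              rw [hf₂, enorm_indicator_eq_indicator_enorm]
              exact indicator_le_self' (fun _ _ => zero_le) z
            calc intrinsicA α f₂ y t ^ 2 ≤ (c₁ * K * (R * d ^ k) ^ (1 / p)) ^ 2 := by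
                  refine pow_le_pow_left' ((intrinsicA_le_of_morrey hα hα1 hpq hf₂m ht hint).trans ?_) 2
                  exact mul_le_mul_right (ENNReal.rpow_le_rpow hΦt (by positivity)) _
              _ = B * ρ ^ k := by
                  rw [mul_pow, mul_pow, ← ENNReal.rpow_natCast (_ ^ (1 / p)), ← ENNReal.rpow_mul,
                    show 1 / p * ((2 : ℕ) : ℝ) = 2 / p by push_cast; ring,
                    ENNReal.mul_rpow_of_nonneg _ _ (by positivity), hB, hρ, ← ENNReal.rpow_natCast d,
                    ← ENNReal.rpow_natCast (d ^ (2 / p)), ← ENNReal.rpow_mul, ← ENNReal.rpow_mul,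
                    mul_comm (2 / p) (k : ℝ)]
                  ring
      _ ≤ ∑' k : ℕ, B * ρ ^ k * v := by
          have hm : ∀ k : ℕ, Measurable ({q : Rn n × ℝ | q.1 ∈ ball x q.2 ∧
              q.2 ∈ Ico (2 ^ k * (r / 2)) (2 * (2 ^ k * (r / 2)))}.indicator
              (fun q => (ENNReal.ofReal (q.2 ^ n))⁻¹)) := fun k =>
            Measurable.indicator (by fun_prop)
              ((measurableSet_lt (measurable_fst.dist measurable_const) measurable_snd).inter
                (measurableSet_Ico.preimage measurable_snd))
          rw [lintegral_tsum fun k => ((hm k).const_mul _).aemeasurable]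
          refine ENNReal.tsum_le_tsum fun k => ?_
          rw [lintegral_const_mul _ (hm k)]
          exact mul_le_mul_right (lintegral_upperMeasure_slice_le x (by positivity)) _
      _ = _ := by
          rw [ENNReal.tsum_mul_right, ENNReal.tsum_mul_left, ENNReal.tsum_geometric, hB, hc₂]
          ring
  have h2 := ENNReal.rpow_le_rpow hsq (z := p / 2) (by positivity)
  have e1 : ∀ a : ℝ≥0∞, (a ^ 2) ^ (p / 2) = a ^ p := fun a => by
    rw [← ENNReal.rpow_natCast, ← ENNReal.rpow_mul]; congr 1; push_cast; ring
  rw [e1, ENNReal.mul_rpow_of_nonneg _ _ (by positivity), ENNReal.mul_rpow_of_nonneg _ _ (by positivity),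
    e1, ← ENNReal.rpow_mul, show 2 / p * (p / 2) = 1 by field_simp, ENNReal.rpow_one, hR,
    ENNReal.ofReal_mul (by positivity)] at h2
  refine h2.trans_eq ?_
  ring

/-- The Morrey estimate on a single ball, for any admissible constant `K` of `f`. -/
theorem exists_setLIntegral_intrinsicSquare_rpow_le [Nontrivial (Rn n)] (hα : 0 < α) (hα1 : α ≤ 1)
    {p : ℝ} (hp : 1 < p) {Φ : ℝ → ℝ} {D : ℝ} (hΦ : IsGrowthFunction Φ D) (hD1 : 1 ≤ D)
    (hD : D < 2 ^ n) :
    ∃ C : ℝ≥0∞, C ≠ ⊤ ∧ ∀ f : Rn n → ℂ, LocallyIntegrable f volume → ∀ K : ℝ≥0∞,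
      (∀ (x₀ : Rn n) (r : ℝ), 0 < r →
        ∫⁻ x in ball x₀ r, ‖f x‖ₑ ^ p ≤ K ^ p * ENNReal.ofReal (Φ r)) →
      ∀ (x₀ : Rn n) (r : ℝ), 0 < r →
        ∫⁻ x in ball x₀ r, intrinsicSquare α f x ^ p ≤ C * K ^ p * ENNReal.ofReal (Φ r) := by
  have hp0 : 0 < p := by linarith
  obtain ⟨C₁, hC₁, hloc⟩ := exists_lintegral_intrinsicSquare_rpow_le (n := n) hα hα1 hp
  obtain ⟨C₂, hC₂, hfar⟩ := exists_intrinsicSquare_far_le (n := n) hα hα1 hp hΦ hD1 hD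
  set v := volume (ball (0 : Rn n) 1) with hv
  have hvt : v ≠ ⊤ := volume_unitBall_ne_top
  have h2p : (2 : ℝ≥0∞) ^ p ≠ ⊤ := ENNReal.rpow_ne_top_of_nonneg hp0.le (by simp)
  refine ⟨2 ^ p * (C₁ * ENNReal.ofReal D + C₂ * v), by finiteness, fun f hf K hK x₀ r hr => ?_⟩
  set E := ball x₀ (2 * r) with hE
  have hEm : MeasurableSet E := measurableSet_ball
  have hf₁ : Integrable (E.indicator f) := by
    rw [integrable_indicator_iff hEm]
    exact (hf.integrableOn_isCompact (isCompact_closedBall x₀ (2 * r))).mono_set ball_subset_closedBall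
  have hf₂ : LocallyIntegrable (Eᶜ.indicator f) volume := hf.indicator hEm.compl
  have hsum : f = E.indicator f + Eᶜ.indicator f := (indicator_self_add_compl E f).symm
  have hm₁ := measurable_intrinsicSquare hα hα1 hf₁.locallyIntegrable
  have h1 : ∫⁻ x, intrinsicSquare α (E.indicator f) x ^ p ≤
      C₁ * (K ^ p * (ENNReal.ofReal D * ENNReal.ofReal (Φ r))) := by
    refine (hloc _ hf₁).trans (mul_le_mul_right ?_ _)
    have e : ∫⁻ x, ‖E.indicator f x‖ₑ ^ p = ∫⁻ x in E, ‖f x‖ₑ ^ p := by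
      rw [← lintegral_indicator hEm]
      refine lintegral_congr fun x => ?_
      by_cases hx : x ∈ E
      · rw [indicator_of_mem hx, indicator_of_mem hx]
      · rw [indicator_of_notMem hx, indicator_of_notMem hx, enorm_zero, ENNReal.zero_rpow_of_pos hp0]
    rw [e]
    refine (hK x₀ (2 * r) (by positivity)).trans (mul_le_mul_right ?_ _)
    rw [← ENNReal.ofReal_mul (by linarith)]
    exact ENNReal.ofReal_le_ofReal (hΦ.doubling r hr)
  have h2 : ∫⁻ x in ball x₀ r, intrinsicSquare α (Eᶜ.indicator f) x ^ p ≤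
      C₂ * K ^ p * (v * ENNReal.ofReal (Φ r)) := by
    calc _ ≤ ∫⁻ x in ball x₀ r, C₂ * K ^ p * ENNReal.ofReal (Φ r / r ^ n) :=
          setLIntegral_mono' measurableSet_ball fun x hx => hfar f hf K hK x₀ r hr x hx
      _ = C₂ * K ^ p * (v * (ENNReal.ofReal (Φ r / r ^ n) * ENNReal.ofReal (r ^ n))) := by
          rw [setLIntegral_const, volume_ball_eq _ hr.le]; ring
      _ = _ := by
          rw [← ENNReal.ofReal_mul (div_nonneg (hΦ.pos r hr).le (by positivity)),
            div_mul_cancel₀ _ (by positivity)]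
  calc _ ≤ ∫⁻ x in ball x₀ r, 2 ^ p * (intrinsicSquare α (E.indicator f) x ^ p +
        intrinsicSquare α (Eᶜ.indicator f) x ^ p) := by
        refine lintegral_mono fun x => ?_
        have h3 := intrinsicSquare_add_le hα hα1 hf₁.locallyIntegrable hf₂ x
        rw [← hsum] at h3
        refine (ENNReal.rpow_le_rpow h3 hp0.le).trans ?_
        rw [ENNReal.mul_rpow_of_nonneg _ _ hp0.le]
        refine mul_le_mul_right ?_ _
        rcases le_total (intrinsicSquare α (E.indicator f) x)
          (intrinsicSquare α (Eᶜ.indicator f) x) with h | h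
        · rw [max_eq_right h]; exact le_add_self
        · rw [max_eq_left h]; exact le_self_add
    _ = 2 ^ p * ((∫⁻ x in ball x₀ r, intrinsicSquare α (E.indicator f) x ^ p) +
        ∫⁻ x in ball x₀ r, intrinsicSquare α (Eᶜ.indicator f) x ^ p) := by
        rw [lintegral_const_mul' _ _ h2p, lintegral_add_left (hm₁.pow_const p)]
    _ ≤ 2 ^ p * (C₁ * (K ^ p * (ENNReal.ofReal D * ENNReal.ofReal (Φ r))) +
        C₂ * K ^ p * (v * ENNReal.ofReal (Φ r))) :=
        mul_le_mul_right (add_le_add ((setLIntegral_le_lintegral _ _).trans h1) h2) _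
    _ = _ := by ring

end

theorem theorem1p1 (n : ℕ) (α p : ℝ) (hα : 0 < α) (hα1 : α ≤ 1) (hp : 1 < p)
    (Φ : ℝ → ℝ) (D : ℝ) (hΦ : IsGrowthFunction Φ D) (hD1 : 1 ≤ D) (hD : D < 2 ^ n) :
    ∃ C : ℝ, 0 < C ∧ ∀ f : Rn n → ℂ, MemMorrey p Φ f →
      MemMorrey p Φ (intrinsicSquare α f) ∧
      morreyNorm p Φ (intrinsicSquare α f) ≤ ENNReal.ofReal C * morreyNorm p Φ f := by
  have hp0 : 0 < p := by linarith
  -- for `n = 0` there is no `D` with `1 ≤ D < 2 ^ n`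
  have hn : n ≠ 0 := by
    rintro rfl
    norm_num at hD
    linarith
  have : Nonempty (Fin n) := ⟨⟨0, Nat.pos_of_ne_zero hn⟩⟩
  obtain ⟨E, hE, hmain⟩ := exists_setLIntegral_intrinsicSquare_rpow_le (n := n) hα hα1 hp hΦ hD1 hD
  have hEp : E ^ (1 / p) ≠ ⊤ := ENNReal.rpow_ne_top_of_nonneg (by positivity) hE
  -- the summand `1` keeps the constant positive
  set C : ℝ := (E ^ (1 / p)).toReal + 1 with hC
  have hC0 : 0 < C := by positivity
  have hEC : E ≤ ENNReal.ofReal C ^ p := by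
    have h1 : E ^ (1 / p) ≤ ENNReal.ofReal C := by
      rw [hC, ENNReal.ofReal_add ENNReal.toReal_nonneg zero_le_one, ENNReal.ofReal_toReal hEp]
      exact le_self_add
    have h2 := ENNReal.rpow_le_rpow h1 hp0.le
    rwa [← ENNReal.rpow_mul, one_div_mul_cancel hp0.ne', ENNReal.rpow_one] at h2
  refine ⟨C, hC0, fun f hf => ?_⟩
  have hfl := hf.1
  have hbound : ∀ K : ℝ≥0∞, (∀ (x₀ : Rn n) (r : ℝ), 0 < r →
        ∫⁻ x in ball x₀ r, ‖f x‖ₑ ^ p ≤ K ^ p * ENNReal.ofReal (Φ r)) →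
      ∀ (x₀ : Rn n) (r : ℝ), 0 < r → ∫⁻ x in ball x₀ r, ‖intrinsicSquare α f x‖ₑ ^ p ≤
        (ENNReal.ofReal C * K) ^ p * ENNReal.ofReal (Φ r) := by
    intro K hK x₀ r hr
    simp only [enorm_eq_self]
    refine (hmain f hfl K hK x₀ r hr).trans ?_
    rw [ENNReal.mul_rpow_of_nonneg _ _ hp0.le]
    gcongr
  have hnorm : morreyNorm p Φ (intrinsicSquare α f) ≤ ENNReal.ofReal C * morreyNorm p Φ f := by
    have hCe : ENNReal.ofReal C ≠ 0 := by simpa using hC0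
    rw [mul_comm, ← ENNReal.div_le_iff hCe ENNReal.ofReal_ne_top]
    refine le_sInf fun K hK => ?_
    rw [ENNReal.div_le_iff hCe ENNReal.ofReal_ne_top, mul_comm]
    exact sInf_le (hbound K hK)
  -- local integrability: on a ball of radius one, `S ≤ 1 + Sᵖ`
  refine ⟨⟨fun x => ?_, hnorm.trans_lt (ENNReal.mul_lt_top ENNReal.ofReal_lt_top hf.2)⟩, hnorm⟩
  obtain ⟨K, hK, hKt⟩ := sInf_lt_iff.1 hf.2
  refine ⟨ball x 1, ball_mem_nhds x one_pos,
    (measurable_intrinsicSquare hα hα1 hfl).aestronglyMeasurable, ?_⟩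
  have h1 := hbound K hK x 1 one_pos
  rw [hasFiniteIntegral_iff_enorm]
  calc ∫⁻ y in ball x 1, ‖intrinsicSquare α f y‖ₑ
      ≤ ∫⁻ y in ball x 1, (1 + ‖intrinsicSquare α f y‖ₑ ^ p) := by
        refine lintegral_mono fun y => ?_
        simp only [enorm_eq_self]
        rcases le_total (intrinsicSquare α f y) 1 with h | h
        · exact h.trans le_self_add
        · refine le_trans ?_ le_add_self
          conv_lhs => rw [← ENNReal.rpow_one (intrinsicSquare α f y)]
          exact ENNReal.rpow_le_rpow_of_exponent_le h hp.le
    _ = volume (ball x 1) + ∫⁻ y in ball x 1, ‖intrinsicSquare α f y‖ₑ ^ p := by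
        rw [lintegral_add_left measurable_const, setLIntegral_one]
    _ < ⊤ := by
        refine ENNReal.add_lt_top.2 ⟨measure_ball_lt_top, h1.trans_lt ?_⟩
        exact ENNReal.mul_lt_top (ENNReal.rpow_lt_top_of_nonneg hp0.le
          (ENNReal.mul_ne_top ENNReal.ofReal_ne_top hKt.ne)) ENNReal.ofReal_lt_top
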